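/- **Setting.** Let $E$ be an elliptic curve over $\overline{\mathbb Q}$ without complex multiplication, i.e. $\mathrm{End}(E)=\mathbb Z$, so that morphisms $\phi:E^g\to E^r$ of algebraic groups are identified with matrices in $M_{r\times g}(\mathbb Z)$; write $B_\phi=\ker\phi\subset E^g(\overline{\mathbb Q})$ and $H(\phi)$ for the maximum of the absolute values of the entries of $\phi$. Fix a symmetric very ample line bundle $\mathcal L$ on $E$, of degree $d\ge 3$, and let $h$ be the $\mathcal L$-canonical Néron–Tate height on $E(\overline{\mathbb Q})$, i.e. $h=d\,\hat h$ with $\hat h(P)=\frac12\lim_{k\to\infty}4^{-k}h_{\rm Weil}(x([2^k]P))$. On $E^g(\overline{\mathbb Q})$ put $h(x_1,\dots,x_g)=\max_i h(x_i)$ and $\|x\|=h(x)^{1/2}$, and let $\mathcal O_\varepsilon=\{\xi:\|\xi\|\le\varepsilon\}$. The norm of a set of bounded height is the supremum of the norms of its elements ($0$ for the empty set). For $V,F\subset E^g(\overline{\mathbb Q})$ let $S_r(V,F)$ be the set of $x\in V$ such that $x\in B+F$ for some abelian subvariety $B\subset E^g$ of codimension at least $r$. Let $C\subset E^g$ be an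 irreducible algebraic curve over $\overline{\mathbb Q}$ that is transverse, i.e. not contained in any translate of a proper algebraic subgroup of $E^g$. Let $\Gamma\subset E^g(\overline{\mathbb Q})$ be a subgroup of finite rank and let $\Gamma_0\subset E(\overline{\mathbb Q})$ be the division group of the group generated by the coordinates of the elements of $\Gamma$, i.e. the group of all $P$ such that $NP$ lies in that group for some integer $N\neq 0$. Put $(\Gamma_0^g)_\varepsilon=\Gamma_0^g+\mathcal O_\varepsilon$. Let $s$ be the rank of $\Gamma_0$ and let $\gamma=(\gamma_1,\dots,\gamma_s)\in E^s(\overline{\mathbb Q})$, where $\gamma_1,\dots,\gamma_s\in\Gamma_0$ are linearly independent over $\mathbb Z$. A matrix $\phi\in M_{r\times g}(\mathbb Z)$ is *Gauss-reduced of rank $r$* if $aI_r$ is a submatrix of $\phi$ for some integer $a\ne0$ with $H(\phi)=a$, and the entries of $\phi$ have no common factor except $\pm1$. A matrix $\tilde\phi\in M_{r\times(g+s)}(\mathbb Z)$ is *special of rank $r$* if $\tilde\phi=(N\phi\,|\,\phi')$ with an integer $N\ge1$, a Gauss-reduced $\phi\in M_{r\times g}(\mathbb Z)$ of rank $r$ and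 $\phi'\in M_{r\times s}(\mathbb Z)$, its entries have no common factor except $\pm1$, and $H(\tilde\phi)=N\,H(\phi)$. **Proposition A.** Let $r\ge2$. (i) Let $\varepsilon_1>0$ be such that $S_2(C,(\Gamma_0^g)_{\varepsilon_1})$ has bounded height, and let $K_1$ be its norm. If $0<\varepsilon\le\varepsilon_1$, then $$\bigcup_{\phi}C(\overline{\mathbb Q})\cap\Big(B_\phi+(\Gamma_0^g)_{\varepsilon/M^{1+\frac1{2n}}}\Big)\ \subset\ \bigcup_{H(\psi)\le M}C(\overline{\mathbb Q})\cap\Big(B_\psi+(\Gamma_0^g)_{g\varepsilon/H(\psi)^{1+\frac1{2n}}}\Big),$$ where $\phi$ and $\psi$ range over the Gauss-reduced morphisms $E^g\to E^r$ of rank $r$, $n=rg-r^2+1$ and $M=\max\big(2,\lceil K_1/\varepsilon\rceil^2\big)^n$. (ii) Let $\varepsilon_2>0$ be such that $S_2(C\times\gamma,\mathcal O_{\varepsilon_2})$ (formed in $E^{g+s}$) has bounded height, and let $K_2$ be its norm. If $0<\varepsilon\le\varepsilon_2$, then $$\bigcup_{\tilde\phi}(C(\overline{\mathbb Q})\times\gamma)\cap\Big(B_{\tilde\phi}+\mathcal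 O_{\varepsilon/M'^{\,1+\frac1{2n}}}\Big)\ \subset\ \bigcup_{H(\tilde\psi)\le M'}(C(\overline{\mathbb Q})\times\gamma)\cap\Big(B_{\tilde\psi}+\mathcal O_{(g+s)\varepsilon/H(\tilde\psi)^{1+\frac1{2n}}}\Big),$$ where $\tilde\phi$ and $\tilde\psi$ range over the special morphisms $E^{g+s}\to E^r$ of rank $r$, $n=r(g+s)-r^2+1$ and $M'=\max\big(2,\lceil K_2/\varepsilon\rceil^2\big)^n$. -/

import Mathlib

open scoped Pointwise Topology

noncomputable section

namespace EllipticPower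

/-- The field of algebraic numbers. -/
abbrev QBar : Type := AlgebraicClosure ℚ

/-- Decidable equality on `QBar`, needed for Mathlib's group law on Weierstrass curves. -/
instance decEqQBar : DecidableEq QBar := Classical.decEq _

/-- The group `E(QBar)`: the point at infinity and the affine points. -/
abbrev Pt (E : WeierstrassCurve QBar) : Type := E.toAffine.Point

/-- The group `E^g(QBar)`. -/
abbrev Pow (E : WeierstrassCurve QBar) (g : ℕ) : Type := Fin g → Pt E

variable {E : WeierstrassCurve QBar}

/-! ### Algebraic geometry of `E^g` -/

/-- Homogeneous coordinates in the projective plane of a point of `E`. -/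
def homCoord : Pt E → Fin 3 → QBar
  | .zero => ![0, 1, 0]
  | .some x y _ => ![x, y, 1]

/-- Polynomials in the `g` blocks of three variables `(i, 0), (i, 1), (i, 2)` that are homogeneous
in each block separately, i.e. the forms on the product of `g` projective planes. -/
def IsMultiHomogeneous {g : ℕ} (p : MvPolynomial (Fin g × Fin 3) QBar) : Prop :=
  ∃ m : Fin g → ℕ,
    p.IsWeightedHomogeneous (fun v : Fin g × Fin 3 => (Pi.single v.1 1 : Fin g → ℕ)) m

/-- The value of a form at the homogeneous coordinates of `x`; only its vanishing has a meaning. -/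
def evalAt {g : ℕ} (p : MvPolynomial (Fin g × Fin 3) QBar) (x : Pow E g) : QBar :=
  MvPolynomial.eval (fun v => homCoord (x v.1) v.2) p

/-- The Zariski topology on `E^g(QBar)`, as a subvariety of a product of `g` projective planes. -/
@[reducible] def zariski (E : WeierstrassCurve QBar) (g : ℕ) : TopologicalSpace (Pow E g) :=
  TopologicalSpace.generateFrom
    {U | ∃ p : MvPolynomial (Fin g × Fin 3) QBar, IsMultiHomogeneous p ∧
      U = {x : Pow E g | evalAt p x ≠ 0}}

/-- Dimension of a subset of `E^g`: Krull dimension for the induced Zariski topology. -/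
def zdim {g : ℕ} (V : Set (Pow E g)) : WithBot ℕ∞ :=
  @topologicalKrullDim V (TopologicalSpace.induced Subtype.val (zariski E g))

/-- Irreducible algebraic curves in `E^g`, given by their set of algebraic points. -/
structure IsIrreducibleCurve {g : ℕ} (C : Set (Pow E g)) : Prop where
  closed : IsClosed[zariski E g] C
  irreducible : @IsIrreducible _ (zariski E g) C
  dim_eq_one : zdim C = 1

/-- Algebraic subgroups of `E^g`. -/
def IsAlgebraicSubgroup {g : ℕ} (B : AddSubgroup (Pow E g)) : Prop :=
  IsClosed[zariski E g] (B : Set (Pow E g))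

/-- Abelian subvarieties of `E^g`: irreducible algebraic subgroups. -/
def IsAbelianSubvariety {g : ℕ} (B : AddSubgroup (Pow E g)) : Prop :=
  IsAlgebraicSubgroup B ∧ @IsIrreducible _ (zariski E g) (B : Set (Pow E g))

/-- `C` is not contained in any translate of a proper algebraic subgroup. -/
def IsTransverse {g : ℕ} (C : Set (Pow E g)) : Prop :=
  ∀ B : AddSubgroup (Pow E g), IsAlgebraicSubgroup B → B ≠ ⊤ →
    ∀ t : Pow E g, ¬ C ⊆ {t} + (B : Set (Pow E g))

/-- A map `E → E` is a morphism of varieties: around every point it is given by three forms of the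
same degree without a common zero at that point. -/
def IsMorphism (f : Pt E → Pt E) : Prop :=
  ∀ P : Pt E, ∃ (m : ℕ) (F : Fin 3 → MvPolynomial (Fin 3) QBar),
    (∀ k, (F k).IsHomogeneous m) ∧
    (∃ k, MvPolynomial.eval (homCoord P) (F k) ≠ 0) ∧
    ∀ (Q : Pt E) (k l : Fin 3),
      MvPolynomial.eval (homCoord Q) (F k) * homCoord (f Q) l =
        MvPolynomial.eval (homCoord Q) (F l) * homCoord (f Q) k

/-- `E` has no complex multiplication: every endomorphism is the multiplication by an integer. -/
def NoCM (E : WeierstrassCurve QBar) : Prop :=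
  ∀ f : Pt E →+ Pt E, IsMorphism f → ∃ m : ℤ, ∀ P : Pt E, f P = m • P

/-- The set `S_r(V, F)`: the points of `V` in `B + F` for some abelian subvariety `B` of `E^g` of
codimension at least `r`. -/
def SSet {g : ℕ} (r : ℕ) (V F : Set (Pow E g)) : Set (Pow E g) :=
  {x | x ∈ V ∧ ∃ B : AddSubgroup (Pow E g), IsAbelianSubvariety B ∧
    zdim (B : Set (Pow E g)) + (r : WithBot ℕ∞) ≤ (g : WithBot ℕ∞) ∧
    x ∈ (B : Set (Pow E g)) + F}

/-! ### Heights -/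

/-- The absolute logarithmic Weil height of the `x`-coordinate. -/
def naiveHeight : Pt E → ℝ
  | .zero => 0
  | .some x _ _ => NumberField.absLogHeight₁ x

/-- The Néron-Tate height on `E(QBar)` attached to the divisor `(O)`. -/
def canonicalHeight (P : Pt E) : ℝ :=
  (1 / 2) * Filter.limUnder Filter.atTop (fun k : ℕ => naiveHeight ((2 ^ k : ℕ) • P) / (4 : ℝ) ^ k)

/-- The canonical height on `E(QBar)` attached to a symmetric line bundle of degree `d`: it is `d`
times the one attached to `(O)`, and does not depend on the line bundle otherwise. -/
def ptHeight (d : ℕ) (P : Pt E) : ℝ := d * canonicalHeight P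

/-- The height of the maximum on `E^g(QBar)`. -/
def height (d : ℕ) {g : ℕ} (x : Pow E g) : ℝ := ⨆ i, ptHeight d (x i)

/-- The seminorm `‖x‖ = h(x)^(1/2)` on `E^g(QBar)`. -/
def hnorm (d : ℕ) {g : ℕ} (x : Pow E g) : ℝ := √(height d x)

/-- The set `O_ε` of points of norm at most `ε`. -/
def smallPts (E : WeierstrassCurve QBar) (d g : ℕ) (ε : ℝ) : Set (Pow E g) :=
  {x | hnorm d x ≤ ε}

/-- A set of points has bounded height. -/
def HasBoundedHeight (d : ℕ) {g : ℕ} (S : Set (Pow E g)) : Prop :=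
  BddAbove (height d '' S)

/-- The norm of a set of bounded height: the square root of the supremum of the heights of its
elements (with value `0` for the empty set). -/
def setNorm (d : ℕ) {g : ℕ} (S : Set (Pow E g)) : ℝ := √(sSup (height d '' S))

/-! ### Subgroups of finite rank -/

/-- The subgroup has finite rank over `ℤ`. -/
def HasFiniteRank {g : ℕ} (Γ : AddSubgroup (Pow E g)) : Prop :=
  Module.rank ℤ Γ < Cardinal.aleph0

/-- The group generated by the coordinates of the elements of `Γ`. -/
def coordGroup {g : ℕ} (Γ : AddSubgroup (Pow E g)) : AddSubgroup (Pt E) :=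
  AddSubgroup.closure {P | ∃ y ∈ Γ, ∃ i, y i = P}

/-- The division group `Γ₀` of the group of coordinates of `Γ`. -/
def divisionGroup {g : ℕ} (Γ : AddSubgroup (Pow E g)) : AddSubgroup (Pt E) where
  carrier := {P | ∃ N : ℤ, N ≠ 0 ∧ N • P ∈ coordGroup Γ}
  zero_mem' := ⟨1, one_ne_zero, by simp [zero_mem]⟩
  add_mem' := by
    rintro P Q ⟨N, hN, hP⟩ ⟨N', hN', hQ⟩
    refine ⟨N' * N, mul_ne_zero hN' hN, ?_⟩
    have h : (N' * N) • (P + Q) = N' • (N • P) + N • (N' • Q) := by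
      rw [← mul_zsmul', ← mul_zsmul', mul_comm N' N]
      exact zsmul_add P Q _
    rw [h]
    exact add_mem (zsmul_mem hP N') (zsmul_mem hQ N)
  neg_mem' := by
    rintro P ⟨N, hN, hP⟩
    exact ⟨N, hN, by
      have h : N • (-P) = -(N • P) := zsmul_neg P N
      rw [h]
      exact neg_mem hP⟩

/-- The neighbourhood `(Γ₀^g)_ε = Γ₀^g + O_ε`. -/
def thickening (d : ℕ) {g : ℕ} (Γ : AddSubgroup (Pow E g)) (ε : ℝ) : Set (Pow E g) :=
  {y : Pow E g | ∀ i, y i ∈ divisionGroup Γ} + smallPts E d g ε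

/-- `γ₁, …, γ_s` is a maximal free set of `Γ₀`, whose rank is `s`. -/
structure IsMaximalFreeSet {g s : ℕ} (Γ : AddSubgroup (Pow E g)) (γ : Pow E s) : Prop where
  rank_eq : Module.rank ℤ (divisionGroup Γ) = s
  mem : ∀ i, γ i ∈ divisionGroup Γ
  linearIndependent : LinearIndependent ℤ γ

/-- The set `V × γ` in `E^(g+s)`. -/
def prodPoint {g s : ℕ} (V : Set (Pow E g)) (γ : Pow E s) : Set (Pow E (g + s)) :=
  (fun x => Fin.append x γ) '' V

/-! ### Morphisms `E^g → E^r` as integral matrices -/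

/-- The morphism `E^g → E^r` with matrix `φ`. -/
def toHom (E : WeierstrassCurve QBar) {r g : ℕ} (φ : Matrix (Fin r) (Fin g) ℤ) :
    Pow E g →+ Pow E r where
  toFun x i := ∑ j, φ i j • x j
  map_zero' := funext fun i => Finset.sum_eq_zero fun j _ => zsmul_zero (φ i j)
  map_add' x y := funext fun i =>
    (Finset.sum_congr rfl fun j _ => zsmul_add (x j) (y j) (φ i j)).trans
      Finset.sum_add_distrib

/-- The kernel `B_φ`. -/
def kerSubgroup (E : WeierstrassCurve QBar) {r g : ℕ} (φ : Matrix (Fin r) (Fin g) ℤ) :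
    AddSubgroup (Pow E g) := (toHom E φ).ker

/-- The height `H(φ)`: the maximum of the absolute values of the entries. -/
def matHeight {r g : ℕ} (φ : Matrix (Fin r) (Fin g) ℤ) : ℕ :=
  Finset.univ.sup fun i => Finset.univ.sup fun j => (φ i j).natAbs

/-- The entries have no common factor but units. -/
def IsPrimitive {r g : ℕ} (φ : Matrix (Fin r) (Fin g) ℤ) : Prop :=
  ∀ (f : ℤ) (φ' : Matrix (Fin r) (Fin g) ℤ), φ = f • φ' → IsUnit f

/-- Gauss-reduced morphisms of rank `r`. Surjectivity follows from `a ≠ 0`, because `a • 1` is a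
submatrix with `r` columns. -/
def IsGaussReduced {r g : ℕ} (φ : Matrix (Fin r) (Fin g) ℤ) : Prop :=
  (∃ (a : ℤ) (σ : Fin r ↪o Fin g), a ≠ 0 ∧
    φ.submatrix id σ = a • (1 : Matrix (Fin r) (Fin r) ℤ) ∧ (matHeight φ : ℤ) = a) ∧
  IsPrimitive φ

/-- The matrix `(Nφ | φ')`. -/
def blockMatrix {r g s : ℕ} (N : ℕ) (φ : Matrix (Fin r) (Fin g) ℤ)
    (φ' : Matrix (Fin r) (Fin s) ℤ) : Matrix (Fin r) (Fin (g + s)) ℤ :=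
  Matrix.of fun i => Fin.append (fun j => (N : ℤ) * φ i j) (φ' i)

/-- Special morphisms `E^(g+s) → E^r` of rank `r`: the quasi-special `(Nφ | φ')`, where `φ` is
Gauss-reduced and there is no common factor, of height `N H(φ)`. -/
def IsSpecial {r : ℕ} (g s : ℕ) (φt : Matrix (Fin r) (Fin (g + s)) ℤ) : Prop :=
  ∃ (N : ℕ) (φ : Matrix (Fin r) (Fin g) ℤ) (φ' : Matrix (Fin r) (Fin s) ℤ),
    0 < N ∧ φt = blockMatrix N φ φ' ∧ IsGaussReduced φ ∧ IsPrimitive φt ∧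
    matHeight φt = N * matHeight φ

/-- The bound `max(2, ⌈K/ε⌉²)^n`. -/
def heightBound (n : ℕ) (K ε : ℝ) : ℕ := max 2 (⌈K / ε⌉₊ ^ 2) ^ n

/-- The number `H^(1 + 1/(2n))`. -/
def radiusPow (n H : ℕ) : ℝ := (H : ℝ) ^ (1 + 1 / (2 * (n : ℝ)))

end EllipticPower

end

/-! A point close to the kernel of a matrix of huge height is also close to the kernel of a matrix
of small height, obtained by rational approximation. Let `x = b + y + ξ` with `φ b = 0`, `y` in
`Γ₀^g` and `‖ξ‖ ≤ δ`, where `φ` contains `a I_r` and `a = H(φ)`. If `a ≤ M`, then `φ` itself serves.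
Otherwise Dirichlet's theorem, applied to the `r(g - r)` remaining entries of `φ / a`, gives an
integral `ψ` containing `f I_r` in the same columns, with `f ≤ Q^(r(g-r)) ≤ M`, such that the
entries of `D = aψ - fφ` are at most `a / Q`. Taking `f` minimal makes `ψ` primitive.

From `aψ(x - ξ) = fφ(y) + D(x - ξ)`, divisibility of `E` yields a correction `v` with `a f v = D(x -
ξ)`. Placed in the distinguished columns, it moves `x - ξ` into `B_ψ + Γ₀^g`, and `‖v‖ ≤ (g - r)(‖x‖
+ δ) / (Q f)`. The norm of `x` is at most `K`: up to torsion, which `Γ₀` absorbs, the kernel of `φ`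
is an abelian subvariety of codimension at least 2, so `x` lies in the set `S_2` whose height is
bounded by hypothesis. As `K ≤ ε√Q` and `f^(1/(2n)) ≤ √Q`, the total error is at most `(g - r + 2)ε
/ f^(1 + 1/(2n))`, and `g - r + 2 ≤ g` because `r ≥ 2`. This is
`exists_matHeight_le_mem_ker_add_thickening`.

Both inclusions are instances of it. The second is the case of the trivial subgroup of `E^(g+s)`,
since torsion has norm zero, and special matrices are the primitive ones with a Gauss-reduced shape
in columns among the first `g` (`isSpecial_iff`).

Three foundations are needed. The norm is homogeneous and subadditive, by the parallelogram law for
the canonical height. The group of algebraic points is divisible (`exists_zsmul_eq`) and has a point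
of infinite order. The neutral component of a kernel is irreducible of the right codimension, which
rests on the irreducibility of `E^g` and the bound `g` for its Krull dimension. -/

noncomputable section

/-! ### Heights and extensions of number fields -/

namespace NumberField

open Height

variable {K L : Type*} [Field K] [NumberField K] [Field L] [NumberField L] [Algebra K L]

/-- A product over the infinite places with multiplicities is a product over the embeddings. -/
lemma prod_infinitePlace_pow_mult {K : Type*} [Field K] [NumberField K] (F : InfinitePlace K → ℝ) :
    ∏ w : InfinitePlace K, F w ^ w.mult = ∏ σ : K →+* ℂ, F (InfinitePlace.mk σ) := by
  classical
  rw [← Finset.prod_fiberwise Finset.univ InfinitePlace.mk]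
  refine Finset.prod_congr rfl fun w _ => ?_
  rw [Finset.prod_congr rfl (fun φ hφ => by rw [(Finset.mem_filter.mp hφ).2]), Finset.prod_const,
    InfinitePlace.card_filter_mk_eq]

/-- The embeddings of `L` are grouped by their restriction to `K`. The fibre over `τ` consists of
the `K`-algebra maps `L → ℂ` for the structure on `ℂ` given by `τ`, and there are `[L : K]` of them.
-/
lemma prod_embeddings_comp_algebraMap (F : (K →+* ℂ) → ℝ) :
    ∏ σ : L →+* ℂ, F (σ.comp (algebraMap K L)) =
      (∏ τ : K →+* ℂ, F τ) ^ Module.finrank K L := by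
  classical
  rw [← Finset.prod_fiberwise Finset.univ (fun σ : L →+* ℂ => σ.comp (algebraMap K L)),
    ← Finset.prod_pow]
  refine Finset.prod_congr rfl fun τ _ => ?_
  rw [Finset.prod_congr rfl (fun φ hφ => by rw [(Finset.mem_filter.mp hφ).2]), Finset.prod_const]
  congr 1
  let := τ.toAlgebra
  rw [← AlgHom.card K L ℂ, ← Fintype.card_subtype]
  refine Fintype.card_congr
    { toFun := fun σ => { σ.1 with commutes' := fun x => congrArg (fun f => f x) σ.2 }
      invFun := fun σ => ⟨σ.toRingHom, RingHom.ext fun x => σ.commutes x⟩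
      left_inv := fun σ => rfl
      right_inv := fun σ => rfl }

/-- For integral coordinates the finite places contribute the inverse norm of the ideal they
generate, and extending an ideal to `L` raises its norm to the power `[L : K]`. The infinite places
contribute a product over embeddings. -/
lemma mulHeight_algebraMap_ringOfIntegers {ι : Type*} [Finite ι] {a : ι → 𝓞 K} (ha : a ≠ 0) :
    mulHeight (fun i => algebraMap K L (a i)) =
      mulHeight (fun i => (a i : K)) ^ Module.finrank K L := by
  let b : ι → 𝓞 L := fun i => algebraMap (𝓞 K) (𝓞 L) (a i)
  have hb : b ≠ 0 := by
    obtain ⟨i, hi⟩ := Function.ne_iff.mp ha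
    refine Function.ne_iff.mpr ⟨i, ?_⟩
    simpa [b] using hi
  have hbL : (fun i => algebraMap K L (a i)) = fun i => (b i : L) := rfl
  have ha' : (fun i => (a i : K)) ≠ 0 := by
    obtain ⟨i, hi⟩ := Function.ne_iff.mp ha
    exact Function.ne_iff.mpr ⟨i, by simpa using hi⟩
  have hb' : (fun i => (b i : L)) ≠ 0 := by
    obtain ⟨i, hi⟩ := Function.ne_iff.mp hb
    exact Function.ne_iff.mpr ⟨i, by simpa using hi⟩
  have h1 := absNorm_mul_finprod_finitePlace_eq_one ha
  have h2 := absNorm_mul_finprod_finitePlace_eq_one hb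
  have h3 : Ideal.span (Set.range b) =
      (Ideal.span (Set.range a)).map (algebraMap (𝓞 K) (𝓞 L)) := by
    rw [Ideal.map_span, ← Set.range_comp]; rfl
  have h4 : Module.finrank (𝓞 K) (𝓞 L) = Module.finrank K L :=
    (IsFractionRing.finrank_eq (𝓞 K) K (𝓞 L) L).symm
  rw [h3, Ideal.absNorm_algebraMap, h4] at h2
  push_cast at h2
  rw [hbL, mulHeight_eq ha', mulHeight_eq hb', mul_pow]
  congr 1
  · rw [prod_infinitePlace_pow_mult (fun w => ⨆ i, w (b i : L)),
      prod_infinitePlace_pow_mult (fun w => ⨆ i, w (a i : K)),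
      ← prod_embeddings_comp_algebraMap (L := L)
        (fun τ => ⨆ i, (InfinitePlace.mk τ) (a i : K))]
    rfl
  · have h5 := congrArg (· ^ Module.finrank K L) h1
    simp only [mul_pow, one_pow] at h5
    have h6 : ((Ideal.span (Set.range a)).absNorm : ℝ) ^ Module.finrank K L ≠ 0 :=
      left_ne_zero_of_mul_eq_one h5
    exact mul_left_cancel₀ h6 (h2.trans h5.symm)

lemma mulHeight₁_algebraMap (x : K) :
    mulHeight₁ (algebraMap K L x) = mulHeight₁ x ^ Module.finrank K L := by
  obtain ⟨a, b, hb, rfl⟩ := IsFractionRing.div_surjective (A := 𝓞 K) x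
  have hb0 : b ≠ 0 := nonZeroDivisors.ne_zero hb
  have h : (![a, b] : Fin 2 → 𝓞 K) ≠ 0 := Function.ne_iff.mpr ⟨1, by simpa using hb0⟩
  have := mulHeight_algebraMap_ringOfIntegers (L := L) h
  rw [map_div₀, mulHeight₁_div_eq_mulHeight, mulHeight₁_div_eq_mulHeight]
  convert this using 2
  · ext i; fin_cases i <;> rfl
  · congr 1
    ext i; fin_cases i <;> rfl

/-- The absolute height can be computed in every number field containing the element. -/
lemma absLogHeight₁_algebraMap {F : Type*} [Field F] [CharZero F] {L : Type*} [Field L]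
    [NumberField L] [Algebra L F] (x : L) :
    absLogHeight₁ (algebraMap L F x) = logHeight₁ x / Module.finrank ℚ L := by
  have hx : IsIntegral ℚ (algebraMap L F x) :=
    (Algebra.IsIntegral.isIntegral (R := ℚ) x).map (algebraMap L F).toRatAlgHom
  rw [absLogHeight₁, absMulHeight₁, dif_pos hx, logHeight₁]
  have : FiniteDimensional ℚ (IntermediateField.adjoin ℚ {algebraMap L F x}) :=
    IntermediateField.adjoin.finiteDimensional hx
  have : NumberField (IntermediateField.adjoin ℚ {algebraMap L F x}) := {}
  have hle : IntermediateField.adjoin ℚ {algebraMap L F x} ≤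
      (algebraMap L F).toRatAlgHom.fieldRange := by
    rw [IntermediateField.adjoin_le_iff, Set.singleton_subset_iff]
    exact ⟨x, rfl⟩
  let e : L ≃ₐ[ℚ] (algebraMap L F).toRatAlgHom.fieldRange :=
    AlgEquiv.ofInjectiveField (algebraMap L F).toRatAlgHom
  let f : IntermediateField.adjoin ℚ {algebraMap L F x} →ₐ[ℚ] L :=
    e.symm.toAlgHom.comp (IntermediateField.inclusion hle)
  have hf : f (IntermediateField.AdjoinSimple.gen ℚ (algebraMap L F x)) = x := by
    refine e.symm_apply_eq.mpr (Subtype.ext ?_)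
    rfl
  let := f.toRingHom.toAlgebra
  have hm := mulHeight₁_algebraMap (K := IntermediateField.adjoin ℚ {algebraMap L F x}) (L := L)
    (IntermediateField.AdjoinSimple.gen ℚ (algebraMap L F x))
  have hf' : algebraMap (IntermediateField.adjoin ℚ {algebraMap L F x}) L
      (IntermediateField.AdjoinSimple.gen ℚ (algebraMap L F x)) = x := hf
  rw [hf'] at hm
  have ht := Module.finrank_mul_finrank ℚ (IntermediateField.adjoin ℚ {algebraMap L F x}) L
  rw [hm, Real.log_rpow (mulHeight₁_pos _), Real.log_pow, ← ht]
  have h0 : Module.finrank (IntermediateField.adjoin ℚ {algebraMap L F x}) L ≠ 0 := by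
    have : FiniteDimensional (IntermediateField.adjoin ℚ {algebraMap L F x}) L :=
      Module.Finite.of_restrictScalars_finite ℚ _ _
    exact Module.finrank_pos.ne'
  have h1 : Module.finrank ℚ (IntermediateField.adjoin ℚ {algebraMap L F x}) ≠ 0 :=
    Module.finrank_pos.ne'
  push_cast
  field_simp

end NumberField

end

noncomputable section

/-! ### The approximate parallelogram law for the naive height -/

namespace WeierstrassCurve.Affine.Point

open MvPolynomial

variable {F : Type*} [Field F] {W : WeierstrassCurve F}

lemma eval_addSubMap (W : WeierstrassCurve F) (s t u : F) :
    (fun i => (addSubMap W i).eval ![s, t, u]) =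
      ![s ^ 2 - W.b₄ * s * u - W.b₆ * t * u - W.b₈ * u ^ 2,
        2 * t * s + W.b₂ * s * u + W.b₄ * t * u + W.b₆ * u ^ 2, t ^ 2 - 4 * s * u] := by
  ext i
  fin_cases i <;> simp [addSubMap]

lemma sq_sub_negY {x y : F} (h : W.toAffine.Equation x y) :
    (y - W.toAffine.negY x y) ^ 2 = 4 * x ^ 3 + W.b₂ * x ^ 2 + 2 * W.b₄ * x + W.b₆ := by
  rw [Affine.equation_iff] at h
  simp only [negY, b₂, b₄, b₆]
  linear_combination 4 * h

variable [DecidableEq F]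

/-- The duplication formula for the `x`-coordinate. -/
lemma addX_slope_self_mul {x y : F} (h : W.toAffine.Equation x y)
    (hy : y ≠ W.toAffine.negY x y) :
    W.toAffine.addX x x (W.toAffine.slope x x y y) *
      (4 * x ^ 3 + W.b₂ * x ^ 2 + 2 * W.b₄ * x + W.b₆) =
      x ^ 4 - W.b₄ * x ^ 2 - 2 * W.b₆ * x - W.b₈ := by
  have hd : y - W.toAffine.negY x y ≠ 0 := sub_ne_zero.mpr hy
  rw [← sq_sub_negY h, slope_of_Y_ne rfl hy, addX]
  field_simp
  rw [Affine.equation_iff] at h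
  simp only [negY, b₄, b₆, b₈]
  linear_combination -(8 * x + 4 * W.a₂ + W.a₁ ^ 2) * h

/-- The diagonal case, kept apart because the chord slope is unavailable: the duplication formula
takes over, and two-torsion points need their own argument. -/
lemma exists_smul_addSubMap_sym2x_self [W.IsElliptic] (P : W.toAffine.Point) :
    ∃ c : F, c ≠ 0 ∧ (fun i => (addSubMap W i).eval (P.sym2x P)) = c • (P + P).sym2x 0 := by
  match P with
  | .zero =>
    refine ⟨1, one_ne_zero, ?_⟩
    change (fun i => (addSubMap W i).eval ((0 : W.toAffine.Point).sym2x 0)) =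
      (1 : F) • ((0 : W.toAffine.Point) + 0).sym2x 0
    rw [add_zero, sym2x_zero_zero, eval_addSubMap]
    ext i
    fin_cases i <;> simp
  | .some x y h =>
    have hd := sq_sub_negY h.1
    by_cases hy : y = W.toAffine.negY x y
    · rw [add_self_of_Y_eq hy, sym2x_zero_zero, sym2x_some_some, eval_addSubMap]
      -- At a two-torsion point the last two coordinates vanish. Since the vector is not zero, its
      -- first coordinate is the scaling factor.
      have hne := addSubMap_ne_zero W (x := ![x * x, x + x, 1])
        (Function.ne_iff.mpr ⟨2, by simp⟩)
      rw [eval_addSubMap] at hne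
      have h2 : 2 * (x + x) * (x * x) + W.b₂ * (x * x) * 1 + W.b₄ * (x + x) * 1 +
          W.b₆ * 1 ^ 2 = 0 := by
        rw [← hy, sub_self] at hd
        linear_combination -hd
      have h3 : (x + x) ^ 2 - 4 * (x * x) * 1 = 0 := by ring
      rw [h2, h3] at hne ⊢
      generalize (x * x) ^ 2 - W.b₄ * (x * x) * 1 - W.b₆ * (x + x) * 1 - W.b₈ * 1 ^ 2 = c at hne ⊢
      refine ⟨c, ?_, by simp⟩
      rintro rfl
      exact hne (by ext i; fin_cases i <;> rfl)
    · rw [add_self_of_Y_ne hy, sym2x_some_some, sym2x_some_zero, eval_addSubMap]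
      refine ⟨4 * x ^ 3 + W.b₂ * x ^ 2 + 2 * W.b₄ * x + W.b₆, ?_, ?_⟩
      · rw [← hd]; exact pow_ne_zero 2 (sub_ne_zero.mpr hy)
      · have hx := addX_slope_self_mul h.1 hy
        ext i
        fin_cases i
        · simp only [Fin.zero_eta, Matrix.cons_val_zero, Pi.smul_apply, smul_eq_mul]
          linear_combination -hx
        · simp
          ring
        · simp
          ring

/-- The two values of `addX` are the abscissae of `P + Q` and `P - Q`. Their sum and product do not
change when `P` or `Q` is negated, so the equations of the curve eliminate `y₁` and `y₂`. -/
lemma addX_slope_sum_prod {x₁ x₂ y₁ y₂ : F} (h₁ : W.toAffine.Equation x₁ y₁)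
    (h₂ : W.toAffine.Equation x₂ y₂) (hx : x₁ ≠ x₂) :
    (x₁ - x₂) ^ 2 * (W.toAffine.addX x₁ x₂ (W.toAffine.slope x₁ x₂ y₁ y₂) *
        W.toAffine.addX x₁ x₂ (W.toAffine.slope x₁ x₂ y₁ (W.toAffine.negY x₂ y₂))) =
      (x₁ * x₂) ^ 2 - W.b₄ * (x₁ * x₂) - W.b₆ * (x₁ + x₂) - W.b₈ ∧
    (x₁ - x₂) ^ 2 * (W.toAffine.addX x₁ x₂ (W.toAffine.slope x₁ x₂ y₁ y₂) +
        W.toAffine.addX x₁ x₂ (W.toAffine.slope x₁ x₂ y₁ (W.toAffine.negY x₂ y₂))) =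
      2 * (x₁ + x₂) * (x₁ * x₂) + W.b₂ * (x₁ * x₂) + W.b₄ * (x₁ + x₂) + W.b₆ := by
  have hd : x₁ - x₂ ≠ 0 := sub_ne_zero.mpr hx
  rw [slope_of_X_ne hx, slope_of_X_ne hx]
  rw [Affine.equation_iff] at h₁ h₂
  simp only [addX, negY, b₂, b₄, b₆, b₈]
  constructor
  · field_simp
    linear_combination
      ((y₁ ^ 2 + W.a₁ * x₁ * y₁ + W.a₃ * y₁ - (y₂ ^ 2 + W.a₁ * x₂ * y₂ + W.a₃ * y₂) +
        (x₁ ^ 3 + W.a₂ * x₁ ^ 2 + W.a₄ * x₁) - (x₂ ^ 3 + W.a₂ * x₂ ^ 2 + W.a₄ * x₂) +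
        W.a₁ * (x₁ - x₂) * (W.a₁ * x₁ + W.a₃)) - W.a₁ ^ 2 * (x₁ - x₂) ^ 2 -
        2 * (x₁ - x₂) ^ 2 * (W.a₂ + x₁ + x₂)) * h₁ +
      (-(y₁ ^ 2 + W.a₁ * x₁ * y₁ + W.a₃ * y₁ - (y₂ ^ 2 + W.a₁ * x₂ * y₂ + W.a₃ * y₂) +
        (x₁ ^ 3 + W.a₂ * x₁ ^ 2 + W.a₄ * x₁) - (x₂ ^ 3 + W.a₂ * x₂ ^ 2 + W.a₄ * x₂) +
        W.a₁ * (x₁ - x₂) * (W.a₁ * x₁ + W.a₃)) -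
        2 * (x₁ - x₂) ^ 2 * (W.a₂ + x₁ + x₂)) * h₂
  · field_simp
    linear_combination 2 * h₁ + 2 * h₂

/-- `addSubMap` realizes the map `(P, Q) ↦ (P + Q, P - Q)` on `x`-coordinates. -/
lemma exists_smul_addSubMap_sym2x [W.IsElliptic] (P Q : W.toAffine.Point) :
    ∃ c : F, c ≠ 0 ∧ (fun i => (addSubMap W i).eval (P.sym2x Q)) = c • (P + Q).sym2x (P - Q) := by
  by_cases hPQ : P = Q
  · subst hPQ
    simpa using exists_smul_addSubMap_sym2x_self P
  by_cases hPQ' : P = -Q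
  · obtain rfl : Q = -P := by rw [hPQ', neg_neg]
    rw [sym2x_neg_right, add_neg_cancel, sub_neg_eq_add, sym2x_comm 0]
    exact exists_smul_addSubMap_sym2x_self P
  match P, Q with
  | .zero, .zero => exact absurd rfl hPQ
  | .zero, .some x y h =>
    refine ⟨1, one_ne_zero, ?_⟩
    rw [← zero_def, zero_add, zero_sub, sym2x_neg_right, sym2x_zero_some, sym2x_some_some,
      eval_addSubMap]
    ext i
    fin_cases i <;> simp <;> ring
  | .some x y h, .zero =>
    refine ⟨1, one_ne_zero, ?_⟩
    rw [← zero_def, add_zero, sub_zero, sym2x_some_zero, sym2x_some_some, eval_addSubMap]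
    ext i
    fin_cases i <;> simp <;> ring
  | .some x₁ y₁ h₁, .some x₂ y₂ h₂ =>
    have hx : x₁ ≠ x₂ := fun hx => by
      rcases X_eq_iff.mp hx with h | h
      · exact hPQ h
      · exact hPQ' h
    obtain ⟨hp, hs⟩ := addX_slope_sum_prod h₁.1 h₂.1 hx
    refine ⟨(x₁ - x₂) ^ 2, pow_ne_zero 2 (sub_ne_zero.mpr hx), ?_⟩
    rw [sub_eq_add_neg (some x₁ y₁ h₁), neg_some, add_of_X_ne hx, add_of_X_ne hx, sym2x_some_some,
      sym2x_some_some, eval_addSubMap]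
    ext i
    fin_cases i
    · simp only [Fin.zero_eta, Matrix.cons_val_zero, Pi.smul_apply, smul_eq_mul]
      linear_combination -hp
    · simp only [Fin.mk_one, Matrix.cons_val_one, Matrix.cons_val_zero, Pi.smul_apply, smul_eq_mul]
      linear_combination -hs
    · simp
      ring

open Height in
/-- The approximate parallelogram law for the naive height. -/
theorem exists_abs_logHeight_xRep_add_sub_le [AdmissibleAbsValues F] (W : WeierstrassCurve F)
    [W.IsElliptic] :
    ∃ C, ∀ P Q : W.toAffine.Point,
      |logHeight (P + Q).xRep + logHeight (P - Q).xRep -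
        2 * (logHeight P.xRep + logHeight Q.xRep)| ≤ C := by
  obtain ⟨C₁, h₁⟩ := abs_logHeight_addSubMap_sub_two_mul_logHeight_le W
  obtain ⟨C₂, h₂⟩ := abs_logHeight_sym2_sub_le F
  have h₂' (P Q : W.toAffine.Point) :
      |logHeight (P.sym2x Q) - (logHeight P.xRep + logHeight Q.xRep)| ≤ C₂ := by
    have e (R : W.toAffine.Point) : R.xRep = ![R.xRep 0, R.xRep 1] := by
      ext i; fin_cases i <;> rfl
    have hP := xRep_ne_zero P
    have hQ := xRep_ne_zero Q
    rw [e] at hP hQ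
    rw [e P, e Q]
    exact h₂ hP hQ
  refine ⟨C₁ + 3 * C₂, fun P Q => ?_⟩
  obtain ⟨c, hc, h⟩ := exists_smul_addSubMap_sym2x P Q
  have k₁ := h₁ (P.sym2x Q)
  rw [h, logHeight_smul_eq_logHeight _ hc] at k₁
  have k₂ := h₂' P Q
  have k₃ := h₂' (P + Q) (P - Q)
  rw [abs_le] at *
  constructor <;> linarith

end WeierstrassCurve.Affine.Point

end

noncomputable section

/-! ### Nonnegative functions satisfying the parallelogram law -/

section Parallelogram

variable {A : Type*} [AddCommGroup A] {q : A → ℝ}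

/-- The law for the pair `m • a + b`, `a` is a recursion of order two in `m`. The quadratic
polynomial solves it with the right values at 0 and 1, and induction runs upwards and downwards on
pairs of consecutive values. -/
lemma parallelogram_zsmul_add (h : ∀ a b, q (a + b) + q (a - b) = 2 * q a + 2 * q b) (a b : A)
    (m : ℤ) : q (m • a + b) = m ^ 2 * q a + m * (q (a + b) - q a - q b) + q b := by
  have key (m : ℤ) : q ((m + 1) • a + b) = 2 * q (m • a + b) + 2 * q a - q ((m - 1) • a + b) := by
    have := h (m • a + b) a
    rw [show (m + 1) • a + b = m • a + b + a by module,
      show (m - 1) • a + b = m • a + b - a by module]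
    linarith
  have hpair (n : ℕ) : (q ((n : ℤ) • a + b) = n ^ 2 * q a + n * (q (a + b) - q a - q b) + q b) ∧
      q (((n : ℤ) + 1) • a + b) = (n + 1) ^ 2 * q a + (n + 1) * (q (a + b) - q a - q b) + q b := by
    induction n with
    | zero => constructor <;> (simp; try ring)
    | succ n ih =>
      refine ⟨by push_cast; exact ih.2, ?_⟩
      have := key (n + 1)
      rw [show (n : ℤ) + 1 - 1 = n by ring, ih.1, ih.2] at this
      push_cast
      rw [this]
      ring
  have hneg (n : ℕ) : (q ((-n : ℤ) • a + b) =
      n ^ 2 * q a - n * (q (a + b) - q a - q b) + q b) ∧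
      q ((-(n : ℤ) - 1) • a + b) =
        (n + 1) ^ 2 * q a - (n + 1) * (q (a + b) - q a - q b) + q b := by
    induction n with
    | zero =>
      have := key 0
      simp only [zero_add, one_smul, zero_smul, zero_sub] at this
      constructor
      · simp
      · simp only [Nat.cast_zero, neg_zero, zero_sub]
        linarith
    | succ n ih =>
      refine ⟨?_, ?_⟩
      · rw [show (-((n + 1 : ℕ) : ℤ)) = -(n : ℤ) - 1 by push_cast; ring, ih.2]
        push_cast; ring
      · have := key (-(n : ℤ) - 1)
        rw [show -(n : ℤ) - 1 + 1 = -n by ring, ih.1, ih.2] at this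
        rw [show (-((n + 1 : ℕ) : ℤ) - 1) = -(n : ℤ) - 1 - 1 by push_cast; ring]
        push_cast
        linarith
  obtain ⟨n, rfl | rfl⟩ := m.eq_nat_or_neg
  · exact_mod_cast (hpair n).1
  · rw [(hneg n).1]; push_cast; ring

lemma parallelogram_zero (h : ∀ a b, q (a + b) + q (a - b) = 2 * q a + 2 * q b) : q 0 = 0 := by
  have := h 0 0
  simp only [add_zero, sub_zero] at this
  linarith

lemma parallelogram_zsmul (h : ∀ a b, q (a + b) + q (a - b) = 2 * q a + 2 * q b) (a : A)
    (m : ℤ) : q (m • a) = m ^ 2 * q a := by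
  have := parallelogram_zsmul_add h a 0 m
  simpa [parallelogram_zero h] using this

/-- The quadratic polynomial `q(t a + b)` is nonnegative at rational `t` by clearing denominators,
hence at real `t` by density, so its discriminant is not positive. -/
lemma parallelogram_cauchy_schwarz (h : ∀ a b, q (a + b) + q (a - b) = 2 * q a + 2 * q b)
    (h0 : ∀ a, 0 ≤ q a) (a b : A) : (q (a + b) - q a - q b) ^ 2 ≤ 4 * q a * q b := by
  have hquad (m n : ℤ) : 0 ≤ m ^ 2 * q a + m * n * (q (a + b) - q a - q b) + n ^ 2 * q b := by
    have h1 := parallelogram_zsmul_add h a (n • b) m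
    have h2 := parallelogram_zsmul_add h b a n
    have h3 := parallelogram_zsmul h b n
    have h4 := h0 (m • a + n • b)
    rw [add_comm b a, add_comm (n • b) a] at h2
    rw [h1, h2, h3] at h4
    linarith
  have hrat (t : ℚ) : 0 ≤ q a * ((t : ℝ) * t) + (q (a + b) - q a - q b) * t + q b := by
    have h1 := hquad t.num t.den
    have hd : (0 : ℝ) < t.den := by exact_mod_cast t.den_pos
    have ht : (t : ℝ) = t.num / t.den := by exact_mod_cast (Rat.num_div_den t).symm
    have h2 : q a * ((t : ℝ) * t) + (q (a + b) - q a - q b) * t + q b =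
        (t.num ^ 2 * q a + t.num * t.den * (q (a + b) - q a - q b) + t.den ^ 2 * q b) /
          (t.den : ℝ) ^ 2 := by
      rw [ht]; field_simp
    rw [h2]
    exact div_nonneg (by exact_mod_cast h1) (by positivity)
  have hreal (t : ℝ) : 0 ≤ q a * (t * t) + (q (a + b) - q a - q b) * t + q b := by
    have hc : Continuous fun t : ℝ => q a * (t * t) + (q (a + b) - q a - q b) * t + q b := by
      fun_prop
    exact Rat.denseRange_cast.induction_on (p := fun t : ℝ =>
      0 ≤ q a * (t * t) + (q (a + b) - q a - q b) * t + q b) t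
      (isClosed_le continuous_const hc) hrat
  have := discrim_le_zero hreal
  rw [discrim] at this
  linarith

lemma sqrt_parallelogram_add_le (h : ∀ a b, q (a + b) + q (a - b) = 2 * q a + 2 * q b)
    (h0 : ∀ a, 0 ≤ q a) (a b : A) : √(q (a + b)) ≤ √(q a) + √(q b) := by
  rw [Real.sqrt_le_left (by positivity), add_sq, Real.sq_sqrt (h0 a), Real.sq_sqrt (h0 b)]
  have h1 : q (a + b) - q a - q b ≤ 2 * (√(q a) * √(q b)) := by
    rw [← Real.sqrt_mul (h0 a)]
    refine le_of_abs_le (abs_le_of_sq_le_sq ?_ (by positivity))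
    rw [mul_pow, Real.sq_sqrt (mul_nonneg (h0 a) (h0 b))]
    linarith [parallelogram_cauchy_schwarz h h0 a b]
  linarith

end Parallelogram

/-! ### The canonical height -/

namespace NumberField

lemma absLogHeight₁_nonneg {F : Type*} [Field F] [CharZero F] (x : F) : 0 ≤ absLogHeight₁ x := by
  rw [absLogHeight₁, absMulHeight₁]
  split_ifs with hx
  · have : FiniteDimensional ℚ (IntermediateField.adjoin ℚ {x}) :=
      IntermediateField.adjoin.finiteDimensional hx
    have : NumberField (IntermediateField.adjoin ℚ {x}) := {}
    exact Real.log_nonneg (Real.one_le_rpow (Height.one_le_mulHeight₁ _) (by positivity))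
  · simp

end NumberField

namespace EllipticPower

open Filter

variable {E : WeierstrassCurve QBar}

lemma naiveHeight_nonneg (P : Pt E) : 0 ≤ naiveHeight P := by
  match P with
  | .zero => exact le_rfl
  | .some x _ _ => exact NumberField.absLogHeight₁_nonneg x

lemma naiveHeight_map {L : Type*} [Field L] [NumberField L] [DecidableEq L] [Algebra L QBar]
    (W : WeierstrassCurve L) (P : (W.baseChange L).toAffine.Point) :
    naiveHeight (E := W.baseChange QBar)
      (WeierstrassCurve.Affine.Point.map (W' := W) (Algebra.ofId L QBar) P) =
      Height.logHeight P.xRep / Module.finrank ℚ L := by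
  match P with
  | .zero =>
    rw [← WeierstrassCurve.Affine.Point.zero_def, WeierstrassCurve.Affine.Point.map_zero,
      WeierstrassCurve.Affine.Point.xRep_zero]
    simp [naiveHeight]
  | .some x y h =>
    rw [WeierstrassCurve.Affine.Point.map_some, WeierstrassCurve.Affine.Point.xRep_some,
      ← Height.logHeight₁_eq_logHeight]
    exact NumberField.absLogHeight₁_algebraMap x

/-- Two points of `E` lie in a subgroup on which the naive height satisfies the approximate
parallelogram law: the points over a suitable number field. -/
lemma exists_subgroup_approx_parallelogram [E.IsElliptic] (P Q : Pt E) :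
    ∃ (G : AddSubgroup (Pt E)) (C : ℝ), P ∈ G ∧ Q ∈ G ∧ ∀ a ∈ G, ∀ b ∈ G,
      |naiveHeight (a + b) + naiveHeight (a - b) - 2 * (naiveHeight a + naiveHeight b)| ≤ C := by
  classical
  let S : Set QBar := {E.a₁, E.a₂, E.a₃, E.a₄, E.a₆} ∪ Set.range (homCoord P) ∪
    Set.range (homCoord Q)
  have hS : S.Finite := ((Set.toFinite _).union (Set.toFinite _)).union (Set.toFinite _)
  let L : IntermediateField ℚ QBar := IntermediateField.adjoin ℚ S
  have : Algebra.IsAlgebraic ℚ QBar := AlgebraicClosure.isAlgebraic ℚ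
  have hfd : FiniteDimensional ℚ L :=
    IntermediateField.finiteDimensional_adjoin fun x _ => Algebra.IsIntegral.isIntegral x
  have hnf : NumberField L := {}
  have hSL : ∀ x ∈ S, x ∈ L := fun x hx => IntermediateField.subset_adjoin ℚ S hx
  let W : WeierstrassCurve L :=
    ⟨⟨E.a₁, hSL _ (by simp [S])⟩, ⟨E.a₂, hSL _ (by simp [S])⟩, ⟨E.a₃, hSL _ (by simp [S])⟩,
      ⟨E.a₄, hSL _ (by simp [S])⟩, ⟨E.a₆, hSL _ (by simp [S])⟩⟩
  have hW : W.baseChange QBar = E := rfl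
  have hWe : W.IsElliptic := by
    rw [WeierstrassCurve.isElliptic_iff, isUnit_iff_ne_zero]
    intro h0
    have h1 : (W.baseChange QBar).Δ = 0 := by
      rw [WeierstrassCurve.baseChange, WeierstrassCurve.map_Δ, h0, map_zero]
    rw [hW] at h1
    exact (E.isUnit_Δ).ne_zero h1
  have hmem (R : Pt E) (hR : ∀ i, homCoord R i ∈ L) :
      R ∈ (WeierstrassCurve.Affine.Point.map (W' := W) (F := L) (Algebra.ofId L QBar)).range := by
    match R with
    | .zero => exact zero_mem _
    | .some x y h =>
      have hx : x ∈ L := hR 0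
      have hy : y ∈ L := hR 1
      have hn : (W.baseChange L).toAffine.Nonsingular (⟨x, hx⟩ : L) (⟨y, hy⟩ : L) :=
        (WeierstrassCurve.Affine.baseChange_nonsingular (W := W) (f := Algebra.ofId L QBar)
          (algebraMap L QBar).injective _ _).mp h
      exact ⟨.some _ _ hn, rfl⟩
  have : (W.baseChange L).IsElliptic := inferInstanceAs (W.map (algebraMap L L)).IsElliptic
  obtain ⟨C, hC⟩ := WeierstrassCurve.Affine.Point.exists_abs_logHeight_xRep_add_sub_le
    (W.baseChange L)
  refine ⟨(WeierstrassCurve.Affine.Point.map (W' := W) (F := L) (Algebra.ofId L QBar)).range,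
    C / Module.finrank ℚ L, hmem P fun i => hSL _ (by simp [S]),
    hmem Q fun i => hSL _ (by simp [S]),
    ?_⟩
  rintro _ ⟨a, rfl⟩ _ ⟨b, rfl⟩
  have hd : (0 : ℝ) < Module.finrank ℚ L := by exact_mod_cast Module.finrank_pos
  have e1 := naiveHeight_map W (a + b)
  have e2 := naiveHeight_map W (a - b)
  rw [map_add] at e1
  rw [map_sub] at e2
  have e3 := naiveHeight_map W a
  have e4 := naiveHeight_map W b
  have key : |Height.logHeight (a + b).xRep / Module.finrank ℚ L +
      Height.logHeight (a - b).xRep / Module.finrank ℚ L -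
      2 * (Height.logHeight a.xRep / Module.finrank ℚ L +
        Height.logHeight b.xRep / Module.finrank ℚ L)| ≤ C / Module.finrank ℚ L := by
    rw [le_div_iff₀ hd]
    refine le_trans (le_of_eq ?_) (hC a b)
    rw [← abs_of_pos hd, ← abs_mul, abs_of_pos hd]
    congr 1
    field_simp
  rw [← e1, ← e2, ← e3, ← e4] at key
  exact key

/-- Tate's argument: the approximate parallelogram law with equal points bounds `h(2R) - 4h(R)`
uniformly for `R` in a subgroup containing `P`, so consecutive terms differ by a geometric sequence.
Hence `limUnder` in `canonicalHeight` is a genuine limit. -/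
lemma tendsto_naiveHeight [E.IsElliptic] (P : Pt E) :
    Tendsto (fun k : ℕ => naiveHeight ((2 ^ k : ℕ) • P) / (4 : ℝ) ^ k) atTop
      (𝓝 (2 * canonicalHeight P)) := by
  obtain ⟨G, C, hP, -, hC⟩ := exists_subgroup_approx_parallelogram P P
  have hstep (k : ℕ) : dist (naiveHeight ((2 ^ k : ℕ) • P) / (4 : ℝ) ^ k)
      (naiveHeight ((2 ^ (k + 1) : ℕ) • P) / (4 : ℝ) ^ (k + 1)) ≤ C / 4 * (1 / 4) ^ k := by
    have h := hC _ (nsmul_mem hP (2 ^ k)) _ (nsmul_mem hP (2 ^ k))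
    rw [sub_self, ← add_nsmul, ← two_mul, ← pow_succ'] at h
    have h0 : naiveHeight (0 : Pt E) = 0 := rfl
    rw [h0, add_zero] at h
    rw [dist_comm, Real.dist_eq]
    have e : naiveHeight ((2 ^ (k + 1) : ℕ) • P) / (4 : ℝ) ^ (k + 1) -
        naiveHeight ((2 ^ k : ℕ) • P) / (4 : ℝ) ^ k =
        (naiveHeight ((2 ^ (k + 1) : ℕ) • P) -
          2 * (naiveHeight ((2 ^ k : ℕ) • P) + naiveHeight ((2 ^ k : ℕ) • P))) *
          (1 / 4 * (1 / 4) ^ k) := by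
      rw [pow_succ, div_pow, one_pow]
      field_simp
      ring
    rw [e, abs_mul, abs_of_pos (a := 1 / 4 * (1 / 4 : ℝ) ^ k) (by positivity)]
    calc _ ≤ C * (1 / 4 * (1 / 4) ^ k) := by gcongr
      _ = _ := by ring
  have hcau := cauchySeq_of_le_geometric (1 / 4) (C / 4) (by norm_num) hstep
  have := hcau.tendsto_limUnder
  rw [canonicalHeight]
  convert this using 2
  ring

lemma canonicalHeight_nonneg [E.IsElliptic] (P : Pt E) : 0 ≤ canonicalHeight P := by
  have := ge_of_tendsto' (tendsto_naiveHeight P)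
    (fun k => div_nonneg (naiveHeight_nonneg _) (by positivity : (0 : ℝ) ≤ 4 ^ k))
  linarith

/-- The bounded error of the naive height at `2^k P` and `2^k Q` disappears after division by `4^k`.
-/
lemma canonicalHeight_parallelogram [E.IsElliptic] (P Q : Pt E) :
    canonicalHeight (P + Q) + canonicalHeight (P - Q) =
      2 * canonicalHeight P + 2 * canonicalHeight Q := by
  obtain ⟨G, C, hP, hQ, hC⟩ := exists_subgroup_approx_parallelogram P Q
  have hlim := ((tendsto_naiveHeight (P + Q)).add (tendsto_naiveHeight (P - Q))).sub
    (((tendsto_naiveHeight P).add (tendsto_naiveHeight Q)).const_mul 2)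
  have hzero : Tendsto (fun k : ℕ => C * (1 / 4 : ℝ) ^ k) atTop (𝓝 0) := by
    simpa using (tendsto_pow_atTop_nhds_zero_of_lt_one (by norm_num : (0 : ℝ) ≤ 1 / 4)
      (by norm_num)).const_mul C
  have hle (k : ℕ) : ‖naiveHeight ((2 ^ k : ℕ) • (P + Q)) / (4 : ℝ) ^ k +
      naiveHeight ((2 ^ k : ℕ) • (P - Q)) / (4 : ℝ) ^ k -
      2 * (naiveHeight ((2 ^ k : ℕ) • P) / (4 : ℝ) ^ k +
        naiveHeight ((2 ^ k : ℕ) • Q) / (4 : ℝ) ^ k)‖ ≤ C * (1 / 4 : ℝ) ^ k := by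
    have h := hC _ (nsmul_mem hP (2 ^ k)) _ (nsmul_mem hQ (2 ^ k))
    rw [← nsmul_add, ← nsmul_sub] at h
    rw [Real.norm_eq_abs]
    have e (a b c d : ℝ) : a / 4 ^ k + b / 4 ^ k - 2 * (c / 4 ^ k + d / 4 ^ k) =
        (a + b - 2 * (c + d)) * (1 / 4) ^ k := by
      rw [div_pow, one_pow]; ring
    rw [e, abs_mul, abs_of_pos (a := (1 / 4 : ℝ) ^ k) (by positivity)]
    gcongr
  have := tendsto_nhds_unique hlim (squeeze_zero_norm hle hzero)
  linarith

/-! ### The seminorm -/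

/-- The seminorm on `E(QBar)`. -/
def ptNorm (d : ℕ) (P : Pt E) : ℝ := √(ptHeight d P)

lemma ptHeight_nonneg [E.IsElliptic] (d : ℕ) (P : Pt E) : 0 ≤ ptHeight d P :=
  mul_nonneg (Nat.cast_nonneg d) (canonicalHeight_nonneg P)

lemma ptHeight_parallelogram [E.IsElliptic] (d : ℕ) (P Q : Pt E) :
    ptHeight d (P + Q) + ptHeight d (P - Q) = 2 * ptHeight d P + 2 * ptHeight d Q := by
  have := canonicalHeight_parallelogram P Q
  simp only [ptHeight]
  linear_combination (d : ℝ) * this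

lemma ptNorm_nonneg (d : ℕ) (P : Pt E) : 0 ≤ ptNorm d P := Real.sqrt_nonneg _

lemma ptNorm_add_le [E.IsElliptic] (d : ℕ) (P Q : Pt E) :
    ptNorm d (P + Q) ≤ ptNorm d P + ptNorm d Q :=
  sqrt_parallelogram_add_le (ptHeight_parallelogram d) (ptHeight_nonneg d) P Q

lemma ptNorm_zsmul [E.IsElliptic] (d : ℕ) (m : ℤ) (P : Pt E) :
    ptNorm d (m • P) = |(m : ℝ)| * ptNorm d P := by
  rw [ptNorm, parallelogram_zsmul (ptHeight_parallelogram d), Real.sqrt_mul (sq_nonneg _),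
    Real.sqrt_sq_eq_abs, ptNorm]

lemma ptNorm_zero [E.IsElliptic] (d : ℕ) : ptNorm d (0 : Pt E) = 0 := by
  simpa using ptNorm_zsmul d 0 (0 : Pt E)

lemma ptNorm_neg [E.IsElliptic] (d : ℕ) (P : Pt E) : ptNorm d (-P) = ptNorm d P := by
  simpa using ptNorm_zsmul d (-1) P

lemma ptNorm_eq_zero_of_torsion [E.IsElliptic] (d : ℕ) {m : ℤ} (hm : m ≠ 0) {P : Pt E}
    (h : m • P = 0) : ptNorm d P = 0 := by
  have := ptNorm_zsmul d m P
  rw [h, ptNorm_zero] at this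
  exact (mul_eq_zero.mp this.symm).resolve_left (by simpa using hm)

lemma ptNorm_sum_le [E.IsElliptic] (d : ℕ) {ι : Type*} (s : Finset ι) (f : ι → Pt E) :
    ptNorm d (∑ i ∈ s, f i) ≤ ∑ i ∈ s, ptNorm d (f i) :=
  Finset.le_sum_of_subadditive _ (ptNorm_zero d).le (ptNorm_add_le d) s f

lemma hnorm_le_iff [E.IsElliptic] (d : ℕ) {g : ℕ} (x : Pow E g) {c : ℝ} (hc : 0 ≤ c) :
    hnorm d x ≤ c ↔ ∀ i, ptNorm d (x i) ≤ c := by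
  rw [hnorm, Real.sqrt_le_left hc, height]
  simp only [ptNorm, Real.sqrt_le_left hc]
  -- For `g = 0` the supremum over the empty family has the value 0.
  rcases isEmpty_or_nonempty (Fin g) with hg | hg
  · simp [Real.iSup_of_isEmpty, sq_nonneg]
  · exact ciSup_le_iff (Set.finite_range _).bddAbove

lemma ptNorm_le_hnorm [E.IsElliptic] (d : ℕ) {g : ℕ} (x : Pow E g) (i : Fin g) :
    ptNorm d (x i) ≤ hnorm d x :=
  (hnorm_le_iff d x (Real.sqrt_nonneg _)).mp le_rfl i

end EllipticPower

end

noncomputable section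

/-! ### Divisibility of the group of algebraic points -/

/-- A nontrivial coset of `H` would lie in the finite complement, so `H` and then `A` would be
finite. -/
lemma AddSubgroup.eq_top_of_finite_compl {A : Type*} [AddCommGroup A] [Infinite A]
    (H : AddSubgroup A) (h : ((H : Set A)ᶜ).Finite) : H = ⊤ := by
  by_contra hH
  obtain ⟨a, ha⟩ : ∃ a, a ∉ H := by
    by_contra! hall
    exact hH (AddSubgroup.ext fun x => by simp [hall x])
  have h1 : (H : Set A).Finite := by
    refine Set.Finite.of_finite_image (f := fun b => a + b) (h.subset ?_)
      (add_right_injective a).injOn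
    rintro _ ⟨b, hb, rfl⟩ hab
    exact ha (by simpa using H.sub_mem hab hb)
  exact Set.infinite_univ (by simpa using h1.union h)

namespace EllipticPower

open Filter WeierstrassCurve.Affine Polynomial

variable {E : WeierstrassCurve QBar}

/-- The `x`-coordinate of a point, with value `0` at infinity. -/
def xCoord : Pt E → QBar
  | .zero => 0
  | .some x _ _ => x

lemma exists_point_xCoord [E.IsElliptic] (x : QBar) : ∃ P : Pt E, P ≠ 0 ∧ xCoord P = x := by
  obtain ⟨s, hs⟩ := IsAlgClosed.exists_eq_mul_self ((E.a₁ * x + E.a₃) ^ 2 +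
    4 * (x ^ 3 + E.a₂ * x ^ 2 + E.a₄ * x + E.a₆))
  have h : E.toAffine.Equation x ((s - (E.a₁ * x + E.a₃)) / 2) := by
    rw [WeierstrassCurve.Affine.equation_iff]
    linear_combination (-1 / 4) * hs
  exact ⟨.some x _ (WeierstrassCurve.Affine.equation_iff_nonsingular.mp h), Point.some_ne_zero _,
    rfl⟩

lemma xCoord_eq_iff {P Q : Pt E} (hP : P ≠ 0) (hQ : Q ≠ 0) :
    xCoord P = xCoord Q ↔ P = Q ∨ P = -Q := by
  match P, Q with
  | .zero, _ => exact absurd rfl hP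
  | .some .., .zero => exact absurd rfl hQ
  | .some .., .some .. => exact Point.X_eq_iff

lemma finite_xCoord_preimage {Z : Set QBar} (hZ : Z.Finite) :
    {P : Pt E | xCoord P ∈ Z}.Finite := by
  refine hZ.preimage' fun c _ => ?_
  by_cases hc : ∃ Q : Pt E, Q ≠ 0 ∧ xCoord Q = c
  · obtain ⟨Q, hQ, rfl⟩ := hc
    refine (Set.toFinite {0, Q, -Q}).subset fun P hP => ?_
    by_cases h0 : P = 0
    · simp [h0]
    · rcases (xCoord_eq_iff h0 hQ).mp hP with h | h <;> simp [h]
  · refine (Set.finite_singleton 0).subset fun P hP => ?_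
    by_contra h0
    exact hc ⟨P, h0, hP⟩

lemma eventually_xCoord_notMem {Z : Set QBar} (hZ : Z.Finite) :
    ∀ᶠ P : Pt E in cofinite, xCoord P ∉ Z := by
  simpa [Filter.eventually_cofinite] using finite_xCoord_preimage hZ

lemma eventually_eval_xCoord_ne_zero {p : QBar[X]} (hp : p ≠ 0) :
    ∀ᶠ P : Pt E in cofinite, p.eval (xCoord P) ≠ 0 := by
  filter_upwards [eventually_xCoord_notMem (E := E) (Polynomial.finite_setOfPred_isRoot hp)]
    with P hP using hP

lemma eventually_ne_zero : ∀ᶠ P : Pt E in cofinite, P ≠ 0 := by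
  simp [Filter.eventually_cofinite]

instance infinite_point [E.IsElliptic] : Infinite (Pt E) :=
  Infinite.of_surjective (xCoord : Pt E → QBar)
    fun x => (exists_point_xCoord x).imp fun _ h => h.2

lemma xCoord_add_sub {P Q : Pt E} (hP : P ≠ 0) (hQ : Q ≠ 0) (h : xCoord P ≠ xCoord Q) :
    P + Q ≠ 0 ∧ (xCoord P - xCoord Q) ^ 2 * (xCoord (P + Q) + xCoord (P - Q)) =
      2 * (xCoord P + xCoord Q) * (xCoord P * xCoord Q) + E.b₂ * (xCoord P * xCoord Q) +
        E.b₄ * (xCoord P + xCoord Q) + E.b₆ := by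
  match P, Q with
  | .zero, _ => exact absurd rfl hP
  | .some .., .zero => exact absurd rfl hQ
  | .some x₁ y₁ h₁, .some x₂ y₂ h₂ =>
    have hx : x₁ ≠ x₂ := h
    rw [sub_eq_add_neg (Point.some x₁ y₁ h₁), Point.neg_some, Point.add_of_X_ne hx,
      Point.add_of_X_ne hx]
    exact ⟨Point.some_ne_zero _, (Point.addX_slope_sum_prod h₁.1 h₂.1 hx).2⟩

lemma xCoord_double {P : Pt E} (hP : P ≠ 0)
    (hd : 4 * xCoord P ^ 3 + E.b₂ * xCoord P ^ 2 + 2 * E.b₄ * xCoord P + E.b₆ ≠ 0) :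
    (2 : ℤ) • P ≠ 0 ∧ xCoord ((2 : ℤ) • P) *
      (4 * xCoord P ^ 3 + E.b₂ * xCoord P ^ 2 + 2 * E.b₄ * xCoord P + E.b₆) =
      xCoord P ^ 4 - E.b₄ * xCoord P ^ 2 - 2 * E.b₆ * xCoord P - E.b₈ := by
  match P with
  | .zero => exact absurd rfl hP
  | .some x y h =>
    have hd' : 4 * x ^ 3 + E.b₂ * x ^ 2 + 2 * E.b₄ * x + E.b₆ ≠ 0 := hd
    have hy : y ≠ E.toAffine.negY x y := fun hy => hd' (by
      rw [← Point.sq_sub_negY h.1, ← hy, sub_self, zero_pow two_ne_zero])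
    rw [two_zsmul, Point.add_self_of_Y_ne hy]
    exact ⟨Point.some_ne_zero _, Point.addX_slope_self_mul h.1 hy⟩

/-! #### A point of infinite order -/

/-- Since 2 is not a unit in the image of `ℤ`, some valuation ring of `QBar` has it among its
nonunits. -/
lemma exists_valuationSubring_two :
    ∃ B : ValuationSubring QBar, B.valuation 2 < 1 := by
  let A : Subring QBar := (Int.castRingHom QBar).range
  have hI : Ideal.span {(⟨2, 2, by simp⟩ : A)} ≠ ⊤ := by
    rw [Ne, Ideal.span_singleton_eq_top, isUnit_iff_exists_inv]
    rintro ⟨⟨_, n, rfl⟩, hn⟩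
    have h1 : ((2 * n : ℤ) : QBar) = ((1 : ℤ) : QBar) := by
      have := congrArg Subtype.val hn
      simpa using this
    have := Int.cast_injective h1
    omega
  obtain ⟨B, -, hB⟩ := Ideal.image_subset_nonunits_valuationSubring _ hI
  exact ⟨B, B.mem_nonunits_iff.mp
    (hB ⟨_, Ideal.mem_span_singleton_self _, rfl⟩)⟩

/-- Take a valuation with 2 in its maximal ideal and a point near the origin, that is, with `1 / x`
small. Duplication multiplies `1 / x` by 4 and a unit, so the values at `2^k P` strictly decrease
and these points are pairwise distinct. -/
lemma exists_point_infinite_order [E.IsElliptic] : ∃ P : Pt E, ∀ m : ℤ, m ≠ 0 → m • P ≠ 0 := by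
  obtain ⟨B, hB⟩ := exists_valuationSubring_two
  set v := B.valuation
  have hv4 : v 4 < 1 := by
    rw [show (4 : QBar) = 2 * 2 by norm_num, map_mul]
    exact mul_lt_one' hB hB
  -- These are the coefficients of the duplication formula written in `w = 1 / x`. When `w` is good,
  -- the correction factors `u₁` and `u₂` below are units; the element 1 ensures that `w` itself is
  -- small.
  let S : Finset QBar := {1, E.b₂ / 4, E.b₄ / 2, E.b₆ / 4, E.b₄, 2 * E.b₆, E.b₈}
  let good : QBar → Prop := fun w => w ≠ 0 ∧ ∀ c ∈ S, v (c * w) < 1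
  have hsmall {c w w' : QBar} (hw : good w) (hc : c ∈ S) (hw' : v w' ≤ 1) :
      v (c * w * w') < 1 := by
    rw [map_mul]
    exact mul_lt_one_of_lt_of_le (hw.2 c hc) hw'
  have hstep (P : Pt E) (hP : P ≠ 0) (hw : good (xCoord P)⁻¹) : (2 : ℤ) • P ≠ 0 ∧
      good (xCoord ((2 : ℤ) • P))⁻¹ ∧ v (xCoord ((2 : ℤ) • P))⁻¹ < v (xCoord P)⁻¹ := by
    generalize hxw : (xCoord P)⁻¹ = w at hw
    have hx : xCoord P = w⁻¹ := by rw [← hxw, inv_inv]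
    have hw0 := hw.1
    have hw1 : v w ≤ 1 := by simpa using (hw.2 1 (by simp [S])).le
    have hww : v (w * w) ≤ 1 := by rw [map_mul]; exact mul_le_one' hw1 hw1
    have hwww : v (w * w * w) ≤ 1 := by rw [map_mul]; exact mul_le_one' hww hw1
    have hu₂ : v (1 + (E.b₂ / 4 * w * 1 + E.b₄ / 2 * w * w + E.b₆ / 4 * w * (w * w))) = 1 :=
      v.map_one_add_of_lt (v.map_add_lt (v.map_add_lt
        (hsmall hw (by simp [S]) (by simp)) (hsmall hw (by simp [S]) hw1))
        (hsmall hw (by simp [S]) hww))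
    have hu₁ : v (1 - (E.b₄ * w * w + 2 * E.b₆ * w * (w * w) + E.b₈ * w * (w * w * w))) = 1 :=
      v.map_one_sub_of_lt (v.map_add_lt (v.map_add_lt
        (hsmall hw (by simp [S]) hw1) (hsmall hw (by simp [S]) hww))
        (hsmall hw (by simp [S]) hwww))
    set u₂ := 1 + (E.b₂ / 4 * w * 1 + E.b₄ / 2 * w * w + E.b₆ / 4 * w * (w * w)) with hu₂'
    set u₁ := 1 - (E.b₄ * w * w + 2 * E.b₆ * w * (w * w) + E.b₈ * w * (w * w * w)) with hu₁'
    have hu₂0 : u₂ ≠ 0 := fun h => by simp [h] at hu₂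
    have hu₁0 : u₁ ≠ 0 := fun h => by simp [h] at hu₁
    have hden : 4 * xCoord P ^ 3 + E.b₂ * xCoord P ^ 2 + 2 * E.b₄ * xCoord P + E.b₆ =
        4 * u₂ / w ^ 3 := by
      rw [hx, hu₂']
      field_simp
      ring
    have hnum : xCoord P ^ 4 - E.b₄ * xCoord P ^ 2 - 2 * E.b₆ * xCoord P - E.b₈ = u₁ / w ^ 4 := by
      rw [hx, hu₁']
      field_simp
      ring
    obtain ⟨h1, h2⟩ := xCoord_double hP (by rw [hden]; simp [hu₂0, hw0])
    rw [hden, hnum] at h2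
    have h3 : (xCoord ((2 : ℤ) • P))⁻¹ = 4 * (w * (u₂ / u₁)) := by
      have h4 : xCoord ((2 : ℤ) • P) = u₁ / (4 * u₂ * w) := by
        field_simp at h2 ⊢
        linear_combination h2
      rw [h4, inv_div]
      ring
    have hvu : v (w * (u₂ / u₁)) = v w := by rw [map_mul, map_div₀, hu₁, hu₂, div_one, mul_one]
    have hlt : v (xCoord ((2 : ℤ) • P))⁻¹ < v w := by
      rw [h3, map_mul, hvu]
      exact mul_lt_of_lt_one_left (zero_lt_iff.mpr (v.ne_zero_iff.mpr hw0)) hv4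
    refine ⟨h1, ⟨by rw [h3]; simp [hw0, hu₁0, hu₂0], fun c hc => ?_⟩, hlt⟩
    refine lt_of_le_of_lt ?_ (hw.2 c hc)
    rw [map_mul, map_mul]
    exact mul_le_mul_right hlt.le _
  obtain ⟨w, hw⟩ : ∃ w, good w := by
    -- Dividing 2 by an element of `S` of largest valuation makes all the products small at once.
    obtain ⟨c, hc, hmax⟩ := S.exists_max_image v ⟨1, by simp [S]⟩
    have hc1 : v 1 ≤ v c := hmax 1 (by simp [S])
    have hc0 : c ≠ 0 := fun h => by simp [h] at hc1
    refine ⟨2 / c, by simp [hc0], fun c' hc' => ?_⟩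
    have hvc : 0 < v c := zero_lt_iff.mpr (v.ne_zero_iff.mpr hc0)
    rw [map_mul, map_div₀, ← mul_div_assoc, div_lt_one₀ hvc]
    calc v c' * v 2 ≤ v c * v 2 := mul_le_mul_left (hmax c' hc') _
      _ < v c := mul_lt_of_lt_one_right hvc hB
  obtain ⟨P, hP0, hPw⟩ := exists_point_xCoord (E := E) w⁻¹
  refine ⟨P, fun m hm hmP => ?_⟩
  have hk (k : ℕ) : (2 ^ k : ℤ) • P ≠ 0 ∧ good (xCoord ((2 ^ k : ℤ) • P))⁻¹ := by
    induction k with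
    | zero => simp [hP0, hPw, hw]
    | succ k ih =>
      obtain ⟨h1, h2, -⟩ := hstep _ ih.1 ih.2
      rw [pow_succ', mul_smul]
      exact ⟨h1, h2⟩
  have hanti : StrictAnti fun k : ℕ => v (xCoord ((2 ^ k : ℤ) • P))⁻¹ := by
    refine strictAnti_nat_of_succ_lt fun k => ?_
    have := (hstep _ (hk k).1 (hk k).2).2.2
    rwa [pow_succ', mul_smul]
  have hfin : Finite (AddSubgroup.zmultiples P) := by
    refine Set.finite_coe_iff.mpr (finite_zmultiples.mpr ?_)
    exact isOfFinAddOrder_iff_zsmul_eq_zero.mpr ⟨m, hm, hmP⟩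
  refine not_injective_infinite_finite
    (fun k : ℕ => (⟨(2 ^ k : ℤ) • P, AddSubgroup.zsmul_mem_zmultiples P _⟩ :
      AddSubgroup.zmultiples P)) fun k l hkl => hanti.injective ?_
  have : (2 ^ k : ℤ) • P = (2 ^ l : ℤ) • P := congrArg Subtype.val hkl
  simp only [this]

end EllipticPower

end

noncomputable section

namespace EllipticPower

open Filter Polynomial

variable {E : WeierstrassCurve QBar}

/-! #### Multiplication by integers on `x`-coordinates -/

lemma not_eventually_zsmul_eq_zero [E.IsElliptic] {m : ℤ} (hm : m ≠ 0) :
    ¬ ∀ᶠ P : Pt E in cofinite, m • P = 0 := by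
  intro h
  have h1 := AddSubgroup.eq_top_of_finite_compl (zsmulAddGroupHom (α := Pt E) m).ker
    (by simpa [Filter.eventually_cofinite, Set.compl_def, AddMonoidHom.mem_ker] using h)
  obtain ⟨P, hP⟩ := exists_point_infinite_order (E := E)
  have hPm : P ∈ (zsmulAddGroupHom (α := Pt E) m).ker := h1 ▸ AddSubgroup.mem_top P
  exact hP m hm hPm

/-- The `x`-coordinate of `m • P` is the rational function `A / B` in the `x`-coordinate of `P`,
for all but finitely many points. -/
def IsXMul (E : WeierstrassCurve QBar) (m : ℤ) (A B : QBar[X]) : Prop :=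
  B ≠ 0 ∧ ∀ᶠ P : Pt E in cofinite,
    m • P ≠ 0 ∧ xCoord (m • P) * B.eval (xCoord P) = A.eval (xCoord P)

lemma isXMul_one : IsXMul E 1 X 1 := by
  refine ⟨one_ne_zero, ?_⟩
  filter_upwards [eventually_ne_zero] with P hP
  simp [hP]

lemma isXMul_two : IsXMul E 2 (X ^ 4 - C E.b₄ * X ^ 2 - C (2 * E.b₆) * X - C E.b₈)
    (C 4 * X ^ 3 + C E.b₂ * X ^ 2 + C (2 * E.b₄) * X + C E.b₆) := by
  have hB : (C 4 * X ^ 3 + C E.b₂ * X ^ 2 + C (2 * E.b₄) * X + C E.b₆ : QBar[X]) ≠ 0 := by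
    intro h
    have := congrArg (fun p => p.coeff 3) h
    simp at this
  refine ⟨hB, ?_⟩
  filter_upwards [eventually_ne_zero, eventually_eval_xCoord_ne_zero hB] with P hP hd
  simp only [eval_add, eval_mul, eval_C, eval_pow, eval_X, eval_sub] at hd ⊢
  exact xCoord_double hP hd

/-- The formula for `x(mP + P) + x(mP - P)` gives a recursion of order two. It requires `x(mP) ≠
x(P)` for almost all `P`; otherwise `mP = ±P` almost everywhere, and `(m - 1)(m + 1)`, nonzero as `m
≥ 2`, would kill almost every point. -/
lemma IsXMul.succ [E.IsElliptic] {m : ℤ} (hm : 2 ≤ m) {A B A' B' : QBar[X]}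
    (h : IsXMul E m A B) (h' : IsXMul E (m - 1) A' B') :
    ∃ A'' B'', IsXMul E (m + 1) A'' B'' := by
  have hne : A - X * B ≠ 0 := by
    intro h0
    have h1 : A = X * B := sub_eq_zero.mp h0
    refine not_eventually_zsmul_eq_zero (E := E) (m := (m - 1) * (m + 1))
      (mul_ne_zero (by omega) (by omega)) ?_
    filter_upwards [h.2, eventually_eval_xCoord_ne_zero h.1, eventually_ne_zero]
      with P ⟨hP1, hP2⟩ hP3 hP0
    rw [h1, eval_mul, eval_X] at hP2
    rcases (xCoord_eq_iff hP1 hP0).mp (mul_right_cancel₀ hP3 hP2) with hP | hP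
    · have : (m - 1) • P = 0 := by rw [sub_zsmul, one_zsmul, hP, add_neg_cancel]
      rw [mul_comm, mul_zsmul, this, zsmul_zero]
    · have : (m + 1) • P = 0 := by rw [add_zsmul, one_zsmul, hP, neg_add_cancel]
      rw [mul_zsmul, this, zsmul_zero]
  refine ⟨(C 2 * (A + X * B) * (A * X) + C E.b₂ * (A * X * B) + C E.b₄ * (A + X * B) * B +
    C E.b₆ * B ^ 2) * B' - A' * (A - X * B) ^ 2, (A - X * B) ^ 2 * B',
    mul_ne_zero (pow_ne_zero 2 hne) h'.1, ?_⟩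
  filter_upwards [h.2, h'.2, eventually_eval_xCoord_ne_zero h.1, eventually_ne_zero,
    eventually_eval_xCoord_ne_zero hne] with P ⟨hP1, hP2⟩ ⟨_, hP2'⟩ hP3 hP0 hP4
  simp only [eval_sub, eval_mul, eval_X, eval_add, eval_pow, eval_C] at hP4 ⊢
  have hx : xCoord (m • P) ≠ xCoord P := fun hx => hP4 (by rw [← hP2, hx, sub_self])
  obtain ⟨h1, h2⟩ := xCoord_add_sub hP1 hP0 hx
  rw [show m • P + P = (m + 1) • P by rw [add_zsmul, one_zsmul],
    show m • P - P = (m - 1) • P by rw [sub_zsmul, one_zsmul, sub_eq_add_neg]] at h2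
  rw [show m • P + P = (m + 1) • P by rw [add_zsmul, one_zsmul]] at h1
  refine ⟨h1, ?_⟩
  rw [← hP2, ← hP2']
  linear_combination (eval (xCoord P) B) ^ 2 * eval (xCoord P) B' * h2

lemma exists_isXMul [E.IsElliptic] (m : ℕ) : ∃ A B, IsXMul E (m + 1) A B := by
  have key (m : ℕ) : (∃ A B, IsXMul E (m + 1) A B) ∧ ∃ A B, IsXMul E (m + 2) A B := by
    induction m with
    | zero => exact ⟨⟨_, _, by simpa using isXMul_one⟩, ⟨_, _, by simpa using isXMul_two⟩⟩
    | succ m ih =>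
      obtain ⟨⟨A', B', h'⟩, A, B, h⟩ := ih
      refine ⟨⟨A, B, by push_cast; exact (add_assoc (m : ℤ) 1 1) ▸ h⟩, ?_⟩
      obtain ⟨A'', B'', h''⟩ := h.succ (m := (m : ℤ) + 2) (by omega)
        (by rw [show (m : ℤ) + 2 - 1 = m + 1 by ring]; exact h')
      exact ⟨A'', B'', by push_cast; rwa [show (m : ℤ) + 1 + 2 = m + 2 + 1 by ring]⟩
  exact (key m).1

lemma IsXMul.exists_isCoprime {m : ℤ} {A B : QBar[X]} (h : IsXMul E m A B) :
    ∃ A' B', IsCoprime A' B' ∧ IsXMul E m A' B' := by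
  classical
  have hg : EuclideanDomain.gcd A B ≠ 0 := fun h0 => h.1 (EuclideanDomain.gcd_eq_zero_iff.mp h0).2
  obtain ⟨A', hA⟩ := EuclideanDomain.gcd_dvd_left A B
  obtain ⟨B', hB⟩ := EuclideanDomain.gcd_dvd_right A B
  obtain ⟨u, w, huw⟩ : ∃ u w, EuclideanDomain.gcd A B = A * u + B * w :=
    ⟨_, _, EuclideanDomain.gcd_eq_gcd_ab A B⟩
  generalize EuclideanDomain.gcd A B = G at *
  subst hA hB
  refine ⟨A', B', ⟨u, w, mul_left_cancel₀ hg ?_⟩, right_ne_zero_of_mul h.1, ?_⟩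
  · linear_combination -huw
  · filter_upwards [h.2, eventually_eval_xCoord_ne_zero hg] with P ⟨h1, h2⟩ h3
    refine ⟨h1, mul_left_cancel₀ h3 ?_⟩
    rw [eval_mul, eval_mul] at h2
    linear_combination h2

/-- If the rational function were constant, then `mP = ±Q` for almost all `P`. Every `R` is a
difference of two such points, so multiplication by `m` would have finite image, against the
existence of a point of infinite order. -/
lemma IsXMul.not_eq_C_mul [E.IsElliptic] {m : ℤ} (hm : m ≠ 0) {A B : QBar[X]}
    (h : IsXMul E m A B) (c : QBar) : A ≠ C c * B := by
  intro hA
  obtain ⟨Q, hQ0, hQ⟩ := exists_point_xCoord (E := E) c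
  have hev : ∀ᶠ P : Pt E in cofinite, m • P = Q ∨ m • P = -Q := by
    filter_upwards [h.2, eventually_eval_xCoord_ne_zero h.1] with P ⟨h1, h2⟩ h3
    rw [hA, eval_mul, eval_C] at h2
    exact (xCoord_eq_iff h1 hQ0).mp ((mul_right_cancel₀ h3 h2).trans hQ.symm)
  have hfin : (Set.range fun R : Pt E => m • R).Finite := by
    refine (Set.toFinite {Q - Q, Q - -Q, -Q - Q, -Q - -Q}).subset ?_
    rintro _ ⟨R, rfl⟩
    have hev' : ∀ᶠ P : Pt E in cofinite, m • (P - R) = Q ∨ m • (P - R) = -Q :=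
      (sub_left_injective (b := R)).tendsto_cofinite.eventually hev
    obtain ⟨P, hP, hP'⟩ := (hev.and hev').exists
    have hR : m • R = m • P - m • (P - R) := by rw [zsmul_sub]; abel
    simp only [hR, Set.mem_insert_iff, Set.mem_singleton_iff]
    rcases hP with hP | hP <;> rcases hP' with hP' | hP' <;> simp [hP, hP']
  have hfin' : Finite (zsmulAddGroupHom (α := Pt E) m).range := hfin
  obtain ⟨P, hP⟩ := exists_point_infinite_order (E := E)
  have h0 : Nat.card (zsmulAddGroupHom (α := Pt E) m).range •
      (⟨m • P, P, rfl⟩ : (zsmulAddGroupHom (α := Pt E) m).range) = 0 := card_nsmul_eq_zero'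
  have h1 : Nat.card (zsmulAddGroupHom (α := Pt E) m).range • (m • P) = 0 :=
    congrArg Subtype.val h0
  rw [← natCast_zsmul, ← mul_zsmul'] at h1
  exact hP _ (mul_ne_zero hm (Nat.cast_ne_zero.mpr Nat.card_pos.ne')) h1

/-- A root of `A - cB` is the abscissa of a point `P` with `x(mP) = c`, coprimality keeping the
denominator away from zero. This fails for finitely many `c` only, so the image of multiplication by
`m` is a subgroup with finite complement. -/
lemma IsXMul.surjective [E.IsElliptic] {m : ℤ} (hm : m ≠ 0) {A B : QBar[X]}
    (h : IsXMul E m A B) (hAB : IsCoprime A B) (Q : Pt E) : ∃ P : Pt E, m • P = Q := by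
  obtain ⟨Z, hZ, hZP⟩ : ∃ Z : Set QBar, Z.Finite ∧ ∀ P : Pt E, P ≠ 0 → xCoord P ∉ Z →
      m • P ≠ 0 ∧ xCoord (m • P) * B.eval (xCoord P) = A.eval (xCoord P) := by
    refine ⟨xCoord '' _, (Filter.eventually_cofinite.mp h.2).image _, fun P _ hP => ?_⟩
    by_contra hc
    exact hP ⟨P, hc, rfl⟩
  have hroot (c : QBar) (hc : (A - C c * B).degree ≠ 0)
      (hcZ : c ∉ (fun x => A.eval x / B.eval x) '' Z) :
      ∃ P : Pt E, m • P ≠ 0 ∧ xCoord (m • P) = c := by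
    obtain ⟨x, hx⟩ := IsAlgClosed.exists_root _ hc
    rw [IsRoot.def, eval_sub, eval_mul, eval_C, sub_eq_zero] at hx
    have hBx : B.eval x ≠ 0 := fun h0 => by
      obtain ⟨u, w, huw⟩ := hAB
      have := congrArg (eval x) huw
      rw [eval_add, eval_mul, eval_mul, h0, hx, h0] at this
      simp at this
    obtain ⟨P, hP0, rfl⟩ := exists_point_xCoord (E := E) x
    have hxZ : xCoord P ∉ Z := fun hxZ => hcZ ⟨xCoord P, hxZ, by
      simp only [hx]; field_simp⟩
    obtain ⟨h1, h2⟩ := hZP P hP0 hxZ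
    exact ⟨P, h1, mul_right_cancel₀ hBx (h2.trans hx)⟩
  -- Two values of `c` with `A - cB` a nonzero constant would make `A` and `B` both constant.
  have hbad : {c : QBar | (A - C c * B).degree = 0}.Subsingleton := by
    intro c hc c' hc'
    by_contra hne
    have hk := eq_C_of_degree_eq_zero hc
    have hk' := eq_C_of_degree_eq_zero hc'
    generalize (A - C c * B).coeff 0 = k at hk
    generalize (A - C c' * B).coeff 0 = k' at hk'
    have hne' : c' - c ≠ 0 := sub_ne_zero.mpr (Ne.symm hne)
    have hB : B = C ((k - k') / (c' - c)) := by
      have h1 : C (c' - c) * B = C (k - k') := by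
        rw [C_sub, C_sub]
        linear_combination hk - hk'
      have h2 : C (c' - c)⁻¹ * C (c' - c) = 1 := by rw [← C_mul, inv_mul_cancel₀ hne', C_1]
      rw [div_eq_inv_mul, C_mul, ← h1, ← mul_assoc, h2, one_mul]
    have hb : (k - k') / (c' - c) ≠ 0 := fun h0 => h.1 (by rw [hB, h0, C_0])
    refine h.not_eq_C_mul hm (k / ((k - k') / (c' - c)) + c) ?_
    generalize (k - k') / (c' - c) = b at hB hb
    have h3 : C (k / b) * C b = C k := by rw [← C_mul, div_mul_cancel₀ k hb]
    rw [C_add, add_mul]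
    nth_rewrite 1 [hB]
    rw [h3]
    linear_combination hk
  have htop := AddSubgroup.eq_top_of_finite_compl (zsmulAddGroupHom (α := Pt E) m).range (by
    refine ((finite_xCoord_preimage (E := E)
      (hbad.finite.union (hZ.image fun x => A.eval x / B.eval x))).union
      (Set.finite_singleton 0)).subset fun Q hQ => ?_
    by_contra hcon
    simp only [Set.mem_union, not_or, Set.mem_ofPred_eq, Set.mem_singleton_iff] at hcon
    obtain ⟨⟨hc1, hc2⟩, hQ0⟩ := hcon
    obtain ⟨P, hP0, hP⟩ := hroot _ hc1 hc2
    rcases (xCoord_eq_iff hP0 hQ0).mp hP with h1 | h1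
    · exact hQ ⟨P, h1⟩
    · exact hQ ⟨-P, by simp [h1]⟩)
  have : Q ∈ (zsmulAddGroupHom (α := Pt E) m).range := htop ▸ AddSubgroup.mem_top Q
  exact this

/-- The group of algebraic points of an elliptic curve is divisible. -/
theorem exists_zsmul_eq [E.IsElliptic] {m : ℤ} (hm : m ≠ 0) (Q : Pt E) :
    ∃ P : Pt E, m • P = Q := by
  obtain ⟨k, hk⟩ : ∃ k : ℕ, m.natAbs = k + 1 :=
    ⟨m.natAbs - 1, by have := Int.natAbs_pos.mpr hm; omega⟩
  obtain ⟨A, B, h⟩ := exists_isXMul (E := E) k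
  obtain ⟨A', B', hc, h'⟩ := h.exists_isCoprime
  obtain ⟨P, hP⟩ := h'.surjective (by omega) hc Q
  have hm' : m = k + 1 ∨ m = -(k + 1) := by omega
  rcases hm' with rfl | rfl
  · exact ⟨P, hP⟩
  · exact ⟨-P, by simpa using hP⟩

end EllipticPower

end

noncomputable section

/-! ### Multihomogeneous polynomials -/

namespace MvPolynomial

variable {ι κ R : Type} [Fintype ι] [Fintype κ] [CommRing R]

lemma weight_single_fst [DecidableEq ι] (d : ι × κ →₀ ℕ) (j : ι) :
    Finsupp.weight (fun v : ι × κ => (Pi.single v.1 1 : ι → ℕ)) d j = ∑ k, d (j, k) := by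
  rw [Finsupp.weight_apply, Finsupp.sum_fintype _ _ (by simp), Finset.sum_apply,
    Fintype.sum_prod_type]
  simp only [Pi.smul_apply, smul_eq_mul, Pi.single_apply]
  rw [Finset.sum_eq_single j (fun i _ hi => by simp [Ne.symm hi]) (by simp)]
  simp

lemma aeval_mul_fst {S : Type} [CommRing S] [Algebra R S] (c : ι → S) (x : ι × κ → S)
    (p : MvPolynomial (ι × κ) R) :
    aeval (fun v => c v.1 * x v) p =
      ∑ d ∈ p.support, (∏ j, c j ^ ∑ k, d (j, k)) *
        (algebraMap R S (p.coeff d) * ∏ v, x v ^ d v) := by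
  rw [aeval_def, eval₂_eq']
  refine Finset.sum_congr rfl fun d _ => ?_
  simp only [mul_pow, Finset.prod_mul_distrib]
  rw [Fintype.prod_prod_type (fun v : ι × κ => c v.1 ^ d v)]
  simp only [Finset.prod_pow_eq_pow_sum]
  ring

/-- A polynomial is multihomogeneous if and only if it scales like one. -/
lemma isWeightedHomogeneous_fst_iff [DecidableEq ι] {p : MvPolynomial (ι × κ) R} {m : ι → ℕ} :
    p.IsWeightedHomogeneous (fun v : ι × κ => (Pi.single v.1 1 : ι → ℕ)) m ↔
      ∀ (S : Type) [CommRing S] [Algebra R S] (c : ι → S) (x : ι × κ → S),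
        aeval (fun v => c v.1 * x v) p = (∏ j, c j ^ m j) * aeval x p := by
  constructor
  · intro h S _ _ c x
    rw [aeval_mul_fst, aeval_def, eval₂_eq', Finset.mul_sum]
    refine Finset.sum_congr rfl fun d hd => ?_
    have hw := h (mem_support_iff.mp hd)
    congr 1
    refine Finset.prod_congr rfl fun j _ => ?_
    rw [← weight_single_fst, hw]
  · intro h d hd
    classical
    by_contra hne
    have hm : ¬ Finsupp.equivFunOnFinite.symm m =
        Finsupp.equivFunOnFinite.symm (fun j => ∑ k, d (j, k)) := fun h0 => hne (by
      rw [Finsupp.equivFunOnFinite.symm.injective h0]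
      exact _root_.funext fun j => weight_single_fst d j)
    -- The scaling identity is tested on generic scalars `X j` and generic coordinates; comparing
    -- coefficients there forces every monomial of `p` to have multidegree `m`.
    have key := h (MvPolynomial ι (MvPolynomial (ι × κ) R)) (fun j => X j) (fun v => C (X v))
    rw [aeval_mul_fst] at key
    have e1 (d : ι → ℕ) : (∏ j, (X j : MvPolynomial ι (MvPolynomial (ι × κ) R)) ^ d j) =
        monomial (Finsupp.equivFunOnFinite.symm d) 1 := by
      rw [monomial_eq, C_1, one_mul, Finsupp.prod_fintype _ _ (by simp)]
      rfl
    have e2 : aeval (fun v => (C (X v) : MvPolynomial ι (MvPolynomial (ι × κ) R))) p = C p := by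
      have : (aeval (fun v => (C (X v) : MvPolynomial ι (MvPolynomial (ι × κ) R))) :
          MvPolynomial (ι × κ) R →ₐ[R] _) =
          (Algebra.ofId (MvPolynomial (ι × κ) R)
            (MvPolynomial ι (MvPolynomial (ι × κ) R))).restrictScalars R := by
        ext v : 1
        simp [Algebra.ofId_apply, algebraMap_eq]
      rw [this]
      simp [Algebra.ofId_apply, algebraMap_eq]
    have e3 (e : ι × κ →₀ ℕ) : algebraMap R (MvPolynomial ι (MvPolynomial (ι × κ) R))
        (p.coeff e) * ∏ v, C (X v) ^ e v = C (monomial e (p.coeff e)) := by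
      rw [monomial_eq, Finsupp.prod_fintype _ _ (by simp), C_mul, map_prod]
      simp only [map_pow]
      rfl
    simp only [e1, e2, e3] at key
    have key2 := congrArg (fun q => (q.coeff (Finsupp.equivFunOnFinite.symm
      (fun j => ∑ k, d (j, k)))).coeff d) key
    simp only [coeff_sum, mul_comm (monomial _ _) (C _), coeff_C_mul, coeff_monomial] at key2
    rw [Finset.sum_eq_single d] at key2
    · rw [if_pos rfl, if_neg hm] at key2
      rw [mul_one, mul_zero, coeff_monomial, if_pos rfl, coeff_zero] at key2
      exact hd key2
    · intro e _ he
      split_ifs <;> simp [coeff_monomial, he]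
    · intro hd'
      simp [notMem_support_iff.mp hd']

end MvPolynomial

/-! ### Morphisms between powers of `E` -/

namespace EllipticPower

open MvPolynomial

variable {E : WeierstrassCurve QBar}

lemma homCoord_ne_zero (P : Pt E) : ∃ k, homCoord P k ≠ 0 := by
  match P with
  | .zero => exact ⟨1, by simp [homCoord]⟩
  | .some x y h => exact ⟨2, by simp [homCoord]⟩

lemma equation_homCoord (P : Pt E) : E.toProjective.Equation (homCoord P) := by
  match P with
  | .zero => exact WeierstrassCurve.Projective.equation_zero
  | .some x y h => exact (WeierstrassCurve.Projective.equation_some x y).mpr h.1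

/-- The addition formula, valid at all pairs of distinct points. -/
lemma addXYZ_homCoord (P Q : Pt E) : ∃ u : QBar,
    E.toProjective.addXYZ (homCoord P) (homCoord Q) = u • homCoord (P + Q) ∧
      (P ≠ Q → u ≠ 0) := by
  by_cases hPQ : P = Q
  · subst hPQ
    refine ⟨0, ?_, fun h => absurd rfl h⟩
    rw [WeierstrassCurve.Projective.addXYZ_self, zero_smul]
    ext i; fin_cases i <;> rfl
  match P, Q with
  | .zero, .zero => exact absurd rfl hPQ
  | .zero, .some x y h =>
    refine ⟨1, ?_, fun _ => one_ne_zero⟩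
    rw [WeierstrassCurve.Projective.addXYZ_of_Z_eq_zero_left (equation_homCoord _) rfl,
      ← WeierstrassCurve.Affine.Point.zero_def, zero_add]
    simp [homCoord]
  | .some x y h, .zero =>
    refine ⟨-1, ?_, fun _ => neg_ne_zero.mpr one_ne_zero⟩
    rw [WeierstrassCurve.Projective.addXYZ_of_Z_eq_zero_right (equation_homCoord _) rfl,
      ← WeierstrassCurve.Affine.Point.zero_def, add_zero]
    simp [homCoord]
  | .some x₁ y₁ h₁, .some x₂ y₂ h₂ =>
    have hz₁ : homCoord (.some x₁ y₁ h₁ : Pt E) 2 ≠ 0 := one_ne_zero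
    have hz₂ : homCoord (.some x₂ y₂ h₂ : Pt E) 2 ≠ 0 := one_ne_zero
    by_cases hx : x₁ = x₂
    · subst hx
      have hneg : (.some x₁ y₁ h₁ : Pt E) = -.some x₁ y₂ h₂ :=
        (WeierstrassCurve.Affine.Point.X_eq_iff.mp rfl).resolve_left hPQ
      have hy : y₁ ≠ y₂ := by
        rintro rfl
        exact hPQ rfl
      refine ⟨WeierstrassCurve.Projective.addU (homCoord (.some x₁ y₁ h₁ : Pt E))
        (homCoord (.some x₁ y₂ h₂ : Pt E)), ?_, fun _ => ?_⟩
      · rw [WeierstrassCurve.Projective.addXYZ_of_X_eq (equation_homCoord _) (equation_homCoord _)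
          hz₁ hz₂ rfl, hneg, neg_add_cancel]
        rfl
      · exact WeierstrassCurve.Projective.addU_ne_zero_of_Y_ne hz₁ hz₂
          (by simpa [homCoord] using hy)
    · have hx' : homCoord (.some x₁ y₁ h₁ : Pt E) 0 * homCoord (.some x₂ y₂ h₂ : Pt E) 2 ≠
          homCoord (.some x₂ y₂ h₂ : Pt E) 0 * homCoord (.some x₁ y₁ h₁ : Pt E) 2 := by
        simpa [homCoord] using hx
      refine ⟨_, ?_, fun _ => WeierstrassCurve.Projective.addZ_ne_zero_of_X_ne
        (equation_homCoord _) (equation_homCoord _) hx'⟩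
      rw [WeierstrassCurve.Projective.addXYZ_of_Z_ne_zero (equation_homCoord _)
        (equation_homCoord _) hz₁ hz₂ hx', WeierstrassCurve.Affine.Point.add_of_X_ne hx]
      simp [homCoord]

/-- A map `E^g → E` is given near `x` by three forms of the same multidegree. -/
def IsRegularAt {g : ℕ} (f : Pow E g → Pt E) (x : Pow E g) : Prop :=
  ∃ (m : Fin g → ℕ) (F : Fin 3 → MvPolynomial (Fin g × Fin 3) QBar),
    (∀ k, (F k).IsWeightedHomogeneous (fun v : Fin g × Fin 3 => (Pi.single v.1 1 : Fin g → ℕ)) m) ∧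
    (∃ k, evalAt (F k) x ≠ 0) ∧
    ∀ y, ∃ c : QBar, ∀ k, evalAt (F k) y = c * homCoord (f y) k

lemma isRegularAt_const {g : ℕ} (P : Pt E) (x : Pow E g) : IsRegularAt (fun _ => P) x := by
  refine ⟨0, fun k => C (homCoord P k), fun k => isWeightedHomogeneous_C _ _, ?_, fun y =>
    ⟨1, fun k => by simp [evalAt]⟩⟩
  simpa [evalAt] using homCoord_ne_zero P

lemma isRegularAt_apply {g : ℕ} (j : Fin g) (x : Pow E g) :
    IsRegularAt (fun y => y j) x := by
  refine ⟨Pi.single j 1, fun k => X (j, k), fun k => isWeightedHomogeneous_X _ _ (j, k), ?_,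
    fun y => ⟨1, fun k => by simp [evalAt]⟩⟩
  simpa [evalAt] using homCoord_ne_zero (x j)

lemma IsRegularAt.neg {g : ℕ} {f : Pow E g → Pt E} {x : Pow E g} (h : IsRegularAt f x) :
    IsRegularAt (fun y => -f y) x := by
  obtain ⟨m, F, hF, ⟨k, hk⟩, hc⟩ := h
  -- The usual formula for the negative returns `-(0, 1, 0)` at the origin, whence the second sign.
  have hneg (P : Pt E) : homCoord (-P) =
      ![homCoord P 0, -homCoord P 1 - E.a₁ * homCoord P 0 - E.a₃ * homCoord P 2,
        homCoord P 2] ∨ homCoord (-P) =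
      -![homCoord P 0, -homCoord P 1 - E.a₁ * homCoord P 0 - E.a₃ * homCoord P 2,
        homCoord P 2] := by
    match P with
    | .zero =>
      right
      rw [← WeierstrassCurve.Affine.Point.zero_def, neg_zero]
      simp [homCoord]
    | .some a b h =>
      left
      rw [WeierstrassCurve.Affine.Point.neg_some]
      simp [homCoord, WeierstrassCurve.Affine.negY]
  refine ⟨m, ![F 0, -F 1 - C E.a₁ * F 0 - C E.a₃ * F 2, F 2], fun k => ?_, ?_, fun y => ?_⟩
  · fin_cases k
    · exact hF 0
    · exact (((hF 1).neg).sub ((hF 0).C_mul _)).sub ((hF 2).C_mul _)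
    · exact hF 2
  · by_contra! hcon
    have h0 : evalAt (F 0) x = 0 := hcon 0
    have h2 : evalAt (F 2) x = 0 := hcon 2
    have h1 : evalAt (-F 1 - C E.a₁ * F 0 - C E.a₃ * F 2) x = 0 := hcon 1
    simp only [evalAt, map_sub, map_neg, map_mul, eval_C] at h0 h1 h2
    rw [h0, h2] at h1
    apply hk
    fin_cases k
    · exact h0
    · simpa [evalAt] using h1
    · exact h2
  · obtain ⟨c, hc⟩ := hc y
    have h0 := hc 0
    have h1 := hc 1
    have h2 := hc 2
    simp only [evalAt] at h0 h1 h2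
    rcases hneg (f y) with h | h
    · refine ⟨c, fun k => ?_⟩
      rw [h]
      fin_cases k <;> simp [evalAt, h0, h1, h2]
      ring
    · refine ⟨-c, fun k => ?_⟩
      rw [h]
      fin_cases k <;> simp [evalAt, h0, h1, h2]
      ring

/-- The addition polynomials are evaluated at the forms representing `f` and `h`. They have bidegree
`(2, 2)`, hence the multidegree `2(m + n)`, and do not all vanish at a pair of distinct points. -/
lemma IsRegularAt.add_of_ne {g : ℕ} {f h : Pow E g → Pt E} {x : Pow E g} (hf : IsRegularAt f x)
    (hh : IsRegularAt h x) (hne : f x ≠ h x) : IsRegularAt (fun y => f y + h y) x := by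
  obtain ⟨m, F, hF, ⟨k, hk⟩, hc⟩ := hf
  obtain ⟨n, H, hH, ⟨l, hl⟩, hd⟩ := hh
  -- The curve is moved to the polynomial ring so that the addition formulas apply to the forms
  -- themselves.
  let W := (E.map (C : QBar →+* MvPolynomial (Fin g × Fin 3) QBar)).toProjective
  have hmap (S : Type) [CommRing S] [Algebra QBar S] (z : Fin g × Fin 3 → S) (k : Fin 3) :
      aeval z (W.addXYZ F H k) = (E.map (algebraMap QBar S)).toProjective.addXYZ
        (fun i => aeval z (F i)) (fun i => aeval z (H i)) k := by
    have := WeierstrassCurve.Projective.map_addXYZ (W' := W)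
      (f := (aeval z : MvPolynomial (Fin g × Fin 3) QBar →ₐ[QBar] S).toRingHom) F H
    have hW : W.map (aeval z : MvPolynomial (Fin g × Fin 3) QBar →ₐ[QBar] S).toRingHom =
        E.map (algebraMap QBar S) := by
      simp only [W, WeierstrassCurve.map_map]
      congr 1
      ext a
      simp
    rw [hW] at this
    exact (congrFun this k).symm
  have heval (y : Pow E g) (k : Fin 3) : evalAt (W.addXYZ F H k) y =
      E.toProjective.addXYZ (fun i => evalAt (F i) y) (fun i => evalAt (H i) y) k :=
    hmap QBar (fun v => homCoord (y v.1) v.2) k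
  have hval (y : Pow E g) (c d : QBar) (hc : ∀ k, evalAt (F k) y = c * homCoord (f y) k)
      (hd : ∀ k, evalAt (H k) y = d * homCoord (h y) k) (k : Fin 3) :
      evalAt (W.addXYZ F H k) y = (c * d) ^ 2 *
        E.toProjective.addXYZ (homCoord (f y)) (homCoord (h y)) k := by
    rw [heval, show (fun i => evalAt (F i) y) = c • homCoord (f y) from funext hc,
      show (fun i => evalAt (H i) y) = d • homCoord (h y) from funext hd,
      WeierstrassCurve.Projective.addXYZ_smul]
    rfl
  refine ⟨2 • (m + n), W.addXYZ F H, fun k => ?_, ?_, fun y => ?_⟩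
  · rw [isWeightedHomogeneous_fst_iff]
    intro S _ _ c z
    rw [hmap, hmap]
    have e1 (G : Fin 3 → MvPolynomial (Fin g × Fin 3) QBar) (m : Fin g → ℕ)
        (hG : ∀ k, (G k).IsWeightedHomogeneous
          (fun v : Fin g × Fin 3 => (Pi.single v.1 1 : Fin g → ℕ)) m) :
        (fun i => aeval (fun v => c v.1 * z v) (G i)) =
          (∏ j, c j ^ m j) • fun i => aeval z (G i) :=
      funext fun i => isWeightedHomogeneous_fst_iff.mp (hG i) S c z
    rw [e1 F m hF, e1 H n hH, WeierstrassCurve.Projective.addXYZ_smul, ← Finset.prod_mul_distrib,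
      ← Finset.prod_pow]
    simp only [Pi.smul_apply, smul_eq_mul, Pi.add_apply, ← pow_add, ← pow_mul]
    congr 1
    refine Finset.prod_congr rfl fun j _ => ?_
    rw [mul_comm]
  · obtain ⟨c, hc⟩ := hc x
    obtain ⟨d, hd⟩ := hd x
    obtain ⟨u, hu, hu0⟩ := addXYZ_homCoord (f x) (h x)
    obtain ⟨i, hi⟩ := homCoord_ne_zero (f x + h x)
    refine ⟨i, ?_⟩
    rw [hval x c d hc hd, hu]
    refine mul_ne_zero (pow_ne_zero 2 (mul_ne_zero ?_ ?_)) (mul_ne_zero (hu0 hne) hi)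
    · rintro rfl
      exact hk (by rw [hc, zero_mul])
    · rintro rfl
      exact hl (by rw [hd, zero_mul])
  · obtain ⟨c, hc⟩ := hc y
    obtain ⟨d, hd⟩ := hd y
    obtain ⟨u, hu, -⟩ := addXYZ_homCoord (f y) (h y)
    refine ⟨(c * d) ^ 2 * u, fun k => ?_⟩
    rw [hval y c d hc hd, hu, Pi.smul_apply, smul_eq_mul, mul_assoc]

end EllipticPower

end

noncomputable section

namespace EllipticPower

open MvPolynomial

variable {E : WeierstrassCurve QBar}

section Zariski

attribute [local instance] zariski

/-! ### Regularity of the group operations and Zariski continuity -/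

lemma infinite_two_zsmul_ne [E.IsElliptic] (P : Pt E) : {R : Pt E | (2 : ℤ) • R ≠ P}.Infinite := by
  refine Set.Infinite.of_image (fun R : Pt E => (2 : ℤ) • R) ?_
  refine ((Set.finite_singleton P).infinite_compl).mono fun Q hQ => ?_
  obtain ⟨R, rfl⟩ := exists_zsmul_eq (two_ne_zero : (2 : ℤ) ≠ 0) Q
  exact ⟨R, hQ, rfl⟩

variable {g : ℕ} {x : Pow E g}

/-- The addition formula degenerates on the diagonal, so the sum is written as `(f + R) + (h - R)`.
The constant `R` is chosen so that each of the three additions involves distinct points at `x`; the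
last one requires `2R ≠ h x - f x`. -/
lemma IsRegularAt.add [E.IsElliptic] {f h : Pow E g → Pt E} (hf : IsRegularAt f x)
    (hh : IsRegularAt h x) : IsRegularAt (fun y => f y + h y) x := by
  obtain ⟨R, hR, hR'⟩ := ((infinite_two_zsmul_ne (h x - f x)).sdiff
    (Set.toFinite {f x, -h x})).nonempty
  simp only [Set.mem_insert_iff, Set.mem_singleton_iff, not_or] at hR'
  have h1 := hf.add_of_ne (isRegularAt_const R x) (Ne.symm hR'.1)
  have h2 := hh.add_of_ne (isRegularAt_const (-R) x)
    (fun h0 => hR'.2 (by rw [h0, neg_neg]))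
  have h3 := h1.add_of_ne h2 (fun h0 => hR (by
    rw [two_zsmul, eq_sub_iff_add_eq]
    calc R + R + f x = f x + R + R := by abel
      _ = h x := by rw [h0]; abel))
  convert h3 using 2
  abel

lemma IsRegularAt.sum [E.IsElliptic] {ι : Type*} (s : Finset ι) {f : ι → Pow E g → Pt E}
    (hf : ∀ i, IsRegularAt (f i) x) : IsRegularAt (fun y => ∑ i ∈ s, f i y) x := by
  classical
  induction s using Finset.induction_on with
  | empty => simpa using isRegularAt_const 0 x
  | insert a s ha ih => simpa only [Finset.sum_insert ha] using (hf a).add ih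

lemma IsRegularAt.nsmul [E.IsElliptic] {f : Pow E g → Pt E} (hf : IsRegularAt f x) (n : ℕ) :
    IsRegularAt (fun y => n • f y) x := by
  induction n with
  | zero => simpa using isRegularAt_const 0 x
  | succ n ih => simpa only [succ_nsmul] using ih.add hf

lemma IsRegularAt.zsmul [E.IsElliptic] {f : Pow E g → Pt E} (hf : IsRegularAt f x) (n : ℤ) :
    IsRegularAt (fun y => n • f y) x := by
  obtain ⟨k, rfl | rfl⟩ := n.eq_nat_or_neg
  · simpa using hf.nsmul k
  · simpa using (hf.nsmul k).neg

/-- A product of forms is a form, so the generating open sets are a basis of the topology. -/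
lemma exists_form_of_isOpen {U : Set (Pow E g)} (hU : IsOpen U) (hx : x ∈ U) :
    ∃ p : MvPolynomial (Fin g × Fin 3) QBar, IsMultiHomogeneous p ∧ evalAt p x ≠ 0 ∧
      ∀ y : Pow E g, evalAt p y ≠ 0 → y ∈ U := by
  induction hU with
  | basic U hU =>
    obtain ⟨p, hp, rfl⟩ := hU
    exact ⟨p, hp, hx, fun y hy => hy⟩
  | univ => exact ⟨1, ⟨0, isWeightedHomogeneous_one _ _⟩, by simp [evalAt], fun _ _ => trivial⟩
  | inter U V _ _ ihU ihV =>
    obtain ⟨p, ⟨m, hp⟩, hpx, hpU⟩ := ihU hx.1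
    obtain ⟨q, ⟨n, hq⟩, hqx, hqV⟩ := ihV hx.2
    refine ⟨p * q, ⟨m + n, hp.mul hq⟩, ?_, fun y hy => ?_⟩
    · simpa [evalAt] using ⟨hpx, hqx⟩
    · have : evalAt p y ≠ 0 ∧ evalAt q y ≠ 0 := by simpa [evalAt] using hy
      exact ⟨hpU y this.1, hqV y this.2⟩
  | sUnion S _ ih =>
    obtain ⟨U, hU, hxU⟩ := hx
    obtain ⟨p, hp, hpx, hpU⟩ := ih U hU hxU
    exact ⟨p, hp, hpx, fun y hy => ⟨U, hU, hpU y hy⟩⟩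

lemma isOpen_evalAt_ne_zero {p : MvPolynomial (Fin g × Fin 3) QBar} (hp : IsMultiHomogeneous p) :
    IsOpen {x : Pow E g | evalAt p x ≠ 0} :=
  TopologicalSpace.isOpen_generateFrom_of_mem ⟨p, hp, rfl⟩

/-- Substituting the local forms of `f` into a form `p` gives a form `q` equal to `p ∘ f` up to a
factor that is nonzero at `x`. Where `q` does not vanish, neither does `p ∘ f`. -/
lemma continuous_of_isRegularAt {m : ℕ} {f : Pow E g → Pow E m}
    (hf : ∀ j x, IsRegularAt (fun y => f y j) x) : Continuous f := by
  refine continuous_generateFrom_iff.mpr ?_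
  rintro _ ⟨p, ⟨n, hp⟩, rfl⟩
  rw [isOpen_iff_forall_mem_open]
  intro x hx
  choose d F hF hFx hFc using fun j => hf j x
  let q : MvPolynomial (Fin g × Fin 3) QBar := aeval (fun v : Fin m × Fin 3 => F v.1 v.2) p
  have hq : IsMultiHomogeneous q := by
    refine ⟨fun i => ∑ j, d j i * n j, isWeightedHomogeneous_fst_iff.mpr fun S _ _ c z => ?_⟩
    have hcomp (z : Fin g × Fin 3 → S) :
        aeval z q = aeval (fun v : Fin m × Fin 3 => aeval z (F v.1 v.2)) p := by
      rw [← AlgHom.comp_apply, comp_aeval]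
    rw [hcomp, hcomp]
    have e1 : (fun v : Fin m × Fin 3 => aeval (fun v => c v.1 * z v) (F v.1 v.2)) =
        fun v : Fin m × Fin 3 => (∏ i, c i ^ d v.1 i) * aeval z (F v.1 v.2) :=
      _root_.funext fun v => isWeightedHomogeneous_fst_iff.mp (hF v.1 v.2) S c z
    rw [e1, isWeightedHomogeneous_fst_iff.mp hp S (fun j => ∏ i, c i ^ d j i)
      (fun v => aeval z (F v.1 v.2))]
    congr 1
    simp only [← Finset.prod_pow, ← pow_mul]
    rw [Finset.prod_comm]
    simp only [Finset.prod_pow_eq_pow_sum]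
  have heval (y : Pow E g) (c : Fin m → QBar)
      (hc : ∀ j k, evalAt (F j k) y = c j * homCoord (f y j) k) :
      evalAt q y = (∏ j, c j ^ n j) * evalAt p (f y) := by
    have h1 : evalAt q y = aeval (fun v : Fin m × Fin 3 => evalAt (F v.1 v.2) y) p := by
      change aeval _ q = _
      rw [← AlgHom.comp_apply, comp_aeval]
      rfl
    rw [h1]
    simp only [hc]
    exact isWeightedHomogeneous_fst_iff.mp hp QBar c (fun v => homCoord (f y v.1) v.2)
  refine ⟨{y | evalAt q y ≠ 0}, fun y hy => ?_, isOpen_evalAt_ne_zero hq, ?_⟩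
  · choose c hc using fun j => hFc j y
    rw [Set.mem_ofPred_eq, heval y c hc] at hy
    exact right_ne_zero_of_mul hy
  · choose c hc using fun j => hFc j x
    rw [Set.mem_ofPred_eq, heval x c hc]
    refine mul_ne_zero (Finset.prod_ne_zero_iff.mpr fun j _ => pow_ne_zero _ ?_) hx
    rintro h0
    obtain ⟨k, hk⟩ := hFx j
    exact hk (by rw [hc, h0, zero_mul])

lemma continuous_toHom [E.IsElliptic] {r : ℕ} (φ : Matrix (Fin r) (Fin g) ℤ) :
    Continuous (toHom E φ) :=
  continuous_of_isRegularAt fun i x => by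
    change IsRegularAt (fun y => ∑ j, φ i j • y j) x
    exact IsRegularAt.sum _ fun j => (isRegularAt_apply j x).zsmul (φ i j)

lemma continuous_add_right [E.IsElliptic] (w : Pow E g) : Continuous fun x : Pow E g => x + w :=
  continuous_of_isRegularAt fun j x => (isRegularAt_apply j x).add (isRegularAt_const (w j) x)

lemma continuous_neg_pow : Continuous fun x : Pow E g => -x :=
  continuous_of_isRegularAt fun j x => (isRegularAt_apply j x).neg

lemma continuous_update (x : Pow E g) (i : Fin g) :
    Continuous fun t : Pow E 1 => Function.update x i (t 0) := by
  refine continuous_of_isRegularAt fun j t => ?_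
  by_cases hj : j = i
  · subst hj
    simpa using isRegularAt_apply 0 t
  · simpa [Function.update_of_ne hj] using isRegularAt_const (x j) t

lemma isClosed_zero_pow : IsClosed ({0} : Set (Pow E g)) := by
  have : ({0} : Set (Pow E g)) = ⋂ i : Fin g, {x | evalAt (X (i, 2)) x ≠ 0}ᶜ := by
    ext x
    simp only [Set.mem_singleton_iff, Set.mem_iInter, Set.mem_compl_iff, Set.mem_ofPred_eq,
      not_not]
    constructor
    · rintro rfl i
      simp only [evalAt, eval_X]
      rfl
    · intro h
      funext i
      have hi := h i
      simp only [evalAt, eval_X] at hi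
      generalize x i = P at hi
      match P with
      | .zero => rfl
      | .some _ _ _ => exact absurd hi one_ne_zero
  rw [this]
  exact isClosed_iInter fun i =>
    (isOpen_evalAt_ne_zero ⟨_, isWeightedHomogeneous_X _ _ _⟩).isClosed_compl

lemma isClosed_kerSubgroup [E.IsElliptic] {r : ℕ} (φ : Matrix (Fin r) (Fin g) ℤ) :
    IsClosed (kerSubgroup E φ : Set (Pow E g)) :=
  isClosed_zero_pow.preimage (continuous_toHom φ)

end Zariski

end EllipticPower

end

noncomputable section

namespace EllipticPower

variable {E : WeierstrassCurve QBar}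

/-! ### Irreducibility of the powers of `E` -/

open Polynomial WeierstrassCurve.Affine in
-- `N` is the norm of `q` from the coordinate ring to the polynomials in `x`: it vanishes below the
-- zeros of `q`, and it is zero only if `q` is zero on the curve.
lemma exists_eval_xCoord_of_evalEval (q : Polynomial QBar[X]) :
    ∃ N : QBar[X], (∀ (x y : QBar) (_ : E.toAffine.Nonsingular x y),
      q.evalEval x y = 0 → N.eval x = 0) ∧
      (N = 0 → ∀ (x y : QBar) (_ : E.toAffine.Nonsingular x y), q.evalEval x y = 0) := by
  obtain ⟨p₁, p₂, h⟩ := CoordinateRing.exists_smul_basis_eq (CoordinateRing.mk E.toAffine q)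
  have hq : CoordinateRing.mk E.toAffine (C p₁ + C p₂ * X) = CoordinateRing.mk E.toAffine q := by
    rw [← h, CoordinateRing.smul, CoordinateRing.smul, map_add, map_mul, mul_one]
  obtain ⟨t, ht⟩ := AdjoinRoot.mk_eq_mk.mp hq
  have heval (x y : QBar) (hxy : E.toAffine.Nonsingular x y) :
      q.evalEval x y = p₁.eval x + p₂.eval x * y := by
    have h1 := congrArg (evalEval x y) ht
    rw [evalEval_sub, evalEval_mul, show evalEval x y (polynomial E.toAffine) = 0 from hxy.1,
      zero_mul, sub_eq_zero] at h1
    simpa [evalEval_C] using h1.symm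
  refine ⟨Algebra.norm QBar[X] (CoordinateRing.mk E.toAffine q), fun x y hxy h0 => ?_,
    fun h0 x y hxy => ?_⟩
  · rw [← h, CoordinateRing.norm_smul_basis]
    have he := (equation_iff x y).mp hxy.1
    rw [heval x y hxy] at h0
    simp only [eval_sub, eval_mul, eval_pow, eval_add, eval_C, eval_X]
    rw [eq_neg_of_add_eq_zero_left h0]
    linear_combination (p₂.eval x) ^ 2 * he
  · have : CoordinateRing.mk E.toAffine q = 0 := by
      have : Module.Free QBar[X] E.toAffine.CoordinateRing :=
        Module.Free.of_basis (CoordinateRing.basis E.toAffine)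
      have : Module.Finite QBar[X] E.toAffine.CoordinateRing :=
        Module.Finite.of_basis (CoordinateRing.basis E.toAffine)
      exact Algebra.norm_eq_zero_iff.mp h0
    rw [this] at h
    obtain ⟨rfl, rfl⟩ := CoordinateRing.smul_basis_eq_zero h
    simp [heval x y hxy]

section Zariski

attribute [local instance] zariski

/-- On affine points `p` becomes a polynomial in `x` and `y`. It is nonzero at `u`, so its norm is a
nonzero polynomial in `x` and has finitely many roots. -/
lemma finite_evalAt_eq_zero {p : MvPolynomial (Fin 1 × Fin 3) QBar} {u : Pow E 1} (hu : u 0 ≠ 0)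
    (hp : evalAt p u ≠ 0) : {x : Pow E 1 | evalAt p x = 0}.Finite := by
  let q : Polynomial (Polynomial QBar) :=
    MvPolynomial.aeval
      (fun v : Fin 1 × Fin 3 => ![Polynomial.C Polynomial.X, Polynomial.X, 1] v.2) p
  have hq (x y : QBar) (h : E.toAffine.Nonsingular x y) (z : Pow E 1)
      (hz : z 0 = .some x y h) : q.evalEval x y = evalAt p z := by
    have h1 : Polynomial.evalEvalRingHom x y q = MvPolynomial.eval₂Hom
        ((Polynomial.evalEvalRingHom x y).comp (algebraMap QBar (Polynomial (Polynomial QBar))))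
        (fun v : Fin 1 × Fin 3 => Polynomial.evalEvalRingHom x y
          ((![Polynomial.C Polynomial.X, Polynomial.X, 1] :
            Fin 3 → Polynomial (Polynomial QBar)) v.2)) p := by
      rw [MvPolynomial.map_aeval]
    have h2 : (Polynomial.evalEvalRingHom x y).comp
        (algebraMap QBar (Polynomial (Polynomial QBar))) = RingHom.id QBar := by
      ext a
      simp [Polynomial.algebraMap_apply]
    have h3 : (fun v : Fin 1 × Fin 3 => Polynomial.evalEvalRingHom x y
          ((![Polynomial.C Polynomial.X, Polynomial.X, 1] :
            Fin 3 → Polynomial (Polynomial QBar)) v.2)) = fun v => homCoord (z v.1) v.2 := by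
      funext ⟨i, k⟩
      rw [Subsingleton.elim i 0, hz]
      fin_cases k <;> simp [homCoord]
    rw [h2, h3] at h1
    exact h1
  obtain ⟨N, hN, hN0⟩ := exists_eval_xCoord_of_evalEval (E := E) q
  have hne : N ≠ 0 := by
    intro h0
    match hP : u 0 with
    | .zero => exact hu hP
    | .some x y h => exact hp ((hq x y h u hP).symm.trans (hN0 h0 x y h))
  have hfin : {P : Pt E | P = 0 ∨ N.eval (xCoord P) = 0}.Finite := by
    have := (eventually_ne_zero (E := E)).and (eventually_eval_xCoord_ne_zero (E := E) hne)
    rw [Filter.eventually_cofinite] at this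
    refine this.subset fun P hP => ?_
    simp only [Set.mem_ofPred_eq] at hP ⊢
    tauto
  refine (hfin.preimage (Equiv.funUnique (Fin 1) (Pt E)).injective.injOn).subset fun z hz => ?_
  change z 0 = 0 ∨ N.eval (xCoord (z 0)) = 0
  match hP : z 0 with
  | .zero => exact Or.inl rfl
  | .some x y h => exact Or.inr (hN x y h ((hq x y h z hP).trans hz))

variable [E.IsElliptic] {g : ℕ}

/-- A translation moves a point of `U` away from the origin, where the finiteness of zeros applies.
-/
lemma finite_compl_of_isOpen {U : Set (Pow E 1)} (hU : IsOpen U) (hne : U.Nonempty) :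
    Uᶜ.Finite := by
  obtain ⟨u, hu⟩ := hne
  obtain ⟨P, hP⟩ := exists_ne (0 : Pt E)
  let w : Pow E 1 := fun _ => P - u 0
  have huw : u + w + -w ∈ U := by simpa using hu
  obtain ⟨p, -, hpu, hpU⟩ := exists_form_of_isOpen (hU.preimage (continuous_add_right (-w))) huw
  have hfin := finite_evalAt_eq_zero (u := u + w) (by simpa [w] using hP) hpu
  refine (hfin.preimage (add_left_injective w).injOn).subset fun z hz => ?_
  by_contra h
  have : z + w + -w ∈ U := hpU (z + w) h
  exact hz (by simpa using this)

/-- A point of `U` and a point of `V` are made equal one coordinate at a time: when only one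
coordinate varies, each open set excludes finitely many values, so a common value remains. -/
lemma exists_mem_inter_of_isOpen {U V : Set (Pow E g)} (hU : IsOpen U) (hV : IsOpen V)
    (hUn : U.Nonempty) (hVn : V.Nonempty) : (U ∩ V).Nonempty := by
  suffices ∀ s : Finset (Fin g), ∃ u ∈ U, ∃ v ∈ V, ∀ i ∈ s, u i = v i by
    obtain ⟨u, hu, v, hv, h⟩ := this Finset.univ
    obtain rfl : u = v := funext fun i => h i (Finset.mem_univ i)
    exact ⟨u, hu, hv⟩
  intro s
  induction s using Finset.induction_on with
  | empty => exact ⟨_, hUn.some_mem, _, hVn.some_mem, by simp⟩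
  | insert a s ha ih =>
    obtain ⟨u, hu, v, hv, h⟩ := ih
    have h1 := finite_compl_of_isOpen (hU.preimage (continuous_update u a))
      ⟨fun _ => u a, by simpa using hu⟩
    have h2 := finite_compl_of_isOpen (hV.preimage (continuous_update v a))
      ⟨fun _ => v a, by simpa using hv⟩
    obtain ⟨t, ht⟩ := ((h1.union h2).infinite_compl).nonempty
    simp only [Set.compl_union, compl_compl] at ht
    refine ⟨_, ht.1, _, ht.2, fun i hi => ?_⟩
    by_cases hia : i = a
    · subst hia; simp
    · simp [Function.update_of_ne hia, h i ((Finset.mem_insert.mp hi).resolve_left hia)]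

lemma isIrreducible_univ_pow : IsIrreducible (Set.univ : Set (Pow E g)) := by
  refine ⟨⟨0, trivial⟩, fun U V hU hV hUn hVn => ?_⟩
  simp only [Set.univ_inter] at *
  exact exists_mem_inter_of_isOpen hU hV hUn hVn

end Zariski

end EllipticPower

end

noncomputable section

namespace EllipticPower

variable {E : WeierstrassCurve QBar}

/-! ### Dimension of the powers of `E` -/

section Zariski

attribute [local instance] zariski

open MvPolynomial TopologicalSpace

variable {g : ℕ}

/-- The points of `E^g` none of whose coordinates is the origin. -/
def affineChart (E : WeierstrassCurve QBar) (g : ℕ) : Set (Pow E g) := {x | ∀ i, x i ≠ 0}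

lemma homCoord_two {P : Pt E} (hP : P ≠ 0) : homCoord P 2 = 1 := by
  match P with
  | .zero => exact absurd rfl hP
  | .some x y h => rfl

lemma isOpen_affineChart : IsOpen (affineChart E g) := by
  have : affineChart E g = ⋂ i, {x | evalAt (X (i, 2)) x ≠ 0} := by
    ext x
    simp only [affineChart, Set.mem_iInter, Set.mem_ofPred_eq, evalAt, eval_X]
    refine forall_congr' fun i => ⟨fun h => by rw [homCoord_two h]; exact one_ne_zero, ?_⟩
    rintro h h0
    exact h (by rw [h0]; rfl)
  rw [this]
  exact isOpen_iInter_of_finite fun i => isOpen_evalAt_ne_zero ⟨_, isWeightedHomogeneous_X _ _ _⟩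

/-- On the affine chart every polynomial agrees with a form. -/
lemma exists_isMultiHomogeneous_evalAt_eq (p : MvPolynomial (Fin g × Fin 3) QBar) :
    ∃ q, IsMultiHomogeneous q ∧ ∀ x ∈ affineChart E g, evalAt q x = evalAt p x := by
  suffices ∃ N₀ : ℕ, ∀ N ≥ N₀, ∃ q : MvPolynomial (Fin g × Fin 3) QBar,
      q.IsWeightedHomogeneous (fun v : Fin g × Fin 3 => (Pi.single v.1 1 : Fin g → ℕ))
        (fun _ => N) ∧ ∀ x ∈ affineChart E g, evalAt q x = evalAt p x by
    obtain ⟨N, h⟩ := this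
    obtain ⟨q, hq, hqp⟩ := h N le_rfl
    exact ⟨q, ⟨_, hq⟩, hqp⟩
  have hprod (s : Finset (Fin g)) (N : ℕ) :
      (∏ i ∈ s, (X (i, 2) : MvPolynomial (Fin g × Fin 3) QBar) ^ N).IsWeightedHomogeneous
        (fun v : Fin g × Fin 3 => (Pi.single v.1 1 : Fin g → ℕ))
        (∑ i ∈ s, N • Pi.single i 1) :=
    IsWeightedHomogeneous.prod _ _ _ fun i _ => (isWeightedHomogeneous_X _ _ (i, 2)).pow N
  have hone (s : Finset (Fin g)) (N : ℕ) (x : Pow E g) (hx : x ∈ affineChart E g) :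
      evalAt (∏ i ∈ s, (X (i, 2) : MvPolynomial (Fin g × Fin 3) QBar) ^ N) x = 1 := by
    simp only [evalAt, map_prod, map_pow, eval_X]
    exact Finset.prod_eq_one fun i _ => by rw [homCoord_two (hx i), one_pow]
  induction p using MvPolynomial.induction_on with
  | C a =>
    refine ⟨0, fun N _ => ⟨C a * ∏ i, X (i, 2) ^ N, ?_, fun x hx => ?_⟩⟩
    · convert (hprod Finset.univ N).C_mul a using 1
      funext j
      simp [Finset.sum_apply, Pi.single_apply]
    · have := hone Finset.univ N x hx
      simp only [evalAt] at this
      simp [evalAt, -map_prod, this]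
  | add p q hp hq =>
    obtain ⟨N₁, h₁⟩ := hp
    obtain ⟨N₂, h₂⟩ := hq
    refine ⟨max N₁ N₂, fun N hN => ?_⟩
    obtain ⟨p', hp', hpe⟩ := h₁ N (le_trans (le_max_left _ _) hN)
    obtain ⟨q', hq', hqe⟩ := h₂ N (le_trans (le_max_right _ _) hN)
    refine ⟨p' + q', hp'.add hq', fun x hx => ?_⟩
    have h1 := hpe x hx
    have h2 := hqe x hx
    simp only [evalAt] at h1 h2
    simp only [evalAt, map_add, h1, h2]
  | mul_X p v hp =>
    obtain ⟨N₁, h₁⟩ := hp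
    refine ⟨N₁ + 1, fun N hN => ?_⟩
    obtain ⟨M, rfl⟩ : ∃ M, N = M + 1 := ⟨N - 1, by omega⟩
    obtain ⟨p', hp', hpe⟩ := h₁ M (by omega)
    refine ⟨p' * X v * ∏ i ∈ Finset.univ.erase v.1, X (i, 2) ^ 1, ?_, fun x hx => ?_⟩
    · convert (hp'.mul (isWeightedHomogeneous_X QBar
        (fun v : Fin g × Fin 3 => (Pi.single v.1 1 : Fin g → ℕ)) v)).mul
        (hprod (Finset.univ.erase v.1) 1) using 1
      simp only [one_smul]
      rw [add_assoc, Finset.add_sum_erase _ (fun i => (Pi.single i 1 : Fin g → ℕ))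
        (Finset.mem_univ v.1)]
      funext j
      simp [Finset.sum_apply, Pi.single_apply]
    · have h1 := hpe x hx
      have h2 := hone (Finset.univ.erase v.1) 1 x hx
      simp only [evalAt] at h1 h2
      simp only [evalAt, map_mul, h1, h2, mul_one]

lemma isOpen_affineChart_inter (p : MvPolynomial (Fin g × Fin 3) QBar) :
    IsOpen (affineChart E g ∩ {x | evalAt p x ≠ 0}) := by
  obtain ⟨q, hq, hqp⟩ := exists_isMultiHomogeneous_evalAt_eq (E := E) p
  convert isOpen_affineChart.inter (isOpen_evalAt_ne_zero (E := E) hq) using 1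
  ext x
  refine and_congr_right fun hx => ?_
  rw [Set.mem_ofPred_eq, Set.mem_ofPred_eq, hqp x hx]

/-- The polynomials that vanish on the affine part of a set. -/
def chartIdeal (Z : Set (Pow E g)) : Ideal (MvPolynomial (Fin g × Fin 3) QBar) where
  carrier := {p | ∀ x ∈ Z, x ∈ affineChart E g → evalAt p x = 0}
  add_mem' hp hq x hx hx' := by
    have h1 := hp x hx hx'
    have h2 := hq x hx hx'
    simp only [evalAt] at h1 h2
    simp [evalAt, h1, h2]
  zero_mem' x _ _ := by simp [evalAt]
  smul_mem' c p hp x hx hx' := by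
    have h1 := hp x hx hx'
    simp only [evalAt] at h1
    simp [evalAt, h1]

lemma isPrime_chartIdeal {Z : Set (Pow E g)} (hZ : IsIrreducible Z)
    (hZa : (Z ∩ affineChart E g).Nonempty) : (chartIdeal Z).IsPrime := by
  constructor
  · rw [Ideal.ne_top_iff_one]
    intro h
    obtain ⟨x, hx, hx'⟩ := hZa
    simpa [evalAt] using h x hx hx'
  · intro p q hpq
    by_contra! hcon
    obtain ⟨hp, hq⟩ := hcon
    obtain ⟨x, hx, hxa, hxp⟩ : ∃ x ∈ Z, x ∈ affineChart E g ∧ evalAt p x ≠ 0 := by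
      by_contra! h; exact hp h
    obtain ⟨y, hy, hya, hyq⟩ : ∃ x ∈ Z, x ∈ affineChart E g ∧ evalAt q x ≠ 0 := by
      by_contra! h; exact hq h
    obtain ⟨z, hz, ⟨hza, hzp⟩, -, hzq⟩ := hZ.2 _ _ (isOpen_affineChart_inter p)
      (isOpen_affineChart_inter q) ⟨x, hx, hxa, hxp⟩ ⟨y, hy, hya, hyq⟩
    have := hpq z hz hza
    simp only [evalAt, map_mul] at this
    exact (mul_ne_zero hzp hzq) this

/-- As `Z'` is irreducible, its nonempty open subsets `Z' \ Z` and `Z' ∩ affineChart` meet; a form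
vanishing on `Z` but not at a common point separates the ideals. -/
lemma exists_mem_chartIdeal_of_lt {Z Z' : IrreducibleCloseds (Pow E g)} (h : Z < Z')
    (hZ : ((Z : Set (Pow E g)) ∩ affineChart E g).Nonempty) :
    ∃ p ∈ chartIdeal (Z : Set (Pow E g)), p ∉ chartIdeal (Z' : Set (Pow E g)) := by
  obtain ⟨hle, x, hx', hx⟩ := SetLike.lt_iff_le_and_exists.mp h
  obtain ⟨z, hz, hza⟩ := hZ
  obtain ⟨y, hy, hyZ, hya⟩ := Z'.isIrreducible.2 _ _ Z.isClosed.isOpen_compl isOpen_affineChart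
    ⟨x, hx', hx⟩ ⟨z, hle hz, hza⟩
  obtain ⟨p, -, hpy, hp⟩ := exists_form_of_isOpen Z.isClosed.isOpen_compl hyZ
  refine ⟨p, fun w hw _ => ?_, fun hcon => hpy (hcon y hy hya)⟩
  by_contra h0
  exact hp w h0 hw

/-- Every polynomial is integral over the polynomials in the `x`-coordinates, as functions on the
affine chart. -/
lemma exists_monic_eval₂_mem_chartIdeal (r : MvPolynomial (Fin g × Fin 3) QBar) :
    ∃ P : Polynomial (MvPolynomial (Fin g) QBar), P.Monic ∧
      ∀ Z : Set (Pow E g), P.eval₂ (rename fun i => (i, 0)).toRingHom r ∈ chartIdeal Z := by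
  let ev : MvPolynomial (Fin g × Fin 3) QBar →+* (affineChart E g → QBar) :=
    RingHom.pi fun x => eval fun v => homCoord (x.1 v.1) v.2
  let ι : MvPolynomial (Fin g) QBar →+* MvPolynomial (Fin g × Fin 3) QBar :=
    (rename fun i => (i, 0)).toRingHom
  suffices (ev.comp ι).IsIntegralElem (ev r) by
    obtain ⟨P, hP, h⟩ := this
    refine ⟨P, hP, fun Z x _ hx' => ?_⟩
    have h1 : ev (P.eval₂ ι r) = 0 := by rw [Polynomial.hom_eval₂, h]
    exact congrFun h1 ⟨x, hx'⟩
  induction r using MvPolynomial.induction_on with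
  | C a =>
    have : ev (C a) = ev.comp ι (C a) := by simp [ι]
    rw [this]
    exact RingHom.isIntegralElem_map _
  | add p q hp hq => rw [map_add]; exact hp.add _ hq
  | mul_X p v hp =>
    rw [map_mul]
    refine hp.mul _ ?_
    obtain ⟨i, k⟩ := v
    fin_cases k
    · have : ev (X (i, 0)) = ev.comp ι (X i) := by simp [ι]
      exact this ▸ RingHom.isIntegralElem_map _
    -- The Weierstrass equation is monic of degree two in `y`.
    · refine ⟨Polynomial.X ^ 2 + Polynomial.C (C E.a₁ * X i + C E.a₃) * Polynomial.X -
        Polynomial.C (X i ^ 3 + C E.a₂ * X i ^ 2 + C E.a₄ * X i + C E.a₆), by monicity!, ?_⟩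
      funext ⟨x, hx⟩
      have hxi := hx i
      simp only [Polynomial.eval₂_sub, Polynomial.eval₂_add, Polynomial.eval₂_mul,
        Polynomial.eval₂_pow, Polynomial.eval₂_X, Polynomial.eval₂_C]
      have e (p : MvPolynomial (Fin g × Fin 3) QBar) :
        ev p ⟨x, hx⟩ = eval (fun v => homCoord (x v.1) v.2) p := rfl
      simp only [Pi.sub_apply, Pi.add_apply, Pi.mul_apply, Pi.pow_apply, Pi.zero_apply,
        RingHom.comp_apply, e]
      simp only [ι, AlgHom.toRingHom_eq_coe, RingHom.coe_coe, map_add, map_mul, map_pow, rename_X,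
        rename_C, eval_X, eval_C]
      match hP : x i with
      | .zero => exact absurd hP hxi
      | .some a b h =>
        have := (WeierstrassCurve.Affine.equation_iff a b).mp h.1
        simp only [homCoord, Fin.mk_one, Matrix.cons_val_zero, Matrix.cons_val_one]
        linear_combination this
    · have : ev (X (i, 2)) = 1 := by
        funext ⟨x, hx⟩
        have : ev (X (i, 2)) ⟨x, hx⟩ = homCoord (x i) 2 := eval_X _
        rw [this, homCoord_two (hx i)]
        rfl
      exact this ▸ (ev.comp ι).isIntegralElem_one

/-- The chain gives a reversed chain of prime ideals, which is contracted to the polynomial ring in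
the `g` abscissae. By integrality the inclusions remain strict, and that ring has dimension `g`. -/
lemma length_le_of_head_inter_affineChart (l : LTSeries (IrreducibleCloseds (Pow E g)))
    (hl : ((l.head : Set (Pow E g)) ∩ affineChart E g).Nonempty) : l.length ≤ g := by
  let ι : MvPolynomial (Fin g) QBar →+* MvPolynomial (Fin g × Fin 3) QBar :=
    (rename fun i => (i, 0)).toRingHom
  have hne (i) : ((l i : Set (Pow E g)) ∩ affineChart E g).Nonempty :=
    hl.mono (Set.inter_subset_inter_left _ (l.strictMono.monotone (Fin.zero_le i)))
  have hprime (i) : (chartIdeal (l i : Set (Pow E g))).IsPrime :=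
    isPrime_chartIdeal (l i).isIrreducible (hne i)
  let J : Fin (l.length + 1) → PrimeSpectrum (MvPolynomial (Fin g) QBar) := fun i =>
    ⟨(chartIdeal (l i.rev : Set (Pow E g))).comap ι, (hprime i.rev).comap ι⟩
  have hJ : StrictMono J := by
    intro i j hij
    have hlt : l j.rev < l i.rev := l.strictMono (Fin.rev_lt_rev.mpr hij)
    obtain ⟨p, hp, hp'⟩ := exists_mem_chartIdeal_of_lt hlt (hne _)
    obtain ⟨P, hP, hPr⟩ := exists_monic_eval₂_mem_chartIdeal (E := E) p
    have hpr := hprime i.rev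
    exact Ideal.comap_lt_comap_of_root_mem_sdiff (f := ι)
      (I := chartIdeal (l i.rev : Set (Pow E g))) (J := chartIdeal (l j.rev : Set (Pow E g)))
      (fun q hq x hx => hq x (hlt.le hx)) ⟨hp, hp'⟩
      (Polynomial.map_monic_ne_zero hP) (hPr _)
  have h1 := Order.LTSeries.length_le_krullDim (LTSeries.mk l.length J hJ)
  have h2 : ringKrullDim (MvPolynomial (Fin g) QBar) = g := by
    rw [MvPolynomial.ringKrullDim_of_isNoetherianRing]
    simp
  exact_mod_cast h1.trans_eq h2

variable [E.IsElliptic]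

/-- A translation, being a homeomorphism, moves a point of the smallest member of the chain into the
affine chart. -/
lemma length_le_of_irreducibleCloseds (l : LTSeries (IrreducibleCloseds (Pow E g))) :
    l.length ≤ g := by
  obtain ⟨z, hz⟩ := l.head.isIrreducible.1
  obtain ⟨P, hP⟩ := exists_ne (0 : Pt E)
  let w : Pow E g := fun i => P - z i
  let e : Pow E g ≃ₜ Pow E g :=
    { Equiv.addRight w with
      continuous_toFun := continuous_add_right w
      continuous_invFun := by
        change Continuous fun x => x + -w
        exact continuous_add_right (-w) }
  have := length_le_of_head_inter_affineChart
    (l.map _ (IrreducibleCloseds.map_strictMono_of_isInducing e.isInducing))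
    ⟨z + w, subset_closure ⟨z, hz, rfl⟩, fun i => by simpa [w] using hP⟩
  exact this

/-- Any chain in `B` is prolonged by `B₁` and by the irreducible space `E^g`. -/
lemma zdim_add_two_le {B B₁ : Set (Pow E g)} (hB : IsClosed B) (hB₁ : IsClosed B₁)
    (hB₁i : IsIrreducible B₁) (h : B ⊂ B₁) (h₁ : B₁ ≠ Set.univ) : zdim B + 2 ≤ g := by
  suffices ∀ l : LTSeries (IrreducibleCloseds B), l.length + 2 ≤ g by
    -- If `B` has no chains at all, its dimension is `⊥` and nothing can be said about `g`;
    -- otherwise `g ≥ 2`.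
    obtain ⟨k, hk⟩ : ∃ k : ℕ, g = k + 2 ∨ IsEmpty (LTSeries (IrreducibleCloseds B)) := by
      rcases isEmpty_or_nonempty (LTSeries (IrreducibleCloseds B)) with h0 | ⟨⟨l⟩⟩
      · exact ⟨0, Or.inr h0⟩
      · exact ⟨g - 2, Or.inl (by have := this l; omega)⟩
    rcases hk with rfl | h0
    · have : zdim B ≤ k := iSup_le fun l => by
        have := this l
        exact_mod_cast (by omega : l.length ≤ k)
      calc zdim B + 2 ≤ k + 2 := by gcongr
        _ = ((k + 2 : ℕ) : WithBot ℕ∞) := by push_cast; rfl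
    · have : zdim B = ⊥ := by
        change Order.krullDim (IrreducibleCloseds B) = ⊥
        rw [Order.krullDim, iSup_of_empty]
      rw [this]
      simp
  intro l
  let l' := l.map _ (IrreducibleCloseds.map_strictMono_of_isInducing
    (Topology.IsInducing.subtypeVal (t := B)))
  let Z₁ : IrreducibleCloseds (Pow E g) := ⟨B₁, hB₁i, hB₁⟩
  let Z₂ : IrreducibleCloseds (Pow E g) := ⟨Set.univ, isIrreducible_univ_pow, isClosed_univ⟩
  have hl' : l'.last < Z₁ := by
    have h0 : (l'.last : Set (Pow E g)) ⊆ B :=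
      closure_minimal (by rintro _ ⟨x, -, rfl⟩; exact x.2) hB
    exact lt_of_le_of_ne (h0.trans h.1) fun he => h.2 (by
      have h1 : (l'.last : Set (Pow E g)) = B₁ := by rw [he]; rfl
      rwa [h1] at h0)
  have hZ : Z₁ < Z₂ := lt_of_le_of_ne (Set.subset_univ _) fun he =>
    h₁ (congrArg (fun Z : IrreducibleCloseds (Pow E g) => (Z : Set (Pow E g))) he)
  exact length_le_of_irreducibleCloseds ((l'.snoc Z₁ hl').snoc Z₂ (by simpa using hZ))

end Zariski

end EllipticPower

end

noncomputable section

namespace EllipticPower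

variable {E : WeierstrassCurve QBar}

/-! ### Abelian subvarieties attached to morphisms -/

lemma toHom_mul {r g m : ℕ} (A : Matrix (Fin r) (Fin g) ℤ) (B : Matrix (Fin g) (Fin m) ℤ)
    (x : Pow E m) : toHom E (A * B) x = toHom E A (toHom E B x) := by
  funext i
  change ∑ k, (A * B) i k • x k = ∑ j, A i j • ∑ k, B j k • x k
  have h1 (k : Fin m) : (A * B) i k • x k = ∑ j, A i j • (B j k • x k) := by
    rw [Matrix.mul_apply]
    refine (map_sum (zmultiplesHom (Pt E) (x k)) _ _).trans (Finset.sum_congr rfl fun j _ => ?_)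
    exact mul_zsmul (x k) (A i j) (B j k)
  rw [Finset.sum_congr rfl fun k _ => h1 k, Finset.sum_comm]
  exact Finset.sum_congr rfl fun j _ => Finset.sum_zsmul _ _ _

lemma toHom_sub {r g : ℕ} (A B : Matrix (Fin r) (Fin g) ℤ) (x : Pow E g) :
    toHom E (A - B) x = toHom E A x - toHom E B x := by
  funext i
  change ∑ j, (A - B) i j • x j = ∑ j, A i j • x j - ∑ j, B i j • x j
  simp only [Matrix.sub_apply, sub_smul, Finset.sum_sub_distrib]

lemma toHom_smul {r g : ℕ} (a : ℤ) (A : Matrix (Fin r) (Fin g) ℤ) (x : Pow E g) :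
    toHom E (a • A) x = a • toHom E A x := by
  funext i
  change ∑ j, (a • A) i j • x j = a • ∑ j, A i j • x j
  simp only [Matrix.smul_apply, smul_eq_mul, mul_smul, Finset.smul_sum]

lemma toHom_one {g : ℕ} (x : Pow E g) : toHom E 1 x = x := by
  funext i
  change ∑ j, (1 : Matrix (Fin g) (Fin g) ℤ) i j • x j = x i
  simp [Matrix.one_apply]

lemma toHom_single {r g : ℕ} (φ : Matrix (Fin r) (Fin g) ℤ) (j : Fin g) (P : Pt E) (i : Fin r) :
    toHom E φ (Pi.single j P) i = φ i j • P := by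
  change ∑ k, φ i k • (Pi.single j P : Pow E g) k = φ i j • P
  rw [Finset.sum_eq_single j (fun k _ hk => ?_) (by simp), Pi.single_eq_same]
  rw [Pi.single_eq_of_ne hk]
  exact zsmul_zero _

lemma exists_zsmul_eq_pow [E.IsElliptic] {g : ℕ} {a : ℤ} (ha : a ≠ 0) (x : Pow E g) :
    ∃ y : Pow E g, a • y = x := by
  choose y hy using fun i => exists_zsmul_eq ha (x i)
  exact ⟨y, funext hy⟩

section Zariski

attribute [local instance] zariski

variable {r g : ℕ}

/-- A matrix whose image is the neutral component of the kernel of `φ`, when `φ` has a submatrix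
`a • 1` in the columns `σ`. -/
def kerParam (φ : Matrix (Fin r) (Fin g) ℤ) (a : ℤ) (σ : Fin r → Fin g) :
    Matrix (Fin g) (Fin g) ℤ :=
  a • 1 - (1 : Matrix (Fin g) (Fin g) ℤ).submatrix id σ * φ

/-- With `toHom_kerParam_mem_ker` this shows that `kerParam` maps `E^g` into the kernel of `φ` and
acts there as multiplication by `a`. Its image is thus the kernel up to torsion, and it is
irreducible because `E^g` is. -/
lemma toHom_kerParam_of_mem_ker {φ : Matrix (Fin r) (Fin g) ℤ} (a : ℤ) (σ : Fin r → Fin g)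
    {x : Pow E g} (hx : x ∈ kerSubgroup E φ) : toHom E (kerParam φ a σ) x = a • x := by
  rw [kerParam, toHom_sub, toHom_smul, toHom_one, toHom_mul,
    show toHom E φ x = 0 from hx, map_zero, sub_zero]

lemma toHom_kerParam_mem_ker {φ : Matrix (Fin r) (Fin g) ℤ} {a : ℤ} {σ : Fin r → Fin g}
    (h : φ.submatrix id σ = a • (1 : Matrix (Fin r) (Fin r) ℤ)) (x : Pow E g) :
    toHom E (kerParam φ a σ) x ∈ kerSubgroup E φ := by
  have h0 : φ * kerParam φ a σ = 0 := by
    have h1 : φ * (1 : Matrix (Fin g) (Fin g) ℤ).submatrix id σ = φ.submatrix id σ := by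
      have := (Matrix.submatrix_mul φ (1 : Matrix (Fin g) (Fin g) ℤ) id id σ
        Function.bijective_id).symm
      simpa using this
    rw [kerParam, Matrix.mul_sub, ← Matrix.mul_assoc, h1, h, Matrix.mul_smul, Matrix.smul_mul,
      Matrix.mul_one, Matrix.one_mul, sub_self]
  change toHom E φ (toHom E (kerParam φ a σ) x) = 0
  rw [← toHom_mul, h0]
  funext i
  change ∑ j, (0 : ℤ) • x j = 0
  exact Finset.sum_eq_zero fun j _ => zero_zsmul (x j)

variable [E.IsElliptic]

/-- The Zariski closure of a subgroup. -/
def zariskiClosure (H : AddSubgroup (Pow E g)) : AddSubgroup (Pow E g) where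
  carrier := closure H
  zero_mem' := subset_closure H.zero_mem
  add_mem' := by
    -- Only continuity of translations is available, so sums with elements of `H` come first and
    -- sums of two points of the closure second.
    have h1 (y : Pow E g) (hy : y ∈ H) {x : Pow E g} (hx : x ∈ closure (H : Set (Pow E g))) :
        x + y ∈ closure (H : Set (Pow E g)) :=
      map_mem_closure (f := fun x => x + y) (continuous_add_right y) hx fun z hz => H.add_mem hz hy
    intro x y hx hy
    rw [← closure_closure, add_comm]
    refine map_mem_closure (f := fun y => y + x) (continuous_add_right x) hy fun z hz => ?_
    change z + x ∈ _
    rw [add_comm z x]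
    exact h1 z hz hx
  neg_mem' hx := map_mem_closure continuous_neg_pow hx fun z hz => H.neg_mem hz

/-- The neutral component of the kernel of `φ`. -/
def kerComponent (E : WeierstrassCurve QBar) [E.IsElliptic] (φ : Matrix (Fin r) (Fin g) ℤ)
    (a : ℤ) (σ : Fin r → Fin g) : AddSubgroup (Pow E g) :=
  zariskiClosure (toHom E (kerParam φ a σ)).range

lemma isAbelianSubvariety_kerComponent (φ : Matrix (Fin r) (Fin g) ℤ) (a : ℤ)
    (σ : Fin r → Fin g) : IsAbelianSubvariety (kerComponent E φ a σ) := by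
  refine ⟨isClosed_closure, ?_⟩
  have := (isIrreducible_univ_pow (E := E) (g := g)).image _
    (continuous_toHom (kerParam φ a σ)).continuousOn
  rw [Set.image_univ] at this
  exact this.closure

lemma toHom_kerParam_mem (φ : Matrix (Fin r) (Fin g) ℤ) (a : ℤ) (σ : Fin r → Fin g)
    (x : Pow E g) : toHom E (kerParam φ a σ) x ∈ kerComponent E φ a σ :=
  subset_closure ⟨x, rfl⟩

lemma kerComponent_le {φ : Matrix (Fin r) (Fin g) ℤ} {a : ℤ} {σ : Fin r → Fin g}
    (h : φ.submatrix id σ = a • (1 : Matrix (Fin r) (Fin r) ℤ)) :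
    kerComponent E φ a σ ≤ kerSubgroup E φ :=
  closure_minimal (by rintro _ ⟨x, rfl⟩; exact toHom_kerParam_mem_ker h x)
    (isClosed_kerSubgroup φ)

/-- The kernel of `φ` is its neutral component up to torsion. -/
lemma exists_sub_torsion_of_mem_ker {φ : Matrix (Fin r) (Fin g) ℤ} {a : ℤ} (ha : a ≠ 0)
    (σ : Fin r → Fin g) {x : Pow E g} (hx : x ∈ kerSubgroup E φ) :
    ∃ b ∈ kerComponent E φ a σ, a • (x - b) = 0 := by
  -- The point `b` is the image of `y`. Although `y` need not lie in the kernel, `a • y` does, and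
  -- that suffices after multiplication by `a`.
  obtain ⟨y, rfl⟩ := exists_zsmul_eq_pow ha x
  refine ⟨_, toHom_kerParam_mem φ a σ y, ?_⟩
  rw [zsmul_sub, ← map_zsmul, toHom_kerParam_of_mem_ker a σ hx, sub_self]

/-- Two rows of `φ` suffice. The component for the single row `i₀` lies strictly between that of `φ`
and `E^g`; strictness is tested with a point of infinite order in column `σ i₁` and in column `σ
i₀`. -/
lemma zdim_kerComponent_add_two_le {φ : Matrix (Fin r) (Fin g) ℤ} {a : ℤ} {σ : Fin r → Fin g}
    (ha : a ≠ 0) (h : φ.submatrix id σ = a • (1 : Matrix (Fin r) (Fin r) ℤ)) (hr : 2 ≤ r) :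
    zdim (kerComponent E φ a σ : Set (Pow E g)) + 2 ≤ g := by
  have hφ (i j : Fin r) : φ i (σ j) = if i = j then a else 0 := by
    have := congrFun (congrFun h i) j
    simpa [Matrix.one_apply] using this
  let i₀ : Fin r := ⟨0, by omega⟩
  let i₁ : Fin r := ⟨1, by omega⟩
  have hi : i₀ ≠ i₁ := by simp [i₀, i₁]
  let φ₀ : Matrix (Fin 1) (Fin g) ℤ := φ.submatrix (fun _ => i₀) id
  let σ₀ : Fin 1 → Fin g := fun _ => σ i₀
  have h₀ : φ₀.submatrix id σ₀ = a • (1 : Matrix (Fin 1) (Fin 1) ℤ) := by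
    ext i j
    simp [φ₀, σ₀, hφ, Subsingleton.elim i j]
  obtain ⟨P, hP⟩ := exists_point_infinite_order (E := E)
  refine zdim_add_two_le (B₁ := (kerComponent E φ₀ a σ₀ : Set (Pow E g)))
    isClosed_closure isClosed_closure (isAbelianSubvariety_kerComponent φ₀ a σ₀).2 ⟨?_, ?_⟩ ?_
  · refine closure_minimal ?_ isClosed_closure
    rintro _ ⟨z, rfl⟩
    obtain ⟨y, rfl⟩ := exists_zsmul_eq_pow ha z
    have hy : toHom E (kerParam φ a σ) y ∈ kerSubgroup E φ₀ :=
      funext fun _ => congrFun (toHom_kerParam_mem_ker h y) i₀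
    rw [map_zsmul, ← toHom_kerParam_of_mem_ker a σ₀ hy]
    exact toHom_kerParam_mem φ₀ a σ₀ _
  · intro hle
    have hy : (Pi.single (σ i₁) P : Pow E g) ∈ kerSubgroup E φ₀ := funext fun i => by
      rw [toHom_single]
      simp [φ₀, hφ, hi]
    have h1 := toHom_kerParam_mem φ₀ a σ₀ (Pi.single (σ i₁) P : Pow E g)
    rw [toHom_kerParam_of_mem_ker a σ₀ hy] at h1
    have h2 := congrFun (kerComponent_le h (hle h1)) i₁
    rw [map_zsmul, Pi.smul_apply, toHom_single, hφ, if_pos rfl, smul_smul] at h2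
    exact hP _ (mul_ne_zero ha ha) h2
  · intro hu
    have h1 : (Pi.single (σ i₀) P : Pow E g) ∈ kerComponent E φ₀ a σ₀ := by
      rw [← SetLike.mem_coe, hu]; trivial
    have h2 := congrFun (kerComponent_le h₀ h1) 0
    rw [toHom_single] at h2
    exact hP a ha (by simpa [φ₀, hφ] using h2)

end Zariski

/-- Up to torsion, every point of the kernel of `φ` lies in an abelian subvariety of codimension at
least two. -/
lemma exists_isAbelianSubvariety_of_mem_ker [E.IsElliptic] {r g : ℕ}
    {φ : Matrix (Fin r) (Fin g) ℤ} {a : ℤ} {σ : Fin r → Fin g} (ha : a ≠ 0)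
    (h : φ.submatrix id σ = a • (1 : Matrix (Fin r) (Fin r) ℤ)) (hr : 2 ≤ r) {x : Pow E g}
    (hx : x ∈ kerSubgroup E φ) :
    ∃ B : AddSubgroup (Pow E g), IsAbelianSubvariety B ∧
      zdim (B : Set (Pow E g)) + 2 ≤ g ∧ ∃ b ∈ B, a • (x - b) = 0 :=
  ⟨kerComponent E φ a σ, isAbelianSubvariety_kerComponent φ a σ,
    zdim_kerComponent_add_two_le ha h hr, exists_sub_torsion_of_mem_ker ha σ hx⟩

end EllipticPower

end

noncomputable section

/-! ### Simultaneous approximation -/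

/-- Dirichlet's theorem on simultaneous approximation. -/
lemma exists_simultaneous_approx {κ : Type*} [Fintype κ] (α : κ → ℝ) {Q : ℕ} (hQ : 0 < Q) :
    ∃ f : ℕ, 0 < f ∧ f ≤ Q ^ Fintype.card κ ∧
      ∃ p : κ → ℤ, ∀ k, |f * α k - p k| * Q < 1 := by
  classical
  have hQ' : (0 : ℝ) < Q := Nat.cast_pos.mpr hQ
  -- The `Q^|κ| + 1` multiples of `α` modulo 1 are sorted into `Q^|κ|` boxes of side `1 / Q`.
  let box : Fin (Q ^ Fintype.card κ + 1) → κ → Fin Q := fun f k =>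
    ⟨⌊Int.fract ((f : ℕ) * α k) * Q⌋₊, by
      rw [Nat.floor_lt (mul_nonneg (Int.fract_nonneg _) hQ'.le)]
      exact mul_lt_of_lt_one_left hQ' (Int.fract_lt_one _)⟩
  obtain ⟨f₁, f₂, hne, hbox⟩ := Fintype.exists_ne_map_eq_of_card_lt box (by simp)
  wlog hlt : f₁ < f₂ generalizing f₁ f₂
  · exact this f₂ f₁ hne.symm hbox.symm (lt_of_le_of_ne (not_lt.mp hlt) hne.symm)
  have hlt' : (f₁ : ℕ) < f₂ := hlt
  refine ⟨f₂ - f₁, by omega, by omega,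
    fun k => ⌊((f₂ : ℕ) : ℝ) * α k⌋ - ⌊((f₁ : ℕ) : ℝ) * α k⌋, fun k => ?_⟩
  have hk : ⌊Int.fract ((f₁ : ℕ) * α k) * Q⌋₊ = ⌊Int.fract ((f₂ : ℕ) * α k) * Q⌋₊ :=
    congrArg Fin.val (congrFun hbox k)
  have h1 := Nat.floor_le (mul_nonneg (Int.fract_nonneg ((f₁ : ℕ) * α k)) hQ'.le)
  have h2 := Nat.floor_le (mul_nonneg (Int.fract_nonneg ((f₂ : ℕ) * α k)) hQ'.le)
  have h3 := Nat.lt_floor_add_one (Int.fract ((f₁ : ℕ) * α k) * Q)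
  have h4 := Nat.lt_floor_add_one (Int.fract ((f₂ : ℕ) * α k) * Q)
  rw [hk] at h1 h3
  have h5 : ((f₂ - f₁ : ℕ) : ℝ) * α k -
      ((⌊((f₂ : ℕ) : ℝ) * α k⌋ - ⌊((f₁ : ℕ) : ℝ) * α k⌋ : ℤ) : ℝ) =
      Int.fract ((f₂ : ℕ) * α k) - Int.fract ((f₁ : ℕ) * α k) := by
    rw [Nat.cast_sub hlt'.le, Int.fract, Int.fract]
    push_cast
    ring
  rw [h5, ← abs_of_pos hQ', ← abs_mul, sub_mul, abs_lt]
  constructor <;> linarith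

namespace EllipticPower

lemma abs_le_matHeight {r g : ℕ} (φ : Matrix (Fin r) (Fin g) ℤ) (i : Fin r) (j : Fin g) :
    |φ i j| ≤ matHeight φ := by
  rw [Int.abs_eq_natAbs]
  exact_mod_cast (Finset.le_sup (f := fun j => (φ i j).natAbs) (Finset.mem_univ j)).trans
    (Finset.le_sup (f := fun i => Finset.univ.sup fun j => (φ i j).natAbs) (Finset.mem_univ i))

lemma matHeight_eq {r g : ℕ} {φ : Matrix (Fin r) (Fin g) ℤ} {a : ℤ} (h : ∀ i j, |φ i j| ≤ a)
    {i : Fin r} {j : Fin g} (hij : φ i j = a) : (matHeight φ : ℤ) = a := by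
  refine le_antisymm ?_ ?_
  · have ha : 0 ≤ a := (abs_nonneg _).trans (h i j)
    rw [← Int.natAbs_of_nonneg ha]
    refine Int.ofNat_le.mpr (Finset.sup_le fun i _ => Finset.sup_le fun j _ => ?_)
    have := h i j
    rw [Int.abs_eq_natAbs] at this
    omega
  · exact (le_abs_self a).trans (hij ▸ abs_le_matHeight φ i j)

lemma submatrix_eq_smul_one_iff {r g : ℕ} {φ : Matrix (Fin r) (Fin g) ℤ} {σ : Fin r → Fin g}
    {a : ℤ} : φ.submatrix id σ = a • (1 : Matrix (Fin r) (Fin r) ℤ) ↔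
      ∀ i j, φ i (σ j) = if i = j then a else 0 := by
  simp only [← Matrix.ext_iff, Matrix.submatrix_apply, Matrix.smul_apply, Matrix.one_apply,
    smul_eq_mul, mul_ite, mul_one, mul_zero, id]

/-- Approximation of a matrix with a submatrix `a • 1` by a primitive one of bounded height with a
submatrix `f • 1` in the same columns. -/
lemma exists_primitive_approx {r m : ℕ} (hr : 0 < r) {φ : Matrix (Fin r) (Fin m) ℤ} {a : ℤ}
    {σ : Fin r → Fin m} (hσ : Function.Injective σ) (ha : 0 < a)
    (hφ : φ.submatrix id σ = a • (1 : Matrix (Fin r) (Fin r) ℤ)) (hH : ∀ i j, |φ i j| ≤ a)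
    {Q : ℕ} (hQ : 0 < Q) :
    ∃ (f : ℕ) (ψ : Matrix (Fin r) (Fin m) ℤ), 0 < f ∧ f ≤ Q ^ (r * (m - r)) ∧
      ψ.submatrix id σ = (f : ℤ) • (1 : Matrix (Fin r) (Fin r) ℤ) ∧ matHeight ψ = f ∧
      IsPrimitive ψ ∧ ∀ i j, |a * ψ i j - f * φ i j| * Q ≤ a := by
  classical
  have ha' : (0 : ℝ) < a := Int.cast_pos.mpr ha
  have hQ' : (0 : ℝ) < Q := Nat.cast_pos.mpr hQ
  -- Only the entries outside the columns `σ` are approximated, which gives the exponent `r(m - r)`.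
  let κ : Type := Fin r × {j : Fin m // j ∉ Set.range σ}
  have hκ : Fintype.card κ = r * (m - r) := by
    have : Fintype.card {j : Fin m // j ∉ Set.range σ} = m - r := by
      rw [Fintype.card_subtype_compl, Fintype.card_fin]
      congr 1
      exact (Set.card_range_of_injective hσ).trans (Fintype.card_fin r)
    rw [Fintype.card_prod, Fintype.card_fin, this]
  let α : κ → ℝ := fun k => φ k.1 k.2 / a
  -- The least possible `f` is taken: a common factor of `ψ` could be divided out, leaving an
  -- approximation that is at least as good with a smaller `f`.
  have hex : ∃ f : ℕ, 0 < f ∧ ∃ p : κ → ℤ, ∀ k, |f * α k - p k| * Q < 1 := by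
    obtain ⟨f, hf, -, hp⟩ := exists_simultaneous_approx α hQ
    exact ⟨f, hf, hp⟩
  obtain ⟨hf, p, hp⟩ := Nat.find_spec hex
  have hmin : ∀ f' < Nat.find hex, ¬ (0 < f' ∧ ∃ p : κ → ℤ, ∀ k, |f' * α k - p k| * Q < 1) :=
    fun _ => Nat.find_min hex
  have hfle : Nat.find hex ≤ Q ^ (r * (m - r)) := by
    obtain ⟨f, hf, hle, hp⟩ := exists_simultaneous_approx α hQ
    exact (Nat.find_min' hex ⟨hf, hp⟩).trans (hκ ▸ hle)
  generalize Nat.find hex = f at hf hp hmin hfle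
  let ψ : Matrix (Fin r) (Fin m) ℤ := fun i j =>
    if h : j ∈ Set.range σ then if σ i = j then f else 0 else p (i, ⟨j, h⟩)
  have hψσ (i j) : ψ i (σ j) = if i = j then (f : ℤ) else 0 := by
    simp only [ψ, Set.mem_range_self, dite_true, hσ.eq_iff]
  have hψp (i : Fin r) (j : {j : Fin m // j ∉ Set.range σ}) : ψ i j = p (i, j) := by
    simp only [ψ, dif_neg j.2]
  have hφσ := submatrix_eq_smul_one_iff.mp hφ
  have hpα (k : κ) : |(a : ℝ) * p k - f * φ k.1 k.2| * Q ≤ a := by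
    have h1 : (a : ℝ) * p k - f * φ k.1 k.2 = -(a * (f * α k - p k)) := by
      simp only [α]
      field_simp
      ring
    rw [h1, abs_neg, abs_mul, abs_of_pos ha', mul_assoc]
    exact mul_le_of_le_one_right ha'.le (hp k).le
  -- The integer `p k` is at distance less than 1 from a real number of absolute value at most `f`;
  -- this yields `H(ψ) = f`.
  have hple (k : κ) : |p k| ≤ f := by
    have h1 : |(f : ℝ) * α k| ≤ f := by
      rw [abs_mul, Nat.abs_cast]
      refine mul_le_of_le_one_right (Nat.cast_nonneg f) ?_
      simp only [α]
      rw [abs_div, abs_of_pos ha', div_le_one ha']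
      exact_mod_cast hH k.1 k.2
    have h2 : |f * α k - p k| < 1 := by
      refine lt_of_le_of_lt (le_mul_of_one_le_right (abs_nonneg _) ?_) (hp k)
      exact_mod_cast hQ
    have h3 : |(p k : ℝ)| < f + 1 := by
      have := abs_sub_abs_le_abs_sub (p k : ℝ) (f * α k)
      rw [abs_sub_comm] at this
      linarith
    have h4 : |p k| < f + 1 := by exact_mod_cast h3
    omega
  let i₀ : Fin r := ⟨0, hr⟩
  refine ⟨f, ψ, hf, hfle, submatrix_eq_smul_one_iff.mpr hψσ, ?_, ?_, fun i j => ?_⟩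
  · have : (matHeight ψ : ℤ) = f := by
      refine matHeight_eq (i := i₀) (j := σ i₀) (fun i j => ?_) (by simp [hψσ])
      by_cases hj : j ∈ Set.range σ
      · obtain ⟨j, rfl⟩ := hj
        rw [hψσ]
        split_ifs <;> simp
      · exact (hψp i ⟨j, hj⟩).symm ▸ hple (i, ⟨j, hj⟩)
    exact_mod_cast this
  · intro t ψ' hψ'
    have hentry (i j) : ψ i j = t * ψ' i j := by rw [hψ']; rfl
    have hft : (f : ℤ) = t * ψ' i₀ (σ i₀) := by rw [← hentry, hψσ, if_pos rfl]
    set f' := ψ' i₀ (σ i₀)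
    have hf'0 : f' ≠ 0 := by
      intro h0
      rw [h0, mul_zero] at hft
      omega
    by_contra ht
    have ht2 : 2 ≤ t.natAbs := by
      have h0 : t ≠ 0 := by
        rintro rfl
        rw [zero_mul] at hft
        omega
      have h1 : t.natAbs ≠ 1 := fun h1 => ht (Int.isUnit_iff_natAbs_eq.mpr h1)
      omega
    have hnat : f = t.natAbs * f'.natAbs := by
      rw [← Int.natAbs_mul, ← hft, Int.natAbs_natCast]
    have hpos : 0 < f'.natAbs := Int.natAbs_pos.mpr hf'0
    refine hmin f'.natAbs (by nlinarith) ⟨hpos, fun k => f'.sign * ψ' k.1 k.2, fun k => ?_⟩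
    have h1 : ((f'.natAbs : ℕ) : ℝ) = f'.sign * f' := by
      rw [← Int.cast_mul, Int.sign_mul_self_eq_natAbs, Int.cast_natCast]
    have hs : |(f'.sign : ℝ)| = 1 := by
      exact_mod_cast Int.abs_sign_of_ne_zero hf'0
    have h2 : |((f'.natAbs : ℕ) : ℝ) * α k - ((f'.sign * ψ' k.1 k.2 : ℤ) : ℝ)| =
        |f' * α k - ψ' k.1 k.2| := by
      rw [h1, Int.cast_mul, mul_assoc, ← mul_sub, abs_mul, hs, one_mul]
    rw [h2]
    refine lt_of_le_of_lt ?_ (hp k)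
    have h3 : (f : ℝ) * α k - p k = t * (f' * α k - ψ' k.1 k.2) := by
      have e1 : (f : ℝ) = t * f' := by exact_mod_cast hft
      have e2 : (p k : ℝ) = t * ψ' k.1 k.2 := by
        exact_mod_cast (hψp k.1 k.2).symm.trans (hentry k.1 k.2)
      rw [e1, e2]
      ring
    rw [h3, abs_mul]
    have ht1 : (1 : ℝ) ≤ |(t : ℝ)| := by
      rw [← Int.cast_abs, Int.abs_eq_natAbs]
      exact_mod_cast (by omega : 1 ≤ t.natAbs)
    exact mul_le_mul_of_nonneg_right (le_mul_of_one_le_left (abs_nonneg _) ht1) hQ'.le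
  · by_cases hj : j ∈ Set.range σ
    · obtain ⟨j, rfl⟩ := hj
      rw [hψσ, hφσ]
      have : a * (if i = j then (f : ℤ) else 0) - f * (if i = j then a else 0) = 0 := by
        split_ifs <;> ring
      rw [this, abs_zero, zero_mul]
      exact ha.le
    · rw [hψp i ⟨j, hj⟩]
      exact_mod_cast hpα (i, ⟨j, hj⟩)

/-! ### Radii -/

lemma radiusPow_eq (n H : ℕ) : radiusPow n H = H * (H : ℝ) ^ (1 / (2 * (n : ℝ))) := by
  rw [radiusPow, Real.rpow_one_add' (Nat.cast_nonneg H) (by positivity)]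

lemma radiusPow_pow {n : ℕ} (hn : 0 < n) (Q : ℕ) : radiusPow n (Q ^ n) = (Q : ℝ) ^ n * √Q := by
  have hn' : (n : ℝ) ≠ 0 := by positivity
  rw [radiusPow_eq, Nat.cast_pow, Real.sqrt_eq_rpow, ← Real.rpow_natCast (Q : ℝ) n,
    ← Real.rpow_mul (Nat.cast_nonneg Q)]
  congr 2
  field_simp

lemma one_le_radiusPow (n : ℕ) {H : ℕ} (hH : 0 < H) : 1 ≤ radiusPow n H :=
  Real.one_le_rpow (by exact_mod_cast hH) (by positivity)

lemma radiusPow_le_radiusPow (n : ℕ) {H H' : ℕ} (h : H ≤ H') : radiusPow n H ≤ radiusPow n H' :=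
  Real.rpow_le_rpow (Nat.cast_nonneg H) (by exact_mod_cast h) (by positivity)

/-- The error made in replacing a matrix by an approximation of smaller height. -/
lemma radius_estimate {n Q f k : ℕ} (hn : 0 < n) (hQ : 2 ≤ Q) (hf : 0 < f) (hfQ : f ≤ Q ^ n)
    (hk : k ≤ n) {ε K : ℝ} (hε : 0 < ε) (hK : K ≤ ε * √Q) :
    ε / radiusPow n (Q ^ n) + k * (K + ε / radiusPow n (Q ^ n)) / (Q * f) ≤
      (k + 2) * ε / radiusPow n f := by
  have hQ1 : (1 : ℝ) ≤ Q := by exact_mod_cast (by omega : 1 ≤ Q)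
  have hf0 : (0 : ℝ) < f := Nat.cast_pos.mpr hf
  have hs1 : 1 ≤ √(Q : ℝ) := Real.one_le_sqrt.mpr hQ1
  have hss : √(Q : ℝ) * √Q = Q := Real.mul_self_sqrt (by linarith)
  have hW : (f : ℝ) ≤ (Q : ℝ) ^ n := by exact_mod_cast hfQ
  -- This absorbs the factor `k` in the third error term `h3`.
  have hkW : (k : ℝ) ≤ (Q : ℝ) ^ n := by
    have : n < Q ^ n := Nat.lt_pow_self (by omega)
    exact_mod_cast (by omega : k ≤ Q ^ n)
  -- The exponent `1 / (2n)` is chosen so that this power costs only `√Q`; the other factor `√Q`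
  -- gained from `Q` compensates for `K`.
  have ht : (f : ℝ) ^ (1 / (2 * (n : ℝ))) ≤ √Q := by
    have h1 := radiusPow_pow hn Q
    rw [radiusPow_eq, Nat.cast_pow] at h1
    have h2 := mul_left_cancel₀ (by positivity) h1
    rw [← h2]
    exact Real.rpow_le_rpow hf0.le hW (by positivity)
  have ht0 : 0 < (f : ℝ) ^ (1 / (2 * (n : ℝ))) := Real.rpow_pos_of_pos hf0 _
  rw [radiusPow_pow hn, radiusPow_eq]
  generalize (f : ℝ) ^ (1 / (2 * (n : ℝ))) = t at ht ht0
  generalize hWW : (Q : ℝ) ^ n = W at hW hkW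
  generalize √(Q : ℝ) = s at *
  have hW0 : 0 < W := hf0.trans_le hW
  have hs0 : 0 < s := by linarith
  have hQ0 : (0 : ℝ) < Q := by linarith
  rw [le_div_iff₀ (mul_pos hf0 ht0)]
  have h1 : ε / (W * s) * (f * t) ≤ ε := by
    rw [div_mul_eq_mul_div, div_le_iff₀ (mul_pos hW0 hs0)]
    exact mul_le_mul_of_nonneg_left (mul_le_mul hW ht ht0.le hW0.le) hε.le
  have h2 : k * K / (Q * f) * (f * t) ≤ k * ε := by
    have e : k * K / (Q * f) * (f * t) = k * (K * t) / Q := by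
      field_simp
    rw [e, div_le_iff₀ hQ0, mul_assoc]
    refine mul_le_mul_of_nonneg_left ?_ (Nat.cast_nonneg k)
    calc K * t ≤ ε * s * t := mul_le_mul_of_nonneg_right hK ht0.le
      _ ≤ ε * s * s := mul_le_mul_of_nonneg_left ht (by positivity)
      _ = ε * Q := by rw [mul_assoc, hss]
  have h3 : k * (ε / (W * s)) / (Q * f) * (f * t) ≤ ε := by
    have e : k * (ε / (W * s)) / (Q * f) * (f * t) = k * ε * t / (W * s * Q) := by
      field_simp
    rw [e, div_le_iff₀ (by positivity)]
    calc k * ε * t ≤ W * ε * s := by gcongr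
      _ ≤ W * ε * s * Q := le_mul_of_one_le_right (by positivity) hQ1
      _ = ε * (W * s * Q) := by ring
  calc _ = ε / (W * s) * (f * t) + k * K / (Q * f) * (f * t) +
      k * (ε / (W * s)) / (Q * f) * (f * t) := by ring
    _ ≤ ε + k * ε + ε := by linarith
    _ = (k + 2) * ε := by ring

end EllipticPower

end

noncomputable section

namespace EllipticPower

variable {E : WeierstrassCurve QBar}

/-! ### Thickenings -/

lemma mem_divisionGroup_of_zsmul_mem {g : ℕ} {Γ : AddSubgroup (Pow E g)} {N : ℤ} (hN : N ≠ 0)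
    {P : Pt E} (h : N • P ∈ divisionGroup Γ) : P ∈ divisionGroup Γ := by
  obtain ⟨N', hN', h'⟩ := h
  refine ⟨N' * N, mul_ne_zero hN' hN, ?_⟩
  rwa [mul_zsmul]

lemma mem_divisionGroup_of_torsion {g : ℕ} (Γ : AddSubgroup (Pow E g)) {N : ℤ} (hN : N ≠ 0)
    {P : Pt E} (h : N • P = 0) : P ∈ divisionGroup Γ :=
  mem_divisionGroup_of_zsmul_mem hN (h ▸ zero_mem _)

lemma mem_divisionGroup_bot {g : ℕ} {P : Pt E} :
    P ∈ divisionGroup (⊥ : AddSubgroup (Pow E g)) ↔ ∃ N : ℤ, N ≠ 0 ∧ N • P = 0 := by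
  have h0 : coordGroup (⊥ : AddSubgroup (Pow E g)) = ⊥ := by
    rw [coordGroup, AddSubgroup.closure_eq_bot_iff]
    rintro P ⟨y, hy, i, rfl⟩
    rw [AddSubgroup.mem_bot.mp hy]
    rfl
  change (∃ N : ℤ, N ≠ 0 ∧ N • P ∈ coordGroup (⊥ : AddSubgroup (Pow E g))) ↔ _
  simp only [h0, AddSubgroup.mem_bot]

variable {d g : ℕ}

lemma thickening_mono (Γ : AddSubgroup (Pow E g)) {ε ε' : ℝ} (h : ε ≤ ε') :
    thickening d Γ ε ⊆ thickening d Γ ε' :=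
  Set.add_subset_add_left fun _ hx => le_trans hx h

lemma toHom_apply {r : ℕ} (φ : Matrix (Fin r) (Fin g) ℤ) (x : Pow E g) (i : Fin r) :
    toHom E φ x i = ∑ j, φ i j • x j := rfl

lemma hnorm_le_setNorm {S : Set (Pow E g)} (hS : HasBoundedHeight d S) {x : Pow E g}
    (hx : x ∈ S) : hnorm d x ≤ setNorm d S :=
  Real.sqrt_le_sqrt (le_csSup hS ⟨x, hx, rfl⟩)

variable [E.IsElliptic]

/-- The division group of the trivial group is the torsion, which has norm zero. Neighbourhoods
`O_ε` thus become a special case of thickenings. -/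
lemma thickening_bot {ε : ℝ} (hε : 0 ≤ ε) :
    thickening d (⊥ : AddSubgroup (Pow E g)) ε = smallPts E d g ε := by
  ext x
  constructor
  · rintro ⟨y, hy, ξ, hξ, rfl⟩
    refine (hnorm_le_iff d _ hε).mpr fun i => ?_
    obtain ⟨N, hN, h⟩ := mem_divisionGroup_bot.mp (hy i)
    refine (ptNorm_add_le d (y i) (ξ i)).trans ?_
    rw [ptNorm_eq_zero_of_torsion d hN h, zero_add]
    exact (hnorm_le_iff d ξ hε).mp hξ i
  · intro hx
    exact ⟨0, fun i => zero_mem _, x, hx, zero_add x⟩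

/-! ### The approximation argument -/

/-- A point near the kernel of `φ` is near the kernel of every approximation `ψ` of `φ`. -/
lemma mem_ker_add_thickening_of_approx {r : ℕ} {Γ : AddSubgroup (Pow E g)}
    {φ ψ : Matrix (Fin r) (Fin g) ℤ} {σ : Fin r → Fin g} (hσ : Function.Injective σ) {a : ℤ}
    {f Q : ℕ} (ha : 0 < a) (hf : 0 < f) (hQ : 0 < Q)
    (hφ : φ.submatrix id σ = a • (1 : Matrix (Fin r) (Fin r) ℤ))
    (hψ : ψ.submatrix id σ = (f : ℤ) • (1 : Matrix (Fin r) (Fin r) ℤ))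
    (happ : ∀ i j, |a * ψ i j - f * φ i j| * Q ≤ a) {x : Pow E g} {K δ : ℝ}
    (hxK : hnorm d x ≤ K) (hδ : 0 ≤ δ)
    (hx : x ∈ (kerSubgroup E φ : Set (Pow E g)) + thickening d Γ δ) :
    x ∈ (kerSubgroup E ψ : Set (Pow E g)) +
      thickening d Γ (δ + (g - r : ℕ) * (K + δ) / (Q * f)) := by
  classical
  obtain ⟨b, hb, _, ⟨y, hy, ξ, hξ, rfl⟩, rfl⟩ := hx
  set x : Pow E g := b + (y + ξ) with hxdef
  have hf0 : (f : ℤ) ≠ 0 := by exact_mod_cast hf.ne'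
  have hξ' (j) : ptNorm d (ξ j) ≤ δ := (hnorm_le_iff d ξ hδ).mp hξ j
  have hx' (j) : ptNorm d (x j) ≤ K := (ptNorm_le_hnorm d x j).trans hxK
  have hK : 0 ≤ K := (Real.sqrt_nonneg _).trans hxK
  have hQ' : (0 : ℝ) < Q := Nat.cast_pos.mpr hQ
  have hf' : (0 : ℝ) < f := Nat.cast_pos.mpr hf
  have ha' : (0 : ℝ) < a := Int.cast_pos.mpr ha
  have hφσ := submatrix_eq_smul_one_iff.mp hφ
  have hψσ := submatrix_eq_smul_one_iff.mp hψ
  let D : Matrix (Fin r) (Fin g) ℤ := a • ψ - (f : ℤ) • φ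
  have hD (i j) : D i j = a * ψ i j - f * φ i j := rfl
  have hDσ (i j) : D i (σ j) = 0 := by
    rw [hD, hψσ, hφσ]
    split_ifs <;> ring
  -- The correction `v` satisfies `a f v = D(x - ξ)`; it will be placed in the columns `σ`, where
  -- `ψ` acts as multiplication by `f`.
  choose v hv using fun i => exists_zsmul_eq (mul_ne_zero ha.ne' hf0) (toHom E D (x - ξ) i)
  let extend (z : Fin r → Pt E) : Pow E g := ∑ i, Pi.single (σ i) (z i)
  have hext (z : Fin r → Pt E) (i : Fin r) : extend z (σ i) = z i := by
    simp only [extend, Finset.sum_apply]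
    rw [Finset.sum_eq_single i (fun k _ hk => Pi.single_eq_of_ne (hσ.ne hk.symm) _) (by simp),
      Pi.single_eq_same]
  have hext' (z : Fin r → Pt E) (j : Fin g) (hj : j ∉ Set.range σ) : extend z j = 0 := by
    simp only [extend, Finset.sum_apply]
    exact Finset.sum_eq_zero fun k _ => Pi.single_eq_of_ne (fun h => hj ⟨k, h.symm⟩) _
  have hψext (z : Fin r → Pt E) (i : Fin r) : toHom E ψ (extend z) i = (f : ℤ) • z i := by
    simp only [extend, map_sum, Finset.sum_apply]
    rw [Finset.sum_eq_single i (fun k _ hk => ?_) (by simp), toHom_single, hψσ, if_pos rfl]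
    rw [toHom_single, hψσ, if_neg hk.symm]
    exact zero_zsmul _
  -- After multiplication by `a`, the contribution of `D` cancels against `v`, and what remains is
  -- `f • φ(y)`, whose coordinates are in `Γ₀`.
  have hG (i : Fin r) : toHom E ψ (x - ξ - extend v) i ∈ divisionGroup Γ := by
    refine mem_divisionGroup_of_zsmul_mem ha.ne' ?_
    have h1 : a • toHom E ψ (x - ξ) i = (f : ℤ) • toHom E φ (x - ξ) i + toHom E D (x - ξ) i := by
      have := congrFun (toHom_sub (a • ψ) ((f : ℤ) • φ) (x - ξ)) i
      rw [toHom_smul, toHom_smul] at this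
      change toHom E D (x - ξ) i = a • toHom E ψ (x - ξ) i - (f : ℤ) • toHom E φ (x - ξ) i at this
      rw [this, add_sub_cancel]
    have h2 : toHom E φ (x - ξ) = toHom E φ y := by
      have : x - ξ = b + y := by rw [hxdef]; abel
      rw [this, map_add, show toHom E φ b = 0 from hb, zero_add]
    rw [map_sub, Pi.sub_apply, zsmul_sub, h1, hψext, h2, ← hv i, ← mul_zsmul, add_sub_cancel_right]
    refine zsmul_mem ?_ _
    rw [toHom_apply]
    exact sum_mem fun j _ => zsmul_mem (hy j) _
  -- The remaining value of `ψ` is divided by `f` within `Γ₀` and becomes part of the `Γ₀^g`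
  -- component.
  choose u hu using fun i => exists_zsmul_eq hf0 (toHom E ψ (x - ξ - extend v) i)
  have hker : x - ξ - extend v - extend u ∈ kerSubgroup E ψ := by
    funext i
    rw [map_sub, Pi.sub_apply, hψext, hu, sub_self]
    rfl
  -- `D` vanishes in the columns `σ`, so only `g - r` terms contribute, each at most `(a / Q)(K +
  -- δ)`.
  have hbound (i : Fin r) : ptNorm d (v i) ≤ (g - r : ℕ) * (K + δ) / (Q * f) := by
    have hterm (j : Fin g) : ptNorm d (D i j • (x - ξ) j) ≤
        if j ∈ Set.range σ then 0 else a / Q * (K + δ) := by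
      split_ifs with hj
      · obtain ⟨j, rfl⟩ := hj
        rw [hDσ, ptNorm_zsmul]
        simp
      · rw [ptNorm_zsmul]
        refine mul_le_mul ?_ ?_ (ptNorm_nonneg _ _) (by positivity)
        · rw [le_div_iff₀ hQ', ← Int.cast_abs, hD]
          exact_mod_cast happ i j
        · rw [Pi.sub_apply, sub_eq_add_neg]
          refine (ptNorm_add_le d _ _).trans (add_le_add (hx' j) ?_)
          rw [ptNorm_neg]
          exact hξ' j
    have hcard : (Finset.univ.filter fun j => j ∉ Set.range σ).card = g - r := by
      rw [← Fintype.card_subtype, Fintype.card_subtype_compl, Fintype.card_fin]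
      congr 1
      exact (Set.card_range_of_injective hσ).trans (Fintype.card_fin r)
    have h1 : ptNorm d (toHom E D (x - ξ) i) ≤ (g - r : ℕ) * (a / Q * (K + δ)) := by
      rw [toHom_apply]
      refine (ptNorm_sum_le d _ _).trans ((Finset.sum_le_sum fun j _ => hterm j).trans ?_)
      rw [Finset.sum_ite, Finset.sum_const_zero, zero_add, Finset.sum_const, hcard, nsmul_eq_mul]
    rw [← hv i, ptNorm_zsmul, Int.cast_mul, abs_of_pos (by positivity)] at h1
    rw [le_div_iff₀ (by positivity)]
    have h2 : a * (ptNorm d (v i) * (Q * f)) ≤ a * ((g - r : ℕ) * (K + δ)) := by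
      calc a * (ptNorm d (v i) * (Q * f)) = (a * (f : ℤ) * ptNorm d (v i)) * Q := by
            push_cast; ring
        _ ≤ (g - r : ℕ) * (a / Q * (K + δ)) * Q := mul_le_mul_of_nonneg_right h1 hQ'.le
        _ = a * ((g - r : ℕ) * (K + δ)) := by field_simp
    exact le_of_mul_le_mul_left h2 ha'
  refine ⟨_, hker, extend u + (ξ + extend v), ⟨extend u, fun j => ?_, ξ + extend v, ?_, rfl⟩, ?_⟩
  · by_cases hj : j ∈ Set.range σ
    · obtain ⟨i, rfl⟩ := hj
      rw [hext]
      exact mem_divisionGroup_of_zsmul_mem hf0 (by rw [hu]; exact hG i)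
    · rw [hext' u j hj]
      exact zero_mem _
  · refine (hnorm_le_iff d _ (by positivity)).mpr fun j => ?_
    by_cases hj : j ∈ Set.range σ
    · obtain ⟨i, rfl⟩ := hj
      rw [Pi.add_apply, hext]
      exact (ptNorm_add_le d _ _).trans (add_le_add (hξ' _) (hbound i))
    · rw [Pi.add_apply, hext' v j hj, add_zero]
      exact (hξ' j).trans (le_add_of_nonneg_right (by positivity))
  · change x - ξ - extend v - extend u + (extend u + (ξ + extend v)) = x
    abel

/-- The difference between a point of the kernel and a point of the neutral component is torsion, so
it passes into `Γ₀^g` without enlarging the radius. -/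
lemma mem_SSet_of_mem_ker_add_thickening {r : ℕ} (hr : 2 ≤ r) {V : Set (Pow E g)}
    {Γ : AddSubgroup (Pow E g)} {φ : Matrix (Fin r) (Fin g) ℤ} {a : ℤ} {σ : Fin r → Fin g}
    (ha : a ≠ 0) (hφ : φ.submatrix id σ = a • (1 : Matrix (Fin r) (Fin r) ℤ)) {δ : ℝ}
    {x : Pow E g} (hxV : x ∈ V)
    (hx : x ∈ (kerSubgroup E φ : Set (Pow E g)) + thickening d Γ δ) :
    x ∈ SSet 2 V (thickening d Γ δ) := by
  obtain ⟨b, hb, _, ⟨y, hy, ξ, hξ, rfl⟩, rfl⟩ := hx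
  obtain ⟨B, hB, hdim, b', hb', hbb'⟩ := exists_isAbelianSubvariety_of_mem_ker ha hφ hr hb
  refine ⟨hxV, B, hB, hdim, b', hb', (b - b' + y) + ξ, ⟨b - b' + y, fun i => ?_, ξ, hξ, rfl⟩, ?_⟩
  · exact add_mem (mem_divisionGroup_of_torsion Γ ha (congrFun hbb' i)) (hy i)
  · change b' + (b - b' + y + ξ) = b + (y + ξ)
    abel

/-- The common core of both inclusions: points near the kernel of a matrix with a submatrix `a • 1`
in given columns are near the kernel of one of bounded height with the same shape. -/
lemma exists_matHeight_le_mem_ker_add_thickening {r : ℕ} (hr : 2 ≤ r) {V : Set (Pow E g)}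
    {Γ : AddSubgroup (Pow E g)} {ε₁ : ℝ} (hS : HasBoundedHeight d (SSet 2 V (thickening d Γ ε₁)))
    {ε : ℝ} (hε : 0 < ε) (hεε₁ : ε ≤ ε₁) {n M : ℕ} (hn : n = r * g - r ^ 2 + 1)
    (hM : M = heightBound n (setNorm d (SSet 2 V (thickening d Γ ε₁))) ε)
    {φ : Matrix (Fin r) (Fin g) ℤ} {a : ℤ} {σ : Fin r → Fin g} (hσ : Function.Injective σ)
    (ha : a ≠ 0) (hφ : φ.submatrix id σ = a • (1 : Matrix (Fin r) (Fin r) ℤ))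
    (hφa : (matHeight φ : ℤ) = a) (hprim : IsPrimitive φ) {x : Pow E g} (hxV : x ∈ V)
    (hx : x ∈ (kerSubgroup E φ : Set (Pow E g)) + thickening d Γ (ε / radiusPow n M)) :
    ∃ (ψ : Matrix (Fin r) (Fin g) ℤ) (b : ℤ), b ≠ 0 ∧
      ψ.submatrix id σ = b • (1 : Matrix (Fin r) (Fin r) ℤ) ∧ (matHeight ψ : ℤ) = b ∧
      IsPrimitive ψ ∧ matHeight ψ ≤ M ∧
      x ∈ (kerSubgroup E ψ : Set (Pow E g)) +
        thickening d Γ (g * ε / radiusPow n (matHeight ψ)) := by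
  have hrg : r ≤ g := by simpa using Fintype.card_le_of_injective σ hσ
  have hn0 : 0 < n := by omega
  have hsub : r * g - r ^ 2 = r * (g - r) := by rw [sq, Nat.mul_sub]
  set K := setNorm d (SSet 2 V (thickening d Γ ε₁)) with hKdef
  set Q := max 2 (⌈K / ε⌉₊ ^ 2) with hQdef
  have hQ : 2 ≤ Q := le_max_left _ _
  have hM' : M = Q ^ n := hM
  have ha0 : 0 < a := by omega
  have hMpos : 0 < M := hM' ▸ Nat.pow_pos (by omega)
  -- If `H(φ) ≤ M`, then `ψ = φ` works because the radius only grows when `M` is replaced by `H(φ)`.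
  rcases le_or_gt (matHeight φ) M with hle | hlt
  · refine ⟨φ, a, ha, hφ, hφa, hprim, hle, Set.add_subset_add_left (thickening_mono Γ ?_) hx⟩
    have hH : 0 < matHeight φ := by omega
    have h1 := one_le_radiusPow n hH
    have hg1 : (1 : ℝ) ≤ g := by exact_mod_cast (by omega : 1 ≤ g)
    exact div_le_div₀ (by positivity) (le_mul_of_one_le_left hε.le hg1) (by linarith)
      (radiusPow_le_radiusPow n hle)
  · obtain ⟨f, ψ, hf, hfle, hψ, hψf, hψp, happ⟩ :=
      exists_primitive_approx (by omega : 0 < r) hσ ha0 hφ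
        (fun i j => hφa ▸ abs_le_matHeight φ i j) (by omega : 0 < Q)
    have hfM : f ≤ Q ^ n :=
      hfle.trans (Nat.pow_le_pow_right (by omega) (by omega))
    have hR := one_le_radiusPow n hMpos
    have hδ : 0 ≤ ε / radiusPow n M := by positivity
    -- The hypothesis of bounded height enters only here, to bound the norm of `x` by `K`.
    have hxS := mem_SSet_of_mem_ker_add_thickening hr ha hφ hxV
      (Set.add_subset_add_left (thickening_mono Γ ((div_le_self hε.le hR).trans hεε₁)) hx)
    have hxK : hnorm d x ≤ K := hnorm_le_setNorm hS hxS
    have hKQ : K ≤ ε * √Q := by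
      rw [← div_le_iff₀' hε]
      refine Real.le_sqrt_of_sq_le ?_
      calc (K / ε) ^ 2 ≤ (⌈K / ε⌉₊ : ℝ) ^ 2 :=
            pow_le_pow_left₀ (div_nonneg (Real.sqrt_nonneg _) hε.le) (Nat.le_ceil _) 2
        _ ≤ Q := by exact_mod_cast le_max_right _ _
    have key := mem_ker_add_thickening_of_approx hσ ha0 hf (by omega : 0 < Q) hφ hψ happ hxK hδ hx
    refine ⟨ψ, f, by omega, hψ, by exact_mod_cast hψf, hψp, by omega,
      Set.add_subset_add_left (thickening_mono Γ ?_) key⟩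
    have hk : g - r ≤ n := by
      have := Nat.le_mul_of_pos_left (g - r) (by omega : 0 < r)
      omega
    rw [hψf, hM']
    refine (radius_estimate hn0 hQ hf hfM hk hε hKQ).trans ?_
    have hR' := one_le_radiusPow n hf
    refine div_le_div_of_nonneg_right (mul_le_mul_of_nonneg_right ?_ hε.le) (by linarith)
    -- Here `r ≥ 2` is needed: the two extra error terms fit into the factor `g`.
    exact_mod_cast (by omega : g - r + 2 ≤ g)

end EllipticPower

end

namespace EllipticPower

/-! ### Special morphisms -/

lemma blockMatrix_castAdd {r g s : ℕ} (N : ℕ) (φ : Matrix (Fin r) (Fin g) ℤ)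
    (φ' : Matrix (Fin r) (Fin s) ℤ) (i : Fin r) (j : Fin g) :
    blockMatrix N φ φ' i (Fin.castAdd s j) = N * φ i j :=
  Fin.append_left (fun j => (N : ℤ) * φ i j) (φ' i) j

/-- Special morphisms are those with a Gauss-reduced shape whose columns `σ` are among the first
`g`. -/
lemma isSpecial_iff {r g s : ℕ} (hr : 0 < r) {ψ : Matrix (Fin r) (Fin (g + s)) ℤ} :
    IsSpecial g s ψ ↔ IsPrimitive ψ ∧ ∃ (b : ℤ) (σ : Fin r ↪o Fin g), b ≠ 0 ∧
      ψ.submatrix id (fun i => Fin.castAdd s (σ i)) = b • (1 : Matrix (Fin r) (Fin r) ℤ) ∧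
      (matHeight ψ : ℤ) = b := by
  constructor
  · rintro ⟨N, φ, φ', hN, rfl, ⟨⟨a, σ, ha, hφ, hφa⟩, -⟩, hprim, hH⟩
    refine ⟨hprim, N * a, σ, mul_ne_zero (by omega) ha, ?_, ?_⟩
    · rw [submatrix_eq_smul_one_iff] at hφ ⊢
      intro i j
      rw [blockMatrix_castAdd, hφ, mul_ite, mul_zero]
    · rw [hH, Nat.cast_mul, hφa]
  · rintro ⟨hprim, b, σ, hb, hψ, hH⟩
    rw [submatrix_eq_smul_one_iff] at hψ
    let i₀ : Fin r := ⟨0, hr⟩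
    let F : Fin r × Fin g → ℤ := fun k => ψ k.1 (Fin.castAdd s k.2)
    -- `N` is the greatest common divisor of the entries in the first `g` columns, so the quotient
    -- `φ` is primitive.
    obtain ⟨G, hG, hG1⟩ := Finset.univ.extract_gcd F ⟨(i₀, σ i₀), Finset.mem_univ _⟩
    obtain ⟨N, hN⟩ : ∃ N : ℕ, (N : ℤ) = Finset.univ.gcd F :=
      ⟨_, Int.natAbs_of_nonneg (Int.nonneg_of_normalize_eq_self Finset.normalize_gcd)⟩
    rw [← hN] at hG
    let φ : Matrix (Fin r) (Fin g) ℤ := fun i j => G (i, j)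
    have hφ (i : Fin r) (j : Fin g) : ψ i (Fin.castAdd s j) = N * φ i j :=
      hG (i, j) (Finset.mem_univ _)
    have hc : b = N * φ i₀ (σ i₀) := by rw [← hφ, hψ, if_pos rfl]
    have hN0 : (N : ℤ) ≠ 0 := fun h0 => hb (by rw [hc, h0, zero_mul])
    have hNpos : (0 : ℤ) < N := by omega
    have hHφ : (matHeight φ : ℤ) = φ i₀ (σ i₀) := by
      refine matHeight_eq (i := i₀) (j := σ i₀) (fun i j => ?_) rfl
      have h1 := abs_le_matHeight ψ i (Fin.castAdd s j)
      rw [hH, hφ, hc, abs_mul, abs_of_pos hNpos] at h1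
      exact le_of_mul_le_mul_left h1 hNpos
    refine ⟨N, φ, fun i j => ψ i (Fin.natAdd g j), by omega, ?_,
      ⟨⟨φ i₀ (σ i₀), σ, ?_, ?_, hHφ⟩, ?_⟩, hprim, ?_⟩
    · ext i j
      refine Fin.addCases (fun j => ?_) (fun j => ?_) j
      · exact (hφ i j).trans (blockMatrix_castAdd N φ (fun i j => ψ i (Fin.natAdd g j)) i j).symm
      · exact (Fin.append_right (fun j => (N : ℤ) * φ i j) (fun j => ψ i (Fin.natAdd g j)) j).symm
    · intro h0
      exact hb (by rw [hc, h0, mul_zero])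
    · rw [submatrix_eq_smul_one_iff]
      intro i j
      refine mul_left_cancel₀ hN0 ?_
      rw [← hφ, hψ, mul_ite, mul_zero, ← hc]
    · intro t φ' ht
      refine isUnit_of_dvd_one ?_
      rw [← hG1]
      refine Finset.dvd_gcd fun k _ => ⟨φ' k.1 k.2, ?_⟩
      exact congrFun (congrFun ht k.1) k.2
    · have : (matHeight ψ : ℤ) = N * matHeight φ := by rw [hH, hHφ, hc]
      exact_mod_cast this

end EllipticPower

/-! ### The two inclusions -/

theorem propositionA
    (E : WeierstrassCurve EllipticPower.QBar) [E.IsElliptic] (hE : EllipticPower.NoCM E)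
    (d : ℕ) (hd : 3 ≤ d)
    (g : ℕ) (C : Set (EllipticPower.Pow E g))
    (hC : EllipticPower.IsIrreducibleCurve C) (hCt : EllipticPower.IsTransverse C)
    (Γ : AddSubgroup (EllipticPower.Pow E g)) (hΓ : EllipticPower.HasFiniteRank Γ)
    (r : ℕ) (hr : 2 ≤ r) :
    (∀ ε₁ : ℝ, 0 < ε₁ →
      EllipticPower.HasBoundedHeight d
        (EllipticPower.SSet 2 C (EllipticPower.thickening d Γ ε₁)) →
      ∀ ε : ℝ, 0 < ε → ε ≤ ε₁ →
      ∀ (K₁ : ℝ) (n M : ℕ),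
        K₁ = EllipticPower.setNorm d
          (EllipticPower.SSet 2 C (EllipticPower.thickening d Γ ε₁)) →
        n = r * g - r ^ 2 + 1 →
        M = EllipticPower.heightBound n K₁ ε →
        (⋃ φ ∈ {φ : Matrix (Fin r) (Fin g) ℤ | EllipticPower.IsGaussReduced φ},
          C ∩ ((EllipticPower.kerSubgroup E φ : Set (EllipticPower.Pow E g)) +
            EllipticPower.thickening d Γ (ε / EllipticPower.radiusPow n M))) ⊆
        ⋃ ψ ∈ {ψ : Matrix (Fin r) (Fin g) ℤ |
            EllipticPower.IsGaussReduced ψ ∧ EllipticPower.matHeight ψ ≤ M},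
          C ∩ ((EllipticPower.kerSubgroup E ψ : Set (EllipticPower.Pow E g)) +
            EllipticPower.thickening d Γ
              (g * ε / EllipticPower.radiusPow n (EllipticPower.matHeight ψ)))) ∧
    (∀ (s : ℕ) (γ : EllipticPower.Pow E s), EllipticPower.IsMaximalFreeSet Γ γ →
      ∀ ε₂ : ℝ, 0 < ε₂ →
      EllipticPower.HasBoundedHeight d
        (EllipticPower.SSet 2 (EllipticPower.prodPoint C γ)
          (EllipticPower.smallPts E d (g + s) ε₂)) →
      ∀ ε : ℝ, 0 < ε → ε ≤ ε₂ →
      ∀ (K₂ : ℝ) (n M' : ℕ),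
        K₂ = EllipticPower.setNorm d
          (EllipticPower.SSet 2 (EllipticPower.prodPoint C γ)
            (EllipticPower.smallPts E d (g + s) ε₂)) →
        n = r * (g + s) - r ^ 2 + 1 →
        M' = EllipticPower.heightBound n K₂ ε →
        (⋃ φ ∈ {φ : Matrix (Fin r) (Fin (g + s)) ℤ | EllipticPower.IsSpecial g s φ},
          EllipticPower.prodPoint C γ ∩
            ((EllipticPower.kerSubgroup E φ : Set (EllipticPower.Pow E (g + s))) +
              EllipticPower.smallPts E d (g + s) (ε / EllipticPower.radiusPow n M'))) ⊆
        ⋃ ψ ∈ {ψ : Matrix (Fin r) (Fin (g + s)) ℤ |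
            EllipticPower.IsSpecial g s ψ ∧ EllipticPower.matHeight ψ ≤ M'},
          EllipticPower.prodPoint C γ ∩
            ((EllipticPower.kerSubgroup E ψ : Set (EllipticPower.Pow E (g + s))) +
              EllipticPower.smallPts E d (g + s)
                ((g + s) * ε /
                  EllipticPower.radiusPow n (EllipticPower.matHeight ψ)))) := by
  refine ⟨fun ε₁ _ hS ε hε hεε₁ K n M hK hn hM => ?_,
    fun s γ _ ε₂ hε₂ hS ε hε hεε₂ K n M hK hn hM => ?_⟩
  · subst hK
    simp only [Set.iUnion_subset_iff, Set.mem_ofPred_eq]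
    rintro φ ⟨⟨a, σ, ha, hφ, hφa⟩, hprim⟩ x ⟨hxC, hx⟩
    obtain ⟨ψ, b, hb, hψ, hψb, hψp, hψM, hxψ⟩ :=
      EllipticPower.exists_matHeight_le_mem_ker_add_thickening hr hS hε hεε₁ hn hM σ.injective ha
        hφ hφa hprim hxC hx
    exact Set.mem_biUnion (x := ψ) ⟨⟨⟨b, σ, hb, hψ, hψb⟩, hψp⟩, hψM⟩ ⟨hxC, hxψ⟩
  · subst hK
    have hr0 : 0 < r := by omega
    have hpos (H : ℕ) : 0 ≤ EllipticPower.radiusPow n H := Real.rpow_nonneg (Nat.cast_nonneg H) _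
    simp only [Set.iUnion_subset_iff, Set.mem_ofPred_eq]
    rintro φ hφs x ⟨hxC, hx⟩
    obtain ⟨hprim, a, σ, ha, hφ, hφa⟩ := (EllipticPower.isSpecial_iff hr0).mp hφs
    -- The common argument applies in `E^(g+s)` with the trivial subgroup. It keeps the
    -- distinguished columns, which stay among the first `g`, so `ψ` is again special.
    rw [← EllipticPower.thickening_bot hε₂.le] at hS hM
    rw [← EllipticPower.thickening_bot (div_nonneg hε.le (hpos M))] at hx
    obtain ⟨ψ, b, hb, hψ, hψb, hψp, hψM, hxψ⟩ :=
      EllipticPower.exists_matHeight_le_mem_ker_add_thickening hr hS hε hεε₂ hn hM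
        ((Fin.castAdd_injective g s).comp σ.injective) ha hφ hφa hprim hxC hx
    refine Set.mem_biUnion (x := ψ)
      ⟨(EllipticPower.isSpecial_iff hr0).mpr ⟨hψp, b, σ, hb, hψ, hψb⟩, hψM⟩ ⟨hxC, ?_⟩
    rw [EllipticPower.thickening_bot (div_nonneg (by positivity) (hpos _)), Nat.cast_add] at hxψ
    exact hxψ
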